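/- **Setting.** Let $d\ge 1$, let $\nu$ be the surface measure on the unit sphere $\mathbb S^d\subset\mathbb R^{d+1}$ and $\mu$ the normalized Haar measure on $SO(d+1)$. For $l\ge 0$ let $N(d,l)$ be the dimension of the space of spherical harmonics of order $l$ (restrictions to $\mathbb S^d$ of complex harmonic homogeneous polynomials of degree $l$ in $d+1$ variables), and let $\{B^l_q:1\le q\le N(d,l)\}$ be an orthonormal basis of it in $L^2((\mathbb S^d,\nu),\mathbb C)$. For $g:SO(d+1)\to\mathbb R$ let $\tilde\phi^l(g)$ be the $N(d,l)\times N(d,l)$ matrix with entries $$\tilde\phi^l_{qr}(g)=\int_{SO(d+1)}g(u)D^l_{qr}(u)\,d\mu(u),\qquad D^l_{qr}(u)=\int_{\mathbb S^d}\overline{B^l_q(ux)}\,B^l_r(x)\,d\nu(x).$$ Let $X$ be a random point of $\mathbb S^d$ with density $f_X$ with respect to $\nu$, and let $U$ be a random element of $SO(d+1)$, independent of $X$, with square integrable density $f_U$ with respect to $\mu$ such that every matrix $\tilde\phi^l(f_U)$, $l\ge0$, is invertible. Let $Z_1,Z_2,\dots$ be i.i.d. copies of $Z=UX$. Let $T_n>0$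 with $T_n\to\infty$, and put $$K_{T}(x,z)=\sum_{l=0}^{[T]}\sum_{q=1}^{N(d,l)}\Big(\sum_{r=1}^{N(d,l)}\big((\tilde\phi^l(f_U))^{-1}\big)_{qr}\overline{B^l_r(z)}\Big)B^l_q(x),\qquad \hat f_X(x)=\frac1n\sum_{i=1}^n\mathrm{Re}\,K_{T_n}(x,Z_i).$$ For the regression statements, suppose moreover that $Y=m(X)+\epsilon$ with $m:\mathbb S^d\to\mathbb R$, $\epsilon$ integrable, $E(\epsilon\mid X)=0$, $U$ independent of $(X,\epsilon)$, and that $(Y_1,Z_1),(Y_2,Z_2),\dots$ are i.i.d. copies of $(Y,Z)$. Put $$\hat m(x)=\hat f_X(x)^{-1}\,\frac1n\sum_{i=1}^n\mathrm{Re}\big(K_{T_n}(x,Z_i)\big)Y_i .$$ Let $\|\cdot\|_{\rm op}$ be the operator norm for the standard Hermitian norm. **Theorem.** Assume $f_X\in C^{2k}(\mathbb S^d)$ for some $k\in\mathbb N$ with $k>d/4$. (a) Suppose that, for some $\beta\ge0$ and $c_1>0$, $\|(\tilde\phi^l(f_U))^{-1}\|_{\rm op}\le c_1l^\beta$ for all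 $l\ge1$, and $n^{-1/2}T_n^{\beta+d}\to0$. Then $$\int_{\mathbb S^d}|\hat f_X-f_X|^2d\nu=O_p\big(T_n^{-4k}+n^{-1}T_n^{2\beta+d}\big).$$ (b) Suppose that, for some $\beta,\gamma,c_1>0$ and $\alpha\in\mathbb R$, $\|(\tilde\phi^l(f_U))^{-1}\|_{\rm op}\le c_1l^\alpha\exp(\gamma l^\beta)$ for all $l\ge1$, and $n^{-1/2}T_n^{\alpha+d}\exp(\gamma T_n^\beta)\to0$. Then $$\int_{\mathbb S^d}|\hat f_X-f_X|^2d\nu=O_p\big(T_n^{-4k}+n^{-1}T_n^{2\alpha+d}\exp(2\gamma T_n^\beta)\big).$$ (c) Suppose that, for some $\beta,\gamma,c_1>0$ and $\alpha,\xi_1\in\mathbb R$, $\|(\tilde\phi^l(f_U))^{-1}\|_{\rm op}\le c_1l^\alpha\exp(\gamma l^\beta(\log l-\xi_1))$ for all $l\ge1$, and $n^{-1/2}T_n^{\alpha+d}\exp(\gamma T_n^\beta(\log T_n-\xi_1))\to0$. Then $$\int_{\mathbb S^d}|\hat f_X-f_X|^2d\nu=O_p\big(T_n^{-4k}+n^{-1}T_n^{2\alpha+d}\exp(2\gamma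 T_n^\beta(\log T_n-\xi_1))\big).$$ In each of (a), (b), (c), if in addition $m\in C^{2k}(\mathbb S^d)$, $f_X$ is bounded away from zero on $\mathbb S^d$ and $E(Y^2\mid X=\cdot)$ is bounded, then $\int_{\mathbb S^d}|\hat m-m|^2d\nu$ is $O_p$ of the same rate. -/

import Mathlib

open MeasureTheory ProbabilityTheory Filter Topology
open scoped ENNReal Manifold ComplexConjugate

noncomputable section

namespace SphereDeconv

/-- The unit sphere `S^d` of `ℝ^{d+1}`. -/
abbrev Sph (d : ℕ) : Type := Metric.sphere (0 : EuclideanSpace ℝ (Fin (d + 1))) 1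

/-- The surface measure on `S^d`: `ν(A) = (d+1) · Leb(cone over A)`, so that `ν(S^d)` is the
surface area of `S^d`. -/
def nu (d : ℕ) : Measure (Sph d) :=
  (volume : Measure (EuclideanSpace ℝ (Fin (d + 1)))).toSphere

/-! ### The rotation group and its normalized Haar measure -/

/-- The special orthogonal group `SO(d+1)`. -/
abbrev Rot (d : ℕ) : Type := Matrix.specialOrthogonalGroup (Fin (d + 1)) ℝ

/-- `SO(d+1)` carries its Borel σ-algebra. -/
instance instMeasurableSpaceRot (d : ℕ) : MeasurableSpace (Rot d) := borel _

instance instBorelSpaceRot (d : ℕ) : BorelSpace (Rot d) := ⟨rfl⟩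

theorem Rot.mul_transpose {d : ℕ} (u : Rot d) :
    (u : Matrix (Fin (d + 1)) (Fin (d + 1)) ℝ) * (u : Matrix (Fin (d + 1)) (Fin (d + 1)) ℝ).transpose
      = 1 :=
  (Matrix.mem_orthogonalGroup_iff _ _).1 (Matrix.mem_specialOrthogonalGroup_iff.1 u.2).1

theorem Rot.transpose_mul {d : ℕ} (u : Rot d) :
    (u : Matrix (Fin (d + 1)) (Fin (d + 1)) ℝ).transpose * (u : Matrix (Fin (d + 1)) (Fin (d + 1)) ℝ)
      = 1 :=
  (Matrix.mem_orthogonalGroup_iff' _ _).1 (Matrix.mem_specialOrthogonalGroup_iff.1 u.2).1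

instance instIsTopologicalGroupRot (d : ℕ) : IsTopologicalGroup (Rot d) where
  continuous_mul := by
    refine Continuous.subtype_mk ?_ _
    exact (continuous_subtype_val.comp continuous_fst).mul
      (continuous_subtype_val.comp continuous_snd)
  continuous_inv := by
    refine Continuous.subtype_mk ?_ _
    exact continuous_subtype_val.matrix_transpose

theorem isClosed_rot (d : ℕ) :
    IsClosed {A : Matrix (Fin (d + 1)) (Fin (d + 1)) ℝ |
      A ∈ Matrix.specialOrthogonalGroup (Fin (d + 1)) ℝ} := by
  have h : {A : Matrix (Fin (d + 1)) (Fin (d + 1)) ℝ |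
      A ∈ Matrix.specialOrthogonalGroup (Fin (d + 1)) ℝ}
      = {A | A * A.transpose = 1} ∩ {A | A.det = 1} := by
    ext A
    simp only [Set.mem_ofPred_eq, Set.mem_inter_iff, Matrix.mem_specialOrthogonalGroup_iff,
      Matrix.mem_orthogonalGroup_iff]
  rw [h]
  refine IsClosed.inter (isClosed_eq ?_ continuous_const) (isClosed_eq ?_ continuous_const)
  · exact continuous_id.mul continuous_id.matrix_transpose
  · exact continuous_id.matrix_det

instance instCompactSpaceRot (d : ℕ) : CompactSpace (Rot d) := by
  suffices h : IsCompact {A : Matrix (Fin (d + 1)) (Fin (d + 1)) ℝ |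
      A ∈ Matrix.specialOrthogonalGroup (Fin (d + 1)) ℝ} from isCompact_iff_compactSpace.1 h
  have hK : IsCompact (Set.univ.pi fun _ : Fin (d + 1) =>
      Set.univ.pi fun _ : Fin (d + 1) => Set.Icc (-1 : ℝ) 1) :=
    isCompact_univ_pi fun _ => isCompact_univ_pi fun _ => isCompact_Icc
  refine IsCompact.of_isClosed_subset hK (isClosed_rot d) ?_
  intro A hA i _ j _
  have h1 := congrFun (congrFun (Rot.mul_transpose ⟨A, hA⟩) i) i
  simp only [Matrix.mul_apply, Matrix.transpose_apply, Matrix.one_apply_eq] at h1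
  have h2 : A i j * A i j ≤ ∑ x, A i x * A i x :=
    Finset.single_le_sum (f := fun x => A i x * A i x) (fun x _ => mul_self_nonneg _)
      (Finset.mem_univ j)
  rw [h1] at h2
  exact ⟨by nlinarith, by nlinarith⟩

/-- The normalized (total mass one) Haar measure on `SO(d+1)`. -/
def mu (d : ℕ) : Measure (Rot d) := Measure.haarMeasure ⊤

instance instIsProbabilityMeasureMu (d : ℕ) : IsProbabilityMeasure (mu d) :=
  ⟨by simpa [mu] using Measure.haarMeasure_self (K₀ := (⊤ : TopologicalSpace.PositiveCompacts (Rot d)))⟩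

/-- The rotated point `u x`. -/
def rotate {d : ℕ} (u : Rot d) (x : Sph d) : Sph d :=
  ⟨WithLp.toLp 2 ((u : Matrix (Fin (d + 1)) (Fin (d + 1)) ℝ).mulVec x.1.ofLp), by
    have hx : x.1.ofLp ⬝ᵥ x.1.ofLp = 1 := by
      have h := x.2
      rw [mem_sphere_zero_iff_norm, EuclideanSpace.norm_eq, Real.sqrt_eq_one] at h
      simpa [dotProduct, sq] using h
    rw [mem_sphere_zero_iff_norm, EuclideanSpace.norm_eq, Real.sqrt_eq_one]
    have h3 : (u : Matrix (Fin (d + 1)) (Fin (d + 1)) ℝ).mulVec x.1.ofLp ⬝ᵥ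
        (u : Matrix (Fin (d + 1)) (Fin (d + 1)) ℝ).mulVec x.1.ofLp = 1 := by
      rw [Matrix.dotProduct_mulVec, Matrix.vecMul_mulVec, Rot.transpose_mul, Matrix.vecMul_one, hx]
    simpa [dotProduct, sq] using h3⟩

/-! ### Spherical harmonics -/

/-- The Laplacian `∑ᵢ ∂²/∂tᵢ²` on complex polynomials in `d+1` variables. -/
def polyLaplacian (d : ℕ) :
    MvPolynomial (Fin (d + 1)) ℂ →ₗ[ℂ] MvPolynomial (Fin (d + 1)) ℂ :=
  ∑ i, (MvPolynomial.pderiv i).toLinearMap ∘ₗ (MvPolynomial.pderiv i).toLinearMap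

/-- Restriction of a complex polynomial in `d+1` variables to `S^d`. -/
def restrictSph (d : ℕ) : MvPolynomial (Fin (d + 1)) ℂ →ₗ[ℂ] (Sph d → ℂ) :=
  LinearMap.pi fun x => (MvPolynomial.aeval fun i => ((x.1 i : ℝ) : ℂ)).toLinearMap

/-- The space of spherical harmonics of order `l` in `d+1` variables: the restrictions to `S^d` of
the harmonic homogeneous polynomials of degree `l`. -/
def sphHarm (d l : ℕ) : Submodule ℂ (Sph d → ℂ) :=
  (MvPolynomial.homogeneousSubmodule (Fin (d + 1)) ℂ l ⊓ LinearMap.ker (polyLaplacian d)).map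
    (restrictSph d)

/-- The dimension `N(d,l)` of the space of spherical harmonics of order `l`. -/
def sphDim (d l : ℕ) : ℕ := Module.finrank ℂ (sphHarm d l)

/-- `b` is an orthonormal basis of the space of spherical harmonics of order `l`, for the inner
product `∫ f ḡ dν`. -/
structure IsHarmONB (d l : ℕ) (b : Fin (sphDim d l) → Sph d → ℂ) : Prop where
  orthonormal : ∀ q r, ∫ x, b q x * conj (b r x) ∂(nu d) = if q = r then 1 else 0
  span_eq : Submodule.span ℂ (Set.range b) = sphHarm d l

/-! ### The rotational Fourier transform and the estimators

Throughout, `B l q` is the `q`-th element of the chosen orthonormal basis at degree `l`. -/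

/-- `D^l_{qr}(u) = ∫ conj (B^l_q(u x)) B^l_r(x) dν(x)`. -/
def rotCoeff {d : ℕ} (B : ∀ l, Fin (sphDim d l) → Sph d → ℂ) (l : ℕ) (q r : Fin (sphDim d l))
    (u : Rot d) : ℂ :=
  ∫ x, conj (B l q (rotate u x)) * B l r x ∂(nu d)

/-- The matrix of the rotational Fourier transform of `g` at degree `l`, with entries
`∫ g(u) D^l_{qr}(u) dμ(u)`. -/
def rotFourier {d : ℕ} (B : ∀ l, Fin (sphDim d l) → Sph d → ℂ) (g : Rot d → ℝ) (l : ℕ) :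
    Matrix (Fin (sphDim d l)) (Fin (sphDim d l)) ℂ :=
  Matrix.of fun q r => ∫ u, (g u : ℂ) * rotCoeff B l q r u ∂(mu d)

/-- The operator norm of a complex square matrix for the standard Hermitian norm. -/
def opNorm {N : ℕ} (A : Matrix (Fin N) (Fin N) ℂ) : ℝ := ‖Matrix.toEuclideanCLM (𝕜 := ℂ) A‖

/-- The deconvolution kernel
`K_T(x,z) = ∑_{l ≤ [T]} ∑_q (∑_r (φ̃^l(f_U))⁻¹_{qr} conj (B^l_r(z))) B^l_q(x)`. -/
def kernelK {d : ℕ} (B : ∀ l, Fin (sphDim d l) → Sph d → ℂ) (fU : Rot d → ℝ) (T : ℝ)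
    (x z : Sph d) : ℂ :=
  ∑ l ∈ Finset.range (⌊T⌋₊ + 1), ∑ q, (∑ r, (rotFourier B fU l)⁻¹ q r * conj (B l r z)) * B l q x

/-- The deconvolution density estimator from `z 0, …, z (n-1)`. -/
def fHat {d : ℕ} (B : ∀ l, Fin (sphDim d l) → Sph d → ℂ) (fU : Rot d → ℝ) (T : ℝ) (n : ℕ)
    (z : ℕ → Sph d) (x : Sph d) : ℝ :=
  (n : ℝ)⁻¹ * ∑ i ∈ Finset.range n, (kernelK B fU T x (z i)).re

/-- The deconvolution regression estimator from `(y 0, z 0), …, (y (n-1), z (n-1))`. -/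
def mHat {d : ℕ} (B : ∀ l, Fin (sphDim d l) → Sph d → ℂ) (fU : Rot d → ℝ) (T : ℝ) (n : ℕ)
    (z : ℕ → Sph d) (y : ℕ → ℝ) (x : Sph d) : ℝ :=
  (fHat B fU T n z x)⁻¹ * ((n : ℝ)⁻¹ * ∑ i ∈ Finset.range n, (kernelK B fU T x (z i)).re * y i)

/-- The integrated squared error `∫ |g - f|² dν`, as an element of `[0,∞]`. -/
def ise {d : ℕ} (g f : Sph d → ℝ) : ℝ≥0∞ := ∫⁻ x, ENNReal.ofReal (|g x - f x| ^ 2) ∂(nu d)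

/-! ### The statistical model -/

/-- The measurement error model: `X` has density `fX` with respect to `ν`, `U` has a square
integrable density `fU` with respect to `μ`, `U` is independent of `X`, and `Z 0, Z 1, …` are
i.i.d. copies of `U X`. -/
structure IsErrorModel {d : ℕ} {Ω : Type*} [MeasurableSpace Ω] (P : Measure Ω)
    (X : Ω → Sph d) (U : Ω → Rot d) (fX : Sph d → ℝ) (fU : Rot d → ℝ) (Z : ℕ → Ω → Sph d) :
    Prop where
  measurable_X : Measurable X
  measurable_U : Measurable U
  fX_nonneg : ∀ x, 0 ≤ fX x
  map_X : P.map X = (nu d).withDensity fun x => ENNReal.ofReal (fX x)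
  fU_nonneg : ∀ u, 0 ≤ fU u
  fU_memLp : MemLp fU 2 (mu d)
  map_U : P.map U = (mu d).withDensity fun u => ENNReal.ofReal (fU u)
  indep_UX : IndepFun U X P
  iIndep_Z : iIndepFun Z P
  identDistrib_Z : ∀ i, IdentDistrib (Z i) (fun ω => rotate (U ω) (X ω)) P P

/-- The regression model: `E(ε | X) = 0`, `U` is independent of `(X, ε)`, and
`(Y 0, Z 0), (Y 1, Z 1), …` are i.i.d. copies of `(m(X) + ε, U X)`. -/
structure IsRegressionModel {d : ℕ} {Ω : Type*} [MeasurableSpace Ω] (P : Measure Ω)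
    (X : Ω → Sph d) (U : Ω → Rot d) (m : Sph d → ℝ) (ε : Ω → ℝ) (Z : ℕ → Ω → Sph d)
    (Y : ℕ → Ω → ℝ) : Prop where
  measurable_m : Measurable m
  measurable_ε : Measurable ε
  integrable_ε : Integrable ε P
  condExp_ε : P[ε | MeasurableSpace.comap X inferInstance] =ᵐ[P] 0
  indep_U : IndepFun U (fun ω => (X ω, ε ω)) P
  iIndep_YZ : iIndepFun (fun i ω => (Y i ω, Z i ω)) P
  identDistrib_YZ : ∀ i, IdentDistrib (fun ω => (Y i ω, Z i ω))
    (fun ω => (m (X ω) + ε ω, rotate (U ω) (X ω))) P P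

/-- `E(W² | X = ·)` is finite and bounded. -/
def BoundedCondSecondMoment {d : ℕ} {Ω : Type*} [MeasurableSpace Ω] (P : Measure Ω)
    (X : Ω → Sph d) (W : Ω → ℝ) : Prop :=
  Integrable (fun ω => W ω ^ 2) P ∧
    ∃ C : ℝ, ∀ᵐ ω ∂P, (P[fun ω => W ω ^ 2 | MeasurableSpace.comap X inferInstance]) ω ≤ C

/-- `f ∈ C^s(S^d)`. -/
def IsCk {d : ℕ} (s : ℕ) (f : Sph d → ℝ) : Prop :=
  ContMDiff (𝓡 d) 𝓘(ℝ, ℝ) (s : WithTop ℕ∞) f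

/-- `V_n = O_p(r_n)`. -/
def IsBigOp {Ω : Type*} [MeasurableSpace Ω] (P : Measure Ω) (V : ℕ → Ω → ℝ≥0∞) (r : ℕ → ℝ) :
    Prop :=
  ∀ δ : ℝ, 0 < δ → ∃ M : ℝ, 0 < M ∧
    ∀ᶠ n in atTop, P {ω | ENNReal.ofReal (M * r n) < V n ω} ≤ ENNReal.ofReal δ

/-- For a truncation sequence `T` and a rate `r`: the density estimator has integrated squared
error `O_p(r)`, and so has the regression estimator in every regression model over the given error
model with `m ∈ C^{2k}(S^d)`, `fX` bounded away from zero and `E(Y² | X = ·)` bounded. -/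
def L2Rates {d : ℕ} {Ω : Type*} [MeasurableSpace Ω] (P : Measure Ω) (k : ℕ)
    (B : ∀ l, Fin (sphDim d l) → Sph d → ℂ)
    (X : Ω → Sph d) (U : Ω → Rot d) (fX : Sph d → ℝ) (fU : Rot d → ℝ) (Z : ℕ → Ω → Sph d)
    (T r : ℕ → ℝ) : Prop :=
  IsBigOp P (fun n ω => ise (fHat B fU (T n) n (fun i => Z i ω)) fX) r ∧
  ∀ (m : Sph d → ℝ) (ε : Ω → ℝ) (Y : ℕ → Ω → ℝ),
    IsRegressionModel P X U m ε Z Y →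
    IsCk (2 * k) m →
    (∃ c : ℝ, 0 < c ∧ ∀ x, c ≤ fX x) →
    BoundedCondSecondMoment P X (fun ω => m (X ω) + ε ω) →
    IsBigOp P (fun n ω => ise (mHat B fU (T n) n (fun i => Z i ω) (fun i => Y i ω)) m) r

end SphereDeconv

end

open SphereDeconv

noncomputable section

namespace SphereDeconv

/-! ### Harmonic polynomials and the angular Casimir operator -/

open MvPolynomial

/-! Both estimators are built from truncated spherical harmonic series with empirical coefficients.
A rotation maps the harmonics of order `l` to themselves, so `conj (B l q (u x))` is a combination
of the `conj (B l s x)` with coefficients `rotCoeff B l q s u`. Taking expectations, by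
independence, turns these coefficients into the matrix `rotFourier B fU l`; applying its inverse
makes the empirical coefficients unbiased (`integral_obsCoef`). With weight 1 they estimate the
coefficients of `fX`, with weight `Y` those of `m * fX`, because `E(ε | X) = 0`.

Variance. The coefficients are means of i.i.d. variables. At degree `l` the total variance is at
most `n⁻¹` times the second moment of the weight, times the squared operator norm of the inverse,
times the supremum of `∑ q, ‖B l q‖ ^ 2`. Rotation invariance makes this last sum constant
(`IsHarmONB.sum_norm_sq`), hence proportional to the dimension, which is at most `2 (l+1)^(d-1)`
(`sphDim_le`). Summing over degrees gives `varOrder`, and `varOrder_le` evaluates it under each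
growth condition. Markov's inequality then bounds the coefficient error in probability.

Bias. The sum of squares of the angular derivations `x_i ∂_j - x_j ∂_i` is twice the spherical
Laplacian. It is symmetric in `L²(ν)`, and by `casimir_eq` it acts on harmonics of order `l` as `-2
l (l+d-1)`. For a `C^{2k}` function, its coefficients times `(l (l+d-1))^k` are therefore the
coefficients of a continuous function, and Parseval bounds the squared tail beyond degree `T` by a
constant times `T^(-4k)`. Parseval needs completeness: polynomials are dense by Stone–Weierstrass,
and on the sphere each is a sum of harmonics (`restrictSph_mem_iSup`).

Ratio. The error of `mHat` is controlled by those of its numerator and of `fHat` once `fHat` is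
uniformly bounded below (`ise_ratio_le`). This uniform control combines a Cauchy–Schwarz bound,
which costs a factor `T^d` and is where the limit hypothesis on `T n` enters, with uniform
convergence of the harmonic series of `fX`, which is where `k > d/4` enters
(`tendsto_norm_sub_harmSum`). -/

theorem eq_C_of_isHomogeneous_zero {σ : Type*} {p : MvPolynomial σ ℂ} (hp : p.IsHomogeneous 0) :
    p = C (coeff 0 p) :=
  totalDegree_eq_zero_iff_eq_C.1 ((totalDegree_zero_iff_isHomogeneous σ (R := ℂ)).2 hp)

/-- The commutator of two derivations is a derivation, so it is enough that it kills the variables.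
-/
theorem pderiv_pderiv_comm {σ : Type*} (i j : σ) (p : MvPolynomial σ ℂ) :
    pderiv j (pderiv i p) = pderiv i (pderiv j p) := by
  classical
  have h : ⁅(pderiv j : Derivation ℂ (MvPolynomial σ ℂ) (MvPolynomial σ ℂ)),
      (pderiv i : Derivation ℂ (MvPolynomial σ ℂ) (MvPolynomial σ ℂ))⁆ = 0 := by
    ext k : 1
    simp [Derivation.commutator_apply, pderiv_X, Pi.single_apply, apply_ite]
  have := congrArg (fun D => D p) h
  simpa [Derivation.commutator_apply, sub_eq_zero] using this

/-- The angular derivation `x_i ∂_j - x_j ∂_i`. -/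
def angDeriv {d : ℕ} (i j : Fin (d + 1)) :
    Derivation ℂ (MvPolynomial (Fin (d + 1)) ℂ) (MvPolynomial (Fin (d + 1)) ℂ) :=
  (X i : MvPolynomial (Fin (d + 1)) ℂ) • pderiv j - (X j : MvPolynomial (Fin (d + 1)) ℂ) • pderiv i

theorem angDeriv_apply {d : ℕ} (i j : Fin (d + 1)) (p : MvPolynomial (Fin (d + 1)) ℂ) :
    angDeriv i j p = X i * pderiv j p - X j * pderiv i p := by
  simp [angDeriv]

/-- The sum of the squares of all angular derivations. -/
def casimir (d : ℕ) : MvPolynomial (Fin (d + 1)) ℂ →ₗ[ℂ] MvPolynomial (Fin (d + 1)) ℂ :=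
  ∑ i, ∑ j, (angDeriv i j).toLinearMap ∘ₗ (angDeriv i j).toLinearMap

theorem casimir_apply {d : ℕ} (p : MvPolynomial (Fin (d + 1)) ℂ) :
    casimir d p = ∑ i, ∑ j, angDeriv i j (angDeriv i j p) := by
  simp [casimir]

theorem polyLaplacian_apply {d : ℕ} (p : MvPolynomial (Fin (d + 1)) ℂ) :
    polyLaplacian d p = ∑ i, pderiv i (pderiv i p) := by
  simp [polyLaplacian]

/-- The polynomial `∑ x_i²`. -/
def radSq (d : ℕ) : MvPolynomial (Fin (d + 1)) ℂ := ∑ i, X i * X i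

/-- The eigenvalue `l (l + d - 1)` of minus the spherical Laplacian. -/
def lam (d l : ℕ) : ℕ := l * (l + d - 1)

theorem lam_cast {d : ℕ} (hd : 1 ≤ d) (l : ℕ) : (lam d l : ℂ) = l * (l + d - 1) := by
  unfold lam
  rw [Nat.cast_mul, Nat.cast_sub (by omega)]
  push_cast
  ring

theorem lam_strictMono {d : ℕ} (hd : 1 ≤ d) : StrictMono (lam d) := by
  intro a b hab
  unfold lam
  calc a * (a + d - 1) ≤ a * (b + d - 1) := Nat.mul_le_mul_left _ (by omega)
    _ < b * (b + d - 1) := Nat.mul_lt_mul_of_pos_right hab (by omega)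

theorem sq_le_lam {d : ℕ} (hd : 1 ≤ d) (l : ℕ) : l ^ 2 ≤ lam d l := by
  unfold lam
  rw [sq]
  exact Nat.mul_le_mul_left _ (by omega)

theorem angDeriv_radSq {d : ℕ} (i j : Fin (d + 1)) : angDeriv i j (radSq d) = 0 := by
  classical
  have h : ∀ k : Fin (d + 1), pderiv k (radSq d) = 2 * X k := by
    intro k
    simp only [radSq, map_sum, pderiv_mul, pderiv_X, Pi.single_apply]
    simp [Finset.sum_add_distrib]
    ring
  rw [angDeriv_apply, h, h]
  ring

/-- Every angular derivation kills `radSq`, which therefore behaves as a constant. -/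
theorem casimir_radSq_mul {d : ℕ} (p : MvPolynomial (Fin (d + 1)) ℂ) :
    casimir d (radSq d * p) = radSq d * casimir d p := by
  simp [casimir_apply, Derivation.leibniz, angDeriv_radSq, Finset.mul_sum]

theorem radSq_ne_zero (d : ℕ) : radSq d ≠ 0 := by
  intro h
  have := congrArg (MvPolynomial.eval (Pi.single 0 1)) h
  simp [radSq, Pi.single_apply] at this

theorem radSq_isHomogeneous (d : ℕ) : (radSq d).IsHomogeneous 2 :=
  IsHomogeneous.sum _ _ _ fun i _ => (isHomogeneous_X ℂ i).mul (isHomogeneous_X ℂ i)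

theorem polyLaplacian_isHomogeneous {d l : ℕ} {p : MvPolynomial (Fin (d + 1)) ℂ}
    (hp : p.IsHomogeneous l) : (polyLaplacian d p).IsHomogeneous (l - 2) := by
  rw [polyLaplacian_apply]
  exact IsHomogeneous.sum _ _ _ fun i _ => (hp.pderiv (i := i)).pderiv (i := i)

/-- Euler's identity, applied to the partial derivatives (of degree `l - 1`) and then to `p` itself.
-/
theorem sum_X_mul_X_mul_pderiv {d l : ℕ} {p : MvPolynomial (Fin (d + 1)) ℂ}
    (hp : p.IsHomogeneous l) :
    ∑ i, ∑ j, X i * X j * pderiv i (pderiv j p) = C ((l : ℂ) * (l - 1)) * p := by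
  rw [Finset.sum_comm]
  have h1 : ∀ j : Fin (d + 1), ∑ i, X i * X j * pderiv i (pderiv j p)
      = X j * (C ((l : ℂ) - 1) * pderiv j p) := by
    intro j
    have := (hp.pderiv (i := j)).sum_X_mul_pderiv
    simp_rw [mul_comm (X _ : MvPolynomial (Fin (d + 1)) ℂ) (X j), mul_assoc, ← Finset.mul_sum]
    rw [this]
    rcases Nat.eq_zero_or_pos l with rfl | hl
    · have : p = C (coeff 0 p) := eq_C_of_isHomogeneous_zero hp
      rw [this]
      simp
    · rw [nsmul_eq_mul, Nat.cast_sub hl]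
      simp
  have h2 := hp.sum_X_mul_pderiv
  rw [nsmul_eq_mul] at h2
  simp_rw [h1, mul_left_comm (X _ : MvPolynomial (Fin (d + 1)) ℂ), ← Finset.mul_sum]
  rw [h2]
  simp
  ring

/-- The squares are expanded, and the radial terms are evaluated by Euler's identity. The factors 2
arise because the sum runs over ordered pairs `(i, j)`. -/
theorem casimir_eq {d l : ℕ} (hd : 1 ≤ d) {p : MvPolynomial (Fin (d + 1)) ℂ}
    (hp : p.IsHomogeneous l) :
    casimir d p = 2 * (radSq d * polyLaplacian d p) - C (2 * (lam d l : ℂ)) * p := by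
  classical
  -- On the diagonal the left side is 0; the `if` term corrects the generic formula there.
  have h1 : ∀ i j : Fin (d + 1), angDeriv i j (angDeriv i j p)
      = X i * X i * pderiv j (pderiv j p) + X j * X j * pderiv i (pderiv i p)
        - 2 * (X i * X j * pderiv i (pderiv j p)) - X i * pderiv i p - X j * pderiv j p
        + (if i = j then 2 * (X i * pderiv i p) else 0) := by
    intro i j
    have hc : pderiv j (pderiv i p) = pderiv i (pderiv j p) := pderiv_pderiv_comm i j p
    simp only [angDeriv_apply, map_sub, pderiv_mul, pderiv_X, hc, Pi.single_apply]
    by_cases hij : i = j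
    · subst hij
      simp
      ring
    · simp [hij, Ne.symm hij]
      ring
  have hE := hp.sum_X_mul_pderiv
  rw [nsmul_eq_mul] at hE
  have hlap : ∑ i, ∑ j, X i * X i * pderiv j (pderiv j p) = radSq d * polyLaplacian d p := by
    rw [radSq, polyLaplacian_apply, Finset.sum_mul_sum]
  have hlap' : ∑ i, ∑ j, X j * X j * pderiv i (pderiv i p) = radSq d * polyLaplacian d p := by
    rw [← hlap, Finset.sum_comm]
  have h2 : ∑ i, ∑ j, 2 * (X i * X j * pderiv i (pderiv j p)) = 2 * (C ((l : ℂ) * (l - 1)) * p) := by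
    rw [← sum_X_mul_X_mul_pderiv hp]
    simp only [Finset.mul_sum]
  have h3 : ∑ i : Fin (d + 1), ∑ _j : Fin (d + 1), X i * pderiv i p = (d + 1 : ℕ) * (l * p) := by
    rw [Finset.sum_comm, Finset.sum_const, hE]
    simp
  have h4 : ∑ _i : Fin (d + 1), ∑ j : Fin (d + 1), X j * pderiv j p = (d + 1 : ℕ) * (l * p) := by
    rw [Finset.sum_const, hE]
    simp
  have h5 : ∑ i : Fin (d + 1), ∑ j : Fin (d + 1), (if i = j then 2 * (X i * pderiv i p) else 0)
      = 2 * (l * p) := by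
    simp [← Finset.mul_sum, hE]
  rw [casimir_apply]
  simp_rw [h1]
  simp only [Finset.sum_add_distrib, Finset.sum_sub_distrib]
  rw [hlap', hlap, h2, h3, h4, h5, lam_cast hd]
  simp only [map_mul, map_sub, map_add, map_natCast, map_one, map_ofNat]
  push_cast
  ring

/-- The wrong eigenvalue is passed down in degree. By `casimir_eq`, `radSq d * polyLaplacian d q` is
a nonzero multiple of `q`; since `radSq` commutes with the Casimir operator and can be cancelled,
the Laplacian of `q` satisfies the same equation in degree `m - 2`. By induction it vanishes, and
hence so does `q`. -/
theorem eq_zero_of_casimir_eq {d : ℕ} (hd : 1 ≤ d) {l : ℕ} (m : ℕ) (hm : m < l)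
    {q : MvPolynomial (Fin (d + 1)) ℂ} (hq : q.IsHomogeneous m)
    (hc : casimir d q = - (C (2 * (lam d l : ℂ)) * q)) : q = 0 := by
  induction m using Nat.strong_induction_on generalizing q with
  | _ m ih =>
    have h0 := casimir_eq hd hq
    rw [hc] at h0
    have hlt : (lam d m : ℂ) ≠ lam d l := by
      exact_mod_cast (lam_strictMono hd hm).ne
    have h1 : radSq d * polyLaplacian d q = C ((lam d m : ℂ) - lam d l) * q := by
      have h2 : (2 : MvPolynomial (Fin (d + 1)) ℂ) ≠ 0 := two_ne_zero
      apply mul_left_cancel₀ h2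
      simp only [map_mul, map_sub, map_ofNat, map_natCast] at h0 ⊢
      linear_combination -h0
    suffices hz : polyLaplacian d q = 0 by
      rw [hz, mul_zero, eq_comm, mul_eq_zero] at h1
      rcases h1 with h1 | h1
      · exact absurd (C_eq_zero.1 h1) (sub_ne_zero.2 hlt)
      · exact h1
    rcases Nat.eq_zero_or_pos m with rfl | hpos
    · have : q = C (coeff 0 q) := eq_C_of_isHomogeneous_zero hq
      rw [this, polyLaplacian_apply]
      simp
    -- For `m = 1` the truncated subtraction gives degree 0, which is still smaller; `m = 0` had to
    -- be treated separately.
    · refine ih (m - 2) (by omega) (by omega) (polyLaplacian_isHomogeneous hq) ?_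
      apply mul_left_cancel₀ (radSq_ne_zero d)
      rw [← casimir_radSq_mul, h1, ← smul_eq_C_mul, map_smul, hc, smul_eq_C_mul,
        mul_neg, mul_left_comm (C _), ← h1]
      ring

/-- The map `q ↦ Δ(r² q)` on homogeneous polynomials of degree `m` is injective: if `r² q` is
harmonic, `q` has the Casimir eigenvalue of degree `m + 2`, which is excluded in degree `m`. By
finite dimension it is surjective, and `q` is chosen so that `r² q` has the same Laplacian as `p`.
-/
theorem exists_harmonic_add {d : ℕ} (hd : 1 ≤ d) (m : ℕ) {p : MvPolynomial (Fin (d + 1)) ℂ}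
    (hp : p.IsHomogeneous (m + 2)) : ∃ h q : MvPolynomial (Fin (d + 1)) ℂ,
      h.IsHomogeneous (m + 2) ∧ polyLaplacian d h = 0 ∧ q.IsHomogeneous m ∧ p = h + radSq d * q := by
  have hmem : ∀ q : homogeneousSubmodule (Fin (d + 1)) ℂ m,
      (polyLaplacian d ∘ₗ LinearMap.mulLeft ℂ (radSq d)) q.1
        ∈ homogeneousSubmodule (Fin (d + 1)) ℂ m := by
    intro q
    have h1 := polyLaplacian_isHomogeneous
      ((radSq_isHomogeneous d).mul ((mem_homogeneousSubmodule _ _).1 q.2))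
    rw [Nat.add_sub_cancel_left] at h1
    simpa using h1
  let T : homogeneousSubmodule (Fin (d + 1)) ℂ m →ₗ[ℂ] homogeneousSubmodule (Fin (d + 1)) ℂ m :=
    LinearMap.codRestrict _ ((polyLaplacian d ∘ₗ LinearMap.mulLeft ℂ (radSq d)).domRestrict _) hmem
  have hT : ∀ q, (T q : MvPolynomial (Fin (d + 1)) ℂ) = polyLaplacian d (radSq d * q.1) :=
    fun q => rfl
  have : Module.Finite ℂ (homogeneousSubmodule (Fin (d + 1)) ℂ m) :=
    Module.Finite.iff_fg.2 (homogeneousSubmodule_fg _ _ m)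
  have hinj : Function.Injective T := by
    rw [← LinearMap.ker_eq_bot, LinearMap.ker_eq_bot']
    intro q hq
    have h1 : polyLaplacian d (radSq d * q.1) = 0 := by rw [← hT, hq]; rfl
    have hqh := (mem_homogeneousSubmodule _ _).1 q.2
    have h2 := casimir_eq hd ((radSq_isHomogeneous d).mul hqh)
    rw [h1, casimir_radSq_mul] at h2
    apply Subtype.ext
    refine eq_zero_of_casimir_eq hd (l := 2 + m) m (by omega) hqh ?_
    apply mul_left_cancel₀ (radSq_ne_zero d)
    rw [h2]
    ring
  obtain ⟨q, hq⟩ := LinearMap.injective_iff_surjective.1 hinj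
    ⟨polyLaplacian d p, by
      have := polyLaplacian_isHomogeneous hp
      rwa [Nat.add_sub_cancel, ← mem_homogeneousSubmodule] at this⟩
  have hq' : polyLaplacian d (radSq d * q.1) = polyLaplacian d p := by rw [← hT, hq]
  have hqh := (mem_homogeneousSubmodule _ _).1 q.2
  refine ⟨p - radSq d * q.1, q.1, hp.sub ?_, by rw [map_sub, hq', sub_self], hqh, by ring⟩
  simpa [add_comm] using (radSq_isHomogeneous d).mul hqh

theorem polyLaplacian_eq_zero_of_lt_two {d l : ℕ} (hl : l < 2) {p : MvPolynomial (Fin (d + 1)) ℂ}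
    (hp : p.IsHomogeneous l) : polyLaplacian d p = 0 := by
  rw [polyLaplacian_apply]
  refine Finset.sum_eq_zero fun i _ => ?_
  have h1 : (pderiv i p).IsHomogeneous 0 := by
    have := hp.pderiv (i := i)
    rwa [show l - 1 = 0 by omega] at this
  have : pderiv i p = C (coeff 0 (pderiv i p)) := eq_C_of_isHomogeneous_zero h1
  rw [this, pderiv_C]

theorem restrictSph_apply {d : ℕ} (p : MvPolynomial (Fin (d + 1)) ℂ) (x : Sph d) :
    restrictSph d p x = aeval (fun i => ((x.1 i : ℝ) : ℂ)) p := rfl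

theorem restrictSph_mul {d : ℕ} (p q : MvPolynomial (Fin (d + 1)) ℂ) :
    restrictSph d (p * q) = restrictSph d p * restrictSph d q := by
  ext x
  simp [restrictSph_apply]

theorem restrictSph_radSq (d : ℕ) : restrictSph d (radSq d) = 1 := by
  ext x
  have h := x.2
  rw [mem_sphere_zero_iff_norm, EuclideanSpace.norm_eq, Real.sqrt_eq_one] at h
  simp only [Real.norm_eq_abs, sq_abs] at h
  simp only [restrictSph_apply, radSq, map_sum, map_mul, aeval_X, Pi.one_apply]
  exact_mod_cast (by simpa [sq] using h : ∑ i, x.1 i * x.1 i = 1)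

/-- On the sphere `radSq` equals 1, so splitting off the harmonic part leaves a polynomial of degree
lower by two. -/
theorem restrictSph_mem_iSup {d : ℕ} (hd : 1 ≤ d) (p : MvPolynomial (Fin (d + 1)) ℂ) :
    restrictSph d p ∈ ⨆ l, sphHarm d l := by
  have key : ∀ l : ℕ, ∀ p : MvPolynomial (Fin (d + 1)) ℂ, p.IsHomogeneous l →
      restrictSph d p ∈ ⨆ l, sphHarm d l := by
    intro l
    induction l using Nat.strong_induction_on with
    | _ l ih =>
      intro p hp
      rcases lt_or_ge l 2 with hl | hl
      · exact Submodule.mem_iSup_of_mem l ⟨p, ⟨hp, polyLaplacian_eq_zero_of_lt_two hl hp⟩, rfl⟩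
      · obtain ⟨m, rfl⟩ := Nat.exists_eq_add_of_le' hl
        obtain ⟨h, q, hh, hh0, hq, rfl⟩ := exists_harmonic_add hd m hp
        rw [map_add, restrictSph_mul, restrictSph_radSq, one_mul]
        exact Submodule.add_mem _ (Submodule.mem_iSup_of_mem (m + 2) ⟨h, ⟨hh, hh0⟩, rfl⟩)
          (ih m (by omega) q hq)
  rw [← sum_homogeneousComponent p, map_sum]
  exact Submodule.sum_mem _ fun i _ => key i _ (homogeneousComponent_isHomogeneous i p)

/-! ### The dimension of the space of spherical harmonics -/

/-- The equation `Δp = 0` is a recursion expressing each coefficient with exponent of `x_0` at least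
2 through coefficients with smaller exponent of `x_0`. Thus a harmonic polynomial is determined by
its terms of degree at most 1 in `x_0`. -/
theorem coeff_eq_zero_of_harmonic {d : ℕ} {p : MvPolynomial (Fin (d + 1)) ℂ}
    (hp : polyLaplacian d p = 0) (h0 : ∀ a : Fin (d + 1) →₀ ℕ, a 0 ≤ 1 → coeff a p = 0) :
    p = 0 := by
  have hlap : ∀ b : Fin (d + 1) →₀ ℕ, ∑ i, ((b i : ℂ) + 1) * ((b i : ℂ) + 1 + 1) *
      coeff (b + Finsupp.single i 1 + Finsupp.single i 1) p = 0 := by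
    intro b
    have := congrArg (coeff b) hp
    rw [polyLaplacian_apply, coeff_sum, coeff_zero] at this
    rw [← this]
    refine Finset.sum_congr rfl fun i _ => ?_
    rw [coeff_pderiv, coeff_pderiv]
    simp
    ring
  have key : ∀ n : ℕ, ∀ a : Fin (d + 1) →₀ ℕ, a 0 = n → coeff a p = 0 := by
    intro n
    induction n using Nat.strong_induction_on with
    | _ n ih =>
      intro a ha
      rcases le_or_gt n 1 with hn | hn
      · exact h0 a (by omega)
      · obtain ⟨b, rfl⟩ : ∃ b, a = b + Finsupp.single 0 1 + Finsupp.single 0 1 := by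
          refine ⟨a - Finsupp.single 0 2, ?_⟩
          ext i
          by_cases hi : i = 0
          · subst hi; simp; omega
          · simp [Ne.symm hi]
        have hb : b 0 + 2 = n := by simpa using ha
        have h1 := hlap b
        rw [Finset.sum_eq_single 0] at h1
        · rcases mul_eq_zero.1 h1 with h2 | h2
          · exact absurd h2 (by exact_mod_cast (by positivity : (b 0 + 1) * (b 0 + 1 + 1) ≠ 0))
          · exact h2
        · intro i _ hi
          rw [ih (b 0) (by omega) _ (by simp [hi]), mul_zero]
        · simp
  ext a
  rw [key _ a rfl, coeff_zero]

theorem sphDim_le {d : ℕ} (hd : 1 ≤ d) (l : ℕ) : sphDim d l ≤ 2 * (l + 1) ^ (d - 1) := by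
  classical
  obtain ⟨e, rfl⟩ : ∃ e, d = e + 1 := ⟨d - 1, by omega⟩
  set V := homogeneousSubmodule (Fin (e + 1 + 1)) ℂ l ⊓ LinearMap.ker (polyLaplacian (e + 1)) with hV
  have hfin : Module.Finite ℂ (homogeneousSubmodule (Fin (e + 1 + 1)) ℂ l) :=
    Module.Finite.iff_fg.2 (homogeneousSubmodule_fg _ _ l)
  -- The exponent of `x_0` is 0 or 1, the next `d - 1` exponents lie in `0, …, l`, and the last one
  -- is forced by homogeneity. These monomials number `2 (l+1)^(d-1)`.
  let expo (s : Fin 2 × (Fin e → Fin (l + 1))) : Fin (e + 1 + 1) →₀ ℕ :=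
    Finsupp.equivFunOnFinite.symm (Fin.cons (s.1 : ℕ) (Fin.snoc (fun i => (s.2 i : ℕ))
      (l - s.1 - ∑ i, (s.2 i : ℕ)) : Fin (e + 1) → ℕ))
  let Φ : V →ₗ[ℂ] (Fin 2 × (Fin e → Fin (l + 1)) → ℂ) :=
    LinearMap.pi fun s => (lcoeff ℂ (expo s)) ∘ₗ V.subtype
  have hinj : Function.Injective Φ := by
    rw [← LinearMap.ker_eq_bot, LinearMap.ker_eq_bot']
    intro p hp
    have hph : p.1.IsHomogeneous l := p.2.1
    apply Subtype.ext
    refine coeff_eq_zero_of_harmonic p.2.2 fun a ha => ?_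
    by_contra hne
    have hdeg := hph hne
    have hdeg' : a 0 + (∑ i : Fin e, a i.castSucc.succ + a (Fin.last e).succ) = l := by
      have : a.degree = l := by
        rw [← hdeg, Finsupp.degree_eq_weight_one]
        rfl
      rw [← this, Finsupp.degree_eq_sum, Fin.sum_univ_succ, Fin.sum_univ_castSucc]
    have hle : ∀ i : Fin e, a i.castSucc.succ < l + 1 := fun i => by
      have : a i.castSucc.succ ≤ ∑ i : Fin e, a i.castSucc.succ := Finset.single_le_sum
        (f := fun i : Fin e => a i.castSucc.succ) (fun _ _ => Nat.zero_le _) (Finset.mem_univ i)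
      omega
    have hs : expo (⟨a 0, by omega⟩, fun i => ⟨a i.castSucc.succ, hle i⟩) = a := by
      ext j
      refine Fin.cases ?_ (fun j => ?_) j
      · simp [expo]
      · refine Fin.lastCases ?_ (fun j => ?_) j
        · have : (Fin.last (e + 1)) = (Fin.last e).succ := rfl
          simp only [expo, Finsupp.equivFunOnFinite_symm_apply_apply, Fin.cons_succ, Fin.snoc_last]
          omega
        · simp [expo]
    apply hne
    have := congrFun hp (⟨a 0, by omega⟩, fun i => ⟨a i.castSucc.succ, hle i⟩)
    simpa [Φ, hs] using this
  have hVfin : Module.Finite ℂ V := Module.Finite.of_injective Φ hinj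
  calc sphDim (e + 1) l ≤ Module.finrank ℂ V := Submodule.finrank_map_le _ _
    _ ≤ Module.finrank ℂ (Fin 2 × (Fin e → Fin (l + 1)) → ℂ) :=
      LinearMap.finrank_le_finrank_of_injective hinj
    _ = 2 * (l + 1) ^ (e + 1 - 1) := by simp

/-! ### Orthogonal substitutions -/

/-- The linear substitution `x ↦ M x` in polynomials. -/
def substMat {d : ℕ} (M : Matrix (Fin (d + 1)) (Fin (d + 1)) ℝ) :
    MvPolynomial (Fin (d + 1)) ℂ →ₐ[ℂ] MvPolynomial (Fin (d + 1)) ℂ :=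
  aeval fun i => ∑ j, C (M i j : ℂ) * X j

theorem pderiv_substMat {d : ℕ} (M : Matrix (Fin (d + 1)) (Fin (d + 1)) ℝ) (k : Fin (d + 1))
    (p : MvPolynomial (Fin (d + 1)) ℂ) :
    pderiv k (substMat M p) = ∑ i, C (M i k : ℂ) * substMat M (pderiv i p) := by
  classical
  induction p using MvPolynomial.induction_on with
  | C a => simp [substMat]
  | add p q hp hq => simp [hp, hq, mul_add, Finset.sum_add_distrib]
  | mul_X p j hp =>
    rw [map_mul, pderiv_mul, hp]
    have hX : pderiv k (substMat M (X j)) = C (M j k : ℂ) := by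
      simp [substMat, pderiv_X, Pi.single_apply]
    rw [hX]
    simp only [pderiv_mul, pderiv_X, map_add, map_mul, mul_add, Finset.sum_add_distrib,
      Finset.sum_mul, Pi.single_apply, apply_ite (substMat M), map_one, map_zero]
    simp [mul_comm, mul_left_comm]

/-- The chain rule twice produces the entries of `M * Mᵀ`, which is the identity. -/
theorem polyLaplacian_substMat {d : ℕ} {M : Matrix (Fin (d + 1)) (Fin (d + 1)) ℝ}
    (hM : M * M.transpose = 1) (p : MvPolynomial (Fin (d + 1)) ℂ) :
    polyLaplacian d (substMat M p) = substMat M (polyLaplacian d p) := by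
  classical
  have hM' : ∀ i j, ∑ k, (M i k : ℂ) * (M j k : ℂ) = if i = j then 1 else 0 := by
    intro i j
    have := congrFun (congrFun hM i) j
    simp only [Matrix.mul_apply, Matrix.transpose_apply, Matrix.one_apply] at this
    have h := congrArg (fun a : ℝ => (a : ℂ)) this
    push_cast at h
    rw [h]
    split_ifs <;> simp
  rw [polyLaplacian_apply, polyLaplacian_apply, map_sum]
  calc ∑ k, pderiv k (pderiv k (substMat M p))
      = ∑ k, ∑ i, ∑ j, C ((M i k : ℂ) * (M j k : ℂ)) * substMat M (pderiv j (pderiv i p)) := by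
        simp [pderiv_substMat, Finset.mul_sum, mul_assoc]
    _ = ∑ i, ∑ j, C (∑ k, (M i k : ℂ) * (M j k : ℂ)) * substMat M (pderiv j (pderiv i p)) := by
        rw [Finset.sum_comm]
        refine Finset.sum_congr rfl fun i _ => ?_
        rw [Finset.sum_comm]
        refine Finset.sum_congr rfl fun j _ => ?_
        rw [map_sum, Finset.sum_mul]
    _ = ∑ i, substMat M (pderiv i (pderiv i p)) := by
        simp [hM', apply_ite C]

theorem restrictSph_substMat {d : ℕ} (M : Matrix (Fin (d + 1)) (Fin (d + 1)) ℝ)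
    (p : MvPolynomial (Fin (d + 1)) ℂ) {x y : Sph d} (hxy : ∀ i, y.1 i = ∑ j, M i j * x.1 j) :
    restrictSph d (substMat M p) x = restrictSph d p y := by
  simp only [restrictSph_apply, substMat]
  rw [comp_aeval_apply]
  congr 2
  funext i
  simp [hxy]

theorem comp_mem_sphHarm {d l : ℕ} {M : Matrix (Fin (d + 1)) (Fin (d + 1)) ℝ}
    (hM : M * M.transpose = 1) {φ : Sph d → Sph d}
    (hφ : ∀ x i, (φ x).1 i = ∑ j, M i j * x.1 j) {h : Sph d → ℂ} (hh : h ∈ sphHarm d l) :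
    h ∘ φ ∈ sphHarm d l := by
  obtain ⟨p, ⟨hp, hp0⟩, rfl⟩ := hh
  refine ⟨substMat M p, ⟨?_, ?_⟩, ?_⟩
  · have := IsHomogeneous.aeval hp (fun i => ∑ j, C (M i j : ℂ) * X j) (n := 1)
      fun i => IsHomogeneous.sum _ _ _ fun j _ => isHomogeneous_C_mul_X _ _
    simpa [substMat] using this
  · change polyLaplacian d _ = 0
    rw [polyLaplacian_substMat hM, show polyLaplacian d p = 0 from hp0, map_zero]
  · ext x
    exact restrictSph_substMat M p (hφ x)

end SphereDeconv
end

noncomputable section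

namespace SphereDeconv

/-! ### Isometries of the sphere -/

/-- The ambient Euclidean space. -/
abbrev Euc (d : ℕ) : Type := EuclideanSpace ℝ (Fin (d + 1))

instance instIsFiniteMeasureNu (d : ℕ) : IsFiniteMeasure (nu d) :=
  inferInstanceAs (IsFiniteMeasure (volume : Measure (Euc d)).toSphere)

/-- The map of the sphere induced by a linear isometry. -/
def isoSph {d : ℕ} (L : Euc d ≃ₗᵢ[ℝ] Euc d) (x : Sph d) : Sph d :=
  ⟨L x.1, by rw [mem_sphere_zero_iff_norm, L.norm_map]; exact mem_sphere_zero_iff_norm.1 x.2⟩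

theorem continuous_isoSph {d : ℕ} (L : Euc d ≃ₗᵢ[ℝ] Euc d) : Continuous (isoSph L) :=
  (L.continuous.comp continuous_subtype_val).subtype_mk _

open scoped Pointwise in
theorem measurePreserving_isoSph {d : ℕ} (L : Euc d ≃ₗᵢ[ℝ] Euc d) :
    MeasurePreserving (isoSph L) (nu d) (nu d) := by
  refine ⟨(continuous_isoSph L).measurable, ?_⟩
  ext s hs
  rw [Measure.map_apply (continuous_isoSph L).measurable hs, nu, Measure.toSphere_apply' _ hs,
    Measure.toSphere_apply' _ ((continuous_isoSph L).measurable hs)]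
  congr 1
  rw [← L.measurePreserving.measure_preimage_emb L.toHomeomorph.measurableEmbedding
    (Set.Ioo (0 : ℝ) 1 • (Subtype.val '' s))]
  congr 1
  ext y
  simp only [Set.mem_smul, Set.mem_image, Set.mem_preimage]
  constructor
  · rintro ⟨r, hr, _, ⟨x, hx, rfl⟩, rfl⟩
    exact ⟨r, hr, _, ⟨_, hx, rfl⟩, by simp [isoSph]⟩
  · rintro ⟨r, hr, _, ⟨x, hx, rfl⟩, h⟩
    refine ⟨r, hr, _, ⟨isoSph L.symm x, ?_, rfl⟩, ?_⟩
    · have : isoSph L (isoSph L.symm x) = x := Subtype.ext (by simp [isoSph])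
      rwa [this]
    · apply L.injective
      rw [← h]
      simp [isoSph]

theorem isoSph_comp_mem_sphHarm {d l : ℕ} (L : Euc d ≃ₗᵢ[ℝ] Euc d) {h : Sph d → ℂ}
    (hh : h ∈ sphHarm d l) : h ∘ isoSph L ∈ sphHarm d l := by
  classical
  set M : Matrix (Fin (d + 1)) (Fin (d + 1)) ℝ :=
    Matrix.of fun i j => L (EuclideanSpace.single j 1) i with hMdef
  have happ : ∀ (y : Euc d) i, (L y) i = ∑ j, M i j * y j := by
    intro y i
    have hy : y = ∑ j, y j • EuclideanSpace.single j (1 : ℝ) := by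
      ext k
      simp [Finset.sum_apply, Pi.single_apply]
    conv_lhs => rw [hy]
    simp [hMdef, mul_comm]
  have hM : M.transpose * M = 1 := by
    ext i j
    have h1 := L.inner_map_map (EuclideanSpace.single i (1 : ℝ)) (EuclideanSpace.single j (1 : ℝ))
    rw [PiLp.inner_apply] at h1
    simp only [Matrix.mul_apply, Matrix.transpose_apply, Matrix.one_apply, hMdef, Matrix.of_apply]
    rw [EuclideanSpace.inner_single_left] at h1
    simpa [Pi.single_apply, mul_comm, eq_comm] using h1
  exact comp_mem_sphHarm (mul_eq_one_comm.1 hM) (fun x i => happ x.1 i) hh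

/-- The reflection exchanging two vectors of equal norm does this. It reverses orientation, which is
harmless since harmonics and `nu` are invariant under all linear isometries. -/
theorem exists_isoSph_eq {d : ℕ} (x y : Sph d) : ∃ L : Euc d ≃ₗᵢ[ℝ] Euc d, isoSph L x = y := by
  have h : ‖x.1‖ = ‖y.1‖ := by
    rw [mem_sphere_zero_iff_norm.1 x.2, mem_sphere_zero_iff_norm.1 y.2]
  exact ⟨_, Subtype.ext (Submodule.reflection_sub h)⟩

theorem exists_isoSph_eq_rotate {d : ℕ} (u : Rot d) :
    ∃ L : Euc d ≃ₗᵢ[ℝ] Euc d, rotate u = isoSph L := by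
  let f : Euc d →ₗ[ℝ] Euc d := Matrix.toLpLin 2 2 (u : Matrix (Fin (d + 1)) (Fin (d + 1)) ℝ)
  have hf : ∀ y : Euc d, ‖f y‖ = ‖y‖ := by
    intro y
    have h1 : (u : Matrix (Fin (d + 1)) (Fin (d + 1)) ℝ).mulVec y.ofLp ⬝ᵥ
        (u : Matrix (Fin (d + 1)) (Fin (d + 1)) ℝ).mulVec y.ofLp = y.ofLp ⬝ᵥ y.ofLp := by
      rw [Matrix.dotProduct_mulVec, Matrix.vecMul_mulVec, Rot.transpose_mul, Matrix.vecMul_one]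
    rw [EuclideanSpace.norm_eq, EuclideanSpace.norm_eq]
    congr 1
    simpa [dotProduct, sq, f] using h1
  refine ⟨LinearIsometry.toLinearIsometryEquiv ⟨f, hf⟩ rfl, ?_⟩
  ext x : 1
  rfl

theorem continuous_rotate {d : ℕ} : Continuous fun p : Rot d × Sph d => rotate p.1 p.2 := by
  refine Continuous.subtype_mk ?_ _
  refine (PiLp.continuous_toLp 2 _).comp ?_
  exact (continuous_subtype_val.comp continuous_fst).matrix_mulVec
    ((PiLp.continuous_ofLp 2 _).comp (continuous_subtype_val.comp continuous_snd))

/-! ### Angular derivatives of functions on the sphere -/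

/-- The generator `x ↦ x_i e_j - x_j e_i` of the rotations in a coordinate plane. -/
def rotGen {d : ℕ} (i j : Fin (d + 1)) : Euc d →L[ℝ] Euc d :=
  (EuclideanSpace.proj i : Euc d →L[ℝ] ℝ).smulRight (EuclideanSpace.single j 1) -
    (EuclideanSpace.proj j : Euc d →L[ℝ] ℝ).smulRight (EuclideanSpace.single i 1)

theorem rotGen_apply {d : ℕ} (i j k : Fin (d + 1)) (x : Euc d) :
    rotGen i j x k = x i * (if k = j then 1 else 0) - x j * (if k = i then 1 else 0) := by
  simp [rotGen]

theorem inner_rotGen {d : ℕ} (i j : Fin (d + 1)) (x : Euc d) : inner ℝ x (rotGen i j x) = 0 := by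
  simp [rotGen, inner_sub_right, inner_smul_right, EuclideanSpace.inner_single_right]
  ring

theorem hasDerivAt_exp_rotGen {d : ℕ} (i j : Fin (d + 1)) (x : Euc d) (t : ℝ) :
    HasDerivAt (fun s : ℝ => NormedSpace.exp (s • rotGen i j) x)
      (rotGen i j (NormedSpace.exp (t • rotGen i j) x)) t := by
  have h := hasDerivAt_exp_smul_const' (rotGen i j) t
  exact h.clm_apply (hasDerivAt_const t x) |>.congr_deriv (by simp)

/-- The generator is skew, so the squared norm has zero derivative along the flow. -/
theorem norm_exp_rotGen {d : ℕ} (i j : Fin (d + 1)) (t : ℝ) (x : Euc d) :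
    ‖NormedSpace.exp (t • rotGen i j) x‖ = ‖x‖ := by
  have h : ∀ s, HasDerivAt (fun s : ℝ => ‖NormedSpace.exp (s • rotGen i j) x‖ ^ 2) 0 s := by
    intro s
    have := (hasDerivAt_exp_rotGen i j x s).norm_sq
    simpa [inner_rotGen] using this
  have h2 : ‖NormedSpace.exp (t • rotGen i j) x‖ ^ 2 = ‖NormedSpace.exp ((0 : ℝ) • rotGen i j) x‖ ^ 2 :=
    is_const_of_deriv_eq_zero (fun s => (h s).differentiableAt)
    (fun s => (h s).deriv) t 0
  have h3 : (0 : ℝ) • (rotGen i j : Euc d →L[ℝ] Euc d) = 0 := by ext1 y; simp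
  rw [h3, NormedSpace.exp_zero, one_apply_eq_self] at h2
  exact (sq_eq_sq₀ (norm_nonneg _) (norm_nonneg _)).1 h2

/-- The one-parameter group of rotations generated by `rotGen i j`. -/
def flowIso {d : ℕ} (i j : Fin (d + 1)) (t : ℝ) : Euc d ≃ₗᵢ[ℝ] Euc d :=
  LinearIsometry.toLinearIsometryEquiv
    ⟨(NormedSpace.exp (t • rotGen i j) : Euc d →L[ℝ] Euc d).toLinearMap, norm_exp_rotGen i j t⟩ rfl

/-- The action of `flowIso` on the sphere. -/
def flow {d : ℕ} (i j : Fin (d + 1)) (t : ℝ) : Sph d → Sph d := isoSph (flowIso i j t)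

theorem hasDerivAt_flow {d : ℕ} (i j : Fin (d + 1)) (x : Sph d) (t : ℝ) :
    HasDerivAt (fun s : ℝ => (flow i j s x).1) (rotGen i j (flow i j t x).1) t :=
  hasDerivAt_exp_rotGen i j x.1 t

theorem continuous_flow {d : ℕ} (i j : Fin (d + 1)) :
    Continuous fun p : ℝ × Sph d => flow i j p.1 p.2 := by
  refine Continuous.subtype_mk (?_ : Continuous fun p : ℝ × Sph d =>
    NormedSpace.exp (p.1 • rotGen i j) p.2.1) _
  have h : Continuous fun s : ℝ => NormedSpace.exp (s • rotGen i j : Euc d →L[ℝ] Euc d) :=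
    continuous_iff_continuousAt.2 fun s => (hasDerivAt_exp_smul_const (rotGen i j) s).continuousAt
  exact (h.comp continuous_fst).clm_apply (continuous_subtype_val.comp continuous_snd)

/-- `g` is the derivative of `f` along the rotations `flow i j`. -/
structure IsAngDeriv {d : ℕ} (i j : Fin (d + 1)) (f g : Sph d → ℂ) : Prop where
  continuous_left : Continuous f
  continuous_right : Continuous g
  hasDerivAt : ∀ x t, HasDerivAt (fun s => f (flow i j s x)) (g (flow i j t x)) t

theorem integrable_nu {d : ℕ} {f : Sph d → ℂ} (hf : Continuous f) :
    Integrable f (nu d) :=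
  hf.integrable_of_hasCompactSupport (HasCompactSupport.of_compactSpace f)

/-- Integrating `g` along the flow over `[0, 1]` gives a difference of two translates of `f`, whose
integrals agree because the flow preserves `nu`. Exchanging the integrals, the average over the flow
of `∫ g` is `∫ g` itself. -/
theorem IsAngDeriv.integral_eq_zero {d : ℕ} {i j : Fin (d + 1)} {f g : Sph d → ℂ}
    (h : IsAngDeriv i j f g) : ∫ x, g x ∂(nu d) = 0 := by
  have hjoint : Continuous fun p : ℝ × Sph d => g (flow i j p.1 p.2) :=
    h.continuous_right.comp (continuous_flow i j)
  have hftc : ∀ x, ∫ t in (0 : ℝ)..1, g (flow i j t x) = f (flow i j 1 x) - f (flow i j 0 x) := by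
    intro x
    refine intervalIntegral.integral_eq_sub_of_hasDerivAt (fun t _ => h.hasDerivAt x t) ?_
    exact (hjoint.comp (continuous_id.prodMk continuous_const)).intervalIntegrable _ _
  have hinv : ∀ (k : Sph d → ℂ), Continuous k → ∀ t,
      ∫ x, k (flow i j t x) ∂(nu d) = ∫ x, k x ∂(nu d) := by
    intro k hk t
    rw [← (measurePreserving_isoSph (flowIso i j t)).map_eq,
      integral_map (continuous_isoSph _).measurable.aemeasurable
        hk.aestronglyMeasurable, (measurePreserving_isoSph (flowIso i j t)).map_eq]
    rfl
  have h1 : ∫ x, (∫ t in (0 : ℝ)..1, g (flow i j t x)) ∂(nu d) = 0 := by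
    simp_rw [hftc]
    have hc : ∀ t, Continuous fun x => f (flow i j t x) := fun t =>
      h.continuous_left.comp (continuous_isoSph _)
    rw [integral_sub (integrable_nu (hc 1)) (integrable_nu (hc 0)), hinv f h.continuous_left,
      hinv f h.continuous_left, sub_self]
  simp_rw [intervalIntegral.integral_of_le zero_le_one] at h1
  rw [integral_integral_swap] at h1
  · simpa [hinv g h.continuous_right] using h1
  · obtain ⟨C, hC⟩ := isCompact_univ.exists_bound_of_continuousOn h.continuous_right.continuousOn
    refine Integrable.of_bound (C := C) ?_ (ae_of_all _ fun p => hC _ trivial)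
    exact (hjoint.comp continuous_swap).aestronglyMeasurable

theorem IsAngDeriv.mul {d : ℕ} {i j : Fin (d + 1)} {f g f' g' : Sph d → ℂ}
    (h : IsAngDeriv i j f f') (h' : IsAngDeriv i j g g') :
    IsAngDeriv i j (fun x => f x * g x) (fun x => f' x * g x + f x * g' x) where
  continuous_left := h.continuous_left.mul h'.continuous_left
  continuous_right := (h.continuous_right.mul h'.continuous_left).add
    (h.continuous_left.mul h'.continuous_right)
  hasDerivAt x t := (h.hasDerivAt x t).mul (h'.hasDerivAt x t)

theorem IsAngDeriv.conj {d : ℕ} {i j : Fin (d + 1)} {f f' : Sph d → ℂ}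
    (h : IsAngDeriv i j f f') :
    IsAngDeriv i j (fun x => conj (f x)) (fun x => conj (f' x)) where
  continuous_left := Complex.continuous_conj.comp h.continuous_left
  continuous_right := Complex.continuous_conj.comp h.continuous_right
  hasDerivAt x t := (h.hasDerivAt x t).star

theorem IsAngDeriv.integral_mul {d : ℕ} {i j : Fin (d + 1)} {f g f' g' : Sph d → ℂ}
    (h : IsAngDeriv i j f f') (h' : IsAngDeriv i j g g') :
    ∫ x, f' x * g x ∂(nu d) = - ∫ x, f x * g' x ∂(nu d) := by
  have h0 := (h.mul h').integral_eq_zero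
  rw [integral_add (f := fun x => f' x * g x) (g := fun x => f x * g' x)
    (integrable_nu (h.continuous_right.mul h'.continuous_left))
    (integrable_nu (h.continuous_left.mul h'.continuous_right))] at h0
  exact eq_neg_of_add_eq_zero_left h0

theorem IsAngDeriv.integral_second_mul {d : ℕ} {i j : Fin (d + 1)}
    {f g f' g' f'' g'' : Sph d → ℂ} (h : IsAngDeriv i j f f') (h' : IsAngDeriv i j g g')
    (h2 : IsAngDeriv i j f' f'') (h2' : IsAngDeriv i j g' g'') :
    ∫ x, f'' x * g x ∂(nu d) = ∫ x, f x * g'' x ∂(nu d) := by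
  rw [h2.integral_mul h', h.integral_mul h2', neg_neg]

/-- Both sides obey the Leibniz rule, so only constants and coordinates need checking; on
coordinates the flow derivative is `rotGen`. -/
theorem isAngDeriv_restrictSph {d : ℕ} (i j : Fin (d + 1)) (p : MvPolynomial (Fin (d + 1)) ℂ) :
    IsAngDeriv i j (restrictSph d p) (restrictSph d (angDeriv i j p)) := by
  have hcont : ∀ p, Continuous (restrictSph d p) := by
    intro p
    induction p using MvPolynomial.induction_on with
    | C a =>
      have : restrictSph d (MvPolynomial.C a) = fun _ => a := by ext x; simp [restrictSph_apply]
      rw [this]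
      exact continuous_const
    | add p q hp hq => rw [map_add]; exact hp.add hq
    | mul_X p k hp =>
      rw [restrictSph_mul]
      refine hp.mul ?_
      have : restrictSph d (MvPolynomial.X k) = fun x => ((x.1 k : ℝ) : ℂ) := by
        ext x; simp [restrictSph_apply]
      rw [this]
      fun_prop
  refine ⟨hcont _, hcont _, fun x t => ?_⟩
  induction p using MvPolynomial.induction_on with
  | C a =>
    simp [restrictSph_apply]
    exact hasDerivAt_const _ _
  | add p q hp hq =>
    simp only [map_add, Pi.add_apply]
    exact hp.add hq
  | mul_X p k hp =>
    rw [Derivation.leibniz, map_add, smul_eq_mul, smul_eq_mul]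
    simp only [restrictSph_mul, Pi.mul_apply, Pi.add_apply]
    have hX : HasDerivAt (fun s => restrictSph d (MvPolynomial.X k) (flow i j s x))
        (restrictSph d (angDeriv i j (MvPolynomial.X k)) (flow i j t x)) t := by
      have h1 := (EuclideanSpace.proj k : Euc d →L[ℝ] ℝ).hasFDerivAt.comp_hasDerivAt t
        (hasDerivAt_flow i j x t)
      have h2 := h1.ofReal_comp
      refine (h2.congr_deriv ?_).congr_of_eventuallyEq (Eventually.of_forall fun s => ?_)
      · classical
        have h3 : (EuclideanSpace.proj k : Euc d →L[ℝ] ℝ) (rotGen i j (flow i j t x).1)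
          = _ := rotGen_apply i j k _
        rw [h3]
        simp only [restrictSph_apply, angDeriv_apply, MvPolynomial.pderiv_X, Pi.single_apply]
        push_cast
        split_ifs <;> simp
      · simp [restrictSph_apply]
    refine (hp.mul hX).congr_deriv ?_
    ring

end SphereDeconv
end

noncomputable section

namespace SphereDeconv

/-! ### Eigenfunctions and smooth functions -/

theorem continuous_restrictSph {d : ℕ} (p : MvPolynomial (Fin (d + 1)) ℂ) :
    Continuous (restrictSph d p) :=
  (isAngDeriv_restrictSph 0 0 p).continuous_left

theorem continuous_of_mem_sphHarm {d l : ℕ} {h : Sph d → ℂ} (hh : h ∈ sphHarm d l) :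
    Continuous h := by
  obtain ⟨p, -, rfl⟩ := hh
  exact continuous_restrictSph p

theorem exists_isAngDeriv_of_mem_sphHarm {d l : ℕ} (hd : 1 ≤ d) {h : Sph d → ℂ}
    (hh : h ∈ sphHarm d l) : ∃ h' h'' : Fin (d + 1) → Fin (d + 1) → Sph d → ℂ,
      (∀ i j, IsAngDeriv i j h (h' i j)) ∧ (∀ i j, IsAngDeriv i j (h' i j) (h'' i j)) ∧
      ∀ x, ∑ i, ∑ j, h'' i j x = -(2 * (lam d l : ℂ)) * h x := by
  obtain ⟨p, ⟨hp, hp0⟩, rfl⟩ := hh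
  refine ⟨fun i j => restrictSph d (angDeriv i j p),
    fun i j => restrictSph d (angDeriv i j (angDeriv i j p)),
    fun i j => isAngDeriv_restrictSph i j _, fun i j => isAngDeriv_restrictSph i j _, fun x => ?_⟩
  have h1 := casimir_eq hd hp
  rw [show polyLaplacian d p = 0 from hp0] at h1
  have h2 := congrArg (fun q => restrictSph d q x) h1
  simp only [casimir_apply, map_sum, Finset.sum_apply] at h2
  rw [h2]
  simp [restrictSph_apply]

/-- Two integrations by parts move the second derivatives onto `h`, where they sum to the real
eigenvalue `-2 * lam d l`. -/
theorem integral_angDeriv_second_mul_conj {d l : ℕ} (hd : 1 ≤ d) {f : Sph d → ℂ}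
    {f' f'' : Fin (d + 1) → Fin (d + 1) → Sph d → ℂ} (hf : ∀ i j, IsAngDeriv i j f (f' i j))
    (hf' : ∀ i j, IsAngDeriv i j (f' i j) (f'' i j)) {h : Sph d → ℂ} (hh : h ∈ sphHarm d l) :
    ∫ x, (∑ i, ∑ j, f'' i j x) * conj (h x) ∂(nu d)
      = -(2 * (lam d l : ℂ)) * ∫ x, f x * conj (h x) ∂(nu d) := by
  obtain ⟨h', h'', hh', hh'', hsum⟩ := exists_isAngDeriv_of_mem_sphHarm hd hh
  have hc := continuous_of_mem_sphHarm hh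
  have hfc : Continuous f := (hf 0 0).continuous_left
  have hi1 : ∀ i j, Integrable (fun x => f'' i j x * conj (h x)) (nu d) := fun i j =>
    integrable_nu ((hf' i j).continuous_right.mul (Complex.continuous_conj.comp hc))
  have hi2 : ∀ i j, Integrable (fun x => f x * conj (h'' i j x)) (nu d) := fun i j =>
    integrable_nu (hfc.mul (Complex.continuous_conj.comp (hh'' i j).continuous_right))
  calc ∫ x, (∑ i, ∑ j, f'' i j x) * conj (h x) ∂(nu d)
      = ∑ i, ∑ j, ∫ x, f'' i j x * conj (h x) ∂(nu d) := by
        simp_rw [Finset.sum_mul]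
        rw [integral_finsetSum _ fun i _ => integrable_finsetSum _ fun j _ => hi1 i j]
        exact Finset.sum_congr rfl fun i _ => integral_finsetSum _ fun j _ => hi1 i j
    _ = ∑ i, ∑ j, ∫ x, f x * conj (h'' i j x) ∂(nu d) :=
        Finset.sum_congr rfl fun i _ => Finset.sum_congr rfl fun j _ =>
          (hf i j).integral_second_mul (hh' i j).conj (hf' i j) (hh'' i j).conj
    _ = ∫ x, f x * conj (∑ i, ∑ j, h'' i j x) ∂(nu d) := by
        simp_rw [map_sum, Finset.mul_sum]
        rw [integral_finsetSum _ fun i _ => integrable_finsetSum _ fun j _ => hi2 i j]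
        exact Finset.sum_congr rfl fun i _ => (integral_finsetSum _ fun j _ => hi2 i j).symm
    _ = _ := by
        rw [← integral_const_mul]
        congr 1
        ext x
        rw [hsum]
        simp [show (starRingEnd ℂ) 2 = 2 from Complex.conj_ofNat 2]
        ring

/-- Eigenfunctions of a symmetric operator with different eigenvalues are orthogonal. -/
theorem integral_mul_conj_eq_zero {d l l' : ℕ} (hd : 1 ≤ d) (hll : l ≠ l') {h h' : Sph d → ℂ}
    (hh : h ∈ sphHarm d l) (hh' : h' ∈ sphHarm d l') :
    ∫ x, h x * conj (h' x) ∂(nu d) = 0 := by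
  obtain ⟨g', g'', hg', hg'', hsum⟩ := exists_isAngDeriv_of_mem_sphHarm hd hh
  have h1 := integral_angDeriv_second_mul_conj hd hg' hg'' hh'
  simp_rw [hsum, mul_assoc] at h1
  rw [integral_const_mul] at h1
  have hne : (lam d l : ℂ) - lam d l' ≠ 0 :=
    sub_ne_zero.2 (by exact_mod_cast (lam_strictMono hd).injective.ne hll)
  have h2 : ((lam d l : ℂ) - lam d l') * ∫ x, h x * conj (h' x) ∂(nu d) = 0 := by
    linear_combination (-1 / 2 : ℂ) * h1
  exact (mul_eq_zero.1 h2).resolve_left hne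

/-- The derivative of a function on the ambient space along a rotation generator. -/
def angFDeriv {d : ℕ} (i j : Fin (d + 1)) (F : Euc d → ℂ) (x : Euc d) : ℂ :=
  fderiv ℝ F x (rotGen i j x)

theorem contDiffOn_angFDeriv {d : ℕ} (i j : Fin (d + 1)) {F : Euc d → ℂ} {s : ℕ}
    (hF : ContDiffOn ℝ (s + 1 : ℕ) F {0}ᶜ) : ContDiffOn ℝ s (angFDeriv i j F) {0}ᶜ :=
  (hF.fderiv_of_isOpen isOpen_compl_singleton (m := s) (by simp)).clm_apply
    (rotGen i j).contDiff.contDiffOn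

theorem coe_sph_mem {d : ℕ} (x : Sph d) : x.1 ∈ ({0}ᶜ : Set (Euc d)) := by
  intro h
  have := mem_sphere_zero_iff_norm.1 x.2
  rw [Set.mem_singleton_iff.1 h, norm_zero] at this
  exact zero_ne_one this

theorem continuous_comp_coe {d : ℕ} {F : Euc d → ℂ} (hF : ContinuousOn F {0}ᶜ) :
    Continuous fun x : Sph d => F x.1 :=
  hF.comp_continuous continuous_subtype_val coe_sph_mem

theorem isAngDeriv_angFDeriv {d : ℕ} (i j : Fin (d + 1)) {F : Euc d → ℂ}
    (hF : ContDiffOn ℝ 1 F {0}ᶜ) :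
    IsAngDeriv i j (fun x => F x.1) (fun x => angFDeriv i j F x.1) where
  continuous_left := continuous_comp_coe hF.continuousOn
  continuous_right := continuous_comp_coe
    (contDiffOn_angFDeriv (s := 0) i j (by simpa using hF)).continuousOn
  hasDerivAt x t := by
    have h1 : DifferentiableAt ℝ F (flow i j t x).1 :=
      (hF.differentiableOn one_ne_zero).differentiableAt
        (isOpen_compl_singleton.mem_nhds (coe_sph_mem _))
    exact h1.hasFDerivAt.comp_hasDerivAt t (hasDerivAt_flow i j x t)

theorem exists_iterate_laplacian {d : ℕ} (hd : 1 ≤ d) (k : ℕ) {F : Euc d → ℂ}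
    (hF : ContDiffOn ℝ (2 * k : ℕ) F {0}ᶜ) :
    ∃ g : C(Sph d, ℂ), ∀ l, ∀ h ∈ sphHarm d l,
      ∫ x, g x * conj (h x) ∂(nu d)
        = (lam d l : ℂ) ^ k * ∫ x : Sph d, F x.1 * conj (h x) ∂(nu d) := by
  induction k generalizing F with
  | zero =>
    exact ⟨⟨_, continuous_comp_coe hF.continuousOn⟩, fun l h hh => by simp⟩
  | succ k ih =>
    have h1 : ∀ i j : Fin (d + 1), ContDiffOn ℝ (2 * k + 1 : ℕ) (angFDeriv i j F) {0}ᶜ :=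
      fun i j => contDiffOn_angFDeriv i j hF
    have h2 : ∀ i j : Fin (d + 1),
        ContDiffOn ℝ (2 * k : ℕ) (angFDeriv i j (angFDeriv i j F)) {0}ᶜ :=
      fun i j => contDiffOn_angFDeriv i j (h1 i j)
    -- The factor `-1/2` turns the eigenvalue `-2 * lam d l` into `lam d l`.
    obtain ⟨g, hg⟩ := ih (F := fun x => (-1 / 2 : ℂ) *
      ∑ i, ∑ j, angFDeriv i j (angFDeriv i j F) x)
      (contDiffOn_const.mul (ContDiffOn.sum fun i _ => ContDiffOn.sum fun j _ => h2 i j))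
    refine ⟨g, fun l h hh => ?_⟩
    rw [hg l h hh]
    have h3 := integral_angDeriv_second_mul_conj hd
      (fun i j => isAngDeriv_angFDeriv i j (hF.of_le (by norm_cast; omega)))
      (fun i j => isAngDeriv_angFDeriv i j ((h1 i j).of_le (by norm_cast; omega))) hh
    simp_rw [mul_assoc]
    rw [integral_const_mul, h3]
    ring

/-- The extension is `y ↦ f (y / ‖y‖)`, constant along rays. It makes ordinary derivatives in the
ambient space available for `angFDeriv`. -/
theorem exists_contDiffOn_extension {d s : ℕ} {f : Sph d → ℝ} (hf : IsCk s f) :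
    ∃ F : Euc d → ℂ, ContDiffOn ℝ s F {0}ᶜ ∧ ∀ x : Sph d, F x.1 = f x := by
  classical
  let U : TopologicalSpace.Opens (Euc d) := ⟨{0}ᶜ, isOpen_compl_singleton⟩
  have hne : ∀ x : U, (x : Euc d) ≠ 0 := fun x => x.2
  have hmem : ∀ x : U, ‖(x : Euc d)‖⁻¹ • (x : Euc d) ∈ Metric.sphere (0 : Euc d) 1 := by
    intro x
    rw [mem_sphere_zero_iff_norm, norm_smul, norm_inv, norm_norm,
      inv_mul_cancel₀ (norm_ne_zero_iff.2 (hne x))]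
  have hnorm : ContMDiff 𝓘(ℝ, Euc d) 𝓘(ℝ, Euc d) (s : WithTop ℕ∞)
      fun x : U => ‖(x : Euc d)‖⁻¹ • (x : Euc d) := by
    intro x
    refine (contMDiffAt_subtype_iff (f := fun y : Euc d => ‖y‖⁻¹ • y)).2 ?_
    rw [contMDiffAt_iff_contDiffAt]
    exact ((contDiffAt_norm ℝ (hne x)).inv (norm_ne_zero_iff.2 (hne x))).smul contDiffAt_id
  have hfact : Fact (Module.finrank ℝ (Euc d) = d + 1) := ⟨finrank_euclideanSpace_fin⟩
  have hcomp := ContMDiff.comp hf (hnorm.codRestrict_sphere hmem)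
  let F : Euc d → ℝ := fun y => if hy : y ∈ U then f ⟨‖y‖⁻¹ • y, hmem ⟨y, hy⟩⟩ else 0
  have hF : ∀ x : U, ContDiffAt ℝ s F x := by
    intro x
    rw [← contMDiffAt_iff_contDiffAt]
    refine contMDiffAt_subtype_iff.1 ?_
    have : (fun x : U => F x) = f ∘ Set.codRestrict _ _ hmem := by
      ext y
      simp [F]
      rfl
    rw [this]
    exact hcomp x
  refine ⟨fun y => (F y : ℂ), ?_, fun x => ?_⟩
  · intro y hy
    exact (Complex.ofRealCLM.contDiff.contDiffAt.comp y (hF ⟨y, hy⟩)).contDiffWithinAt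
  · have hx : x.1 ∈ U := coe_sph_mem x
    have hn := mem_sphere_zero_iff_norm.1 x.2
    simp [F, hx, hn]

theorem exists_laplacian_pow {d k : ℕ} (hd : 1 ≤ d) {f : Sph d → ℝ} (hf : IsCk (2 * k) f) :
    ∃ g : C(Sph d, ℂ), ∀ l, ∀ h ∈ sphHarm d l,
      ∫ x, g x * conj (h x) ∂(nu d)
        = (lam d l : ℂ) ^ k * ∫ x : Sph d, (f x : ℂ) * conj (h x) ∂(nu d) := by
  obtain ⟨F, hF, hFf⟩ := exists_contDiffOn_extension hf
  obtain ⟨g, hg⟩ := exists_iterate_laplacian hd k hF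
  exact ⟨g, fun l h hh => by rw [hg l h hh]; simp_rw [hFf]⟩

end SphereDeconv
end

noncomputable section

namespace SphereDeconv

/-! ### Harmonic expansions -/

/-- The class of a continuous function in `L²(ν)`. -/
abbrev toL2 (d : ℕ) : C(Sph d, ℂ) →L[ℂ] Lp ℂ 2 (nu d) := ContinuousMap.toLp 2 (nu d) ℂ

theorem IsHarmONB.mem {d l : ℕ} {b : Fin (sphDim d l) → Sph d → ℂ} (hb : IsHarmONB d l b)
    (q : Fin (sphDim d l)) : b q ∈ sphHarm d l := by
  rw [← hb.span_eq]
  exact Submodule.subset_span ⟨q, rfl⟩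

theorem IsHarmONB.continuous {d l : ℕ} {b : Fin (sphDim d l) → Sph d → ℂ}
    (hb : IsHarmONB d l b) (q : Fin (sphDim d l)) : Continuous (b q) :=
  continuous_of_mem_sphHarm (hb.mem q)

theorem integrable_mul_conj {d : ℕ} {f g : Sph d → ℂ} (hf : Continuous f) (hg : Continuous g) :
    Integrable (fun x => f x * conj (g x)) (nu d) :=
  integrable_nu (hf.mul (Complex.continuous_conj.comp hg))

theorem IsHarmONB.eq_sum {d l : ℕ} {b : Fin (sphDim d l) → Sph d → ℂ} (hb : IsHarmONB d l b)
    {h : Sph d → ℂ} (hh : h ∈ sphHarm d l) (x : Sph d) :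
    h x = ∑ q, (∫ y, h y * conj (b q y) ∂(nu d)) * b q x := by
  rw [← hb.span_eq] at hh
  obtain ⟨c, rfl⟩ := (Submodule.mem_span_range_iff_exists_fun ℂ).1 hh
  simp only [Finset.sum_apply, Pi.smul_apply, smul_eq_mul]
  refine Finset.sum_congr rfl fun q _ => ?_
  congr 1
  simp_rw [Finset.sum_mul, mul_assoc]
  rw [integral_finsetSum _ fun r _ =>
    (integrable_mul_conj (hb.continuous r) (hb.continuous q)).const_mul (c r)]
  simp_rw [integral_const_mul, hb.orthonormal]
  simp

theorem IsHarmONB.integral_norm_sq {d l : ℕ} {b : Fin (sphDim d l) → Sph d → ℂ}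
    (hb : IsHarmONB d l b) (c : Fin (sphDim d l) → ℂ) :
    ∫ x, ‖∑ q, c q * b q x‖ ^ 2 ∂(nu d) = ∑ q, ‖c q‖ ^ 2 := by
  have h1 : ∫ x, (∑ q, c q * b q x) * conj (∑ q, c q * b q x) ∂(nu d)
      = ∑ q, c q * conj (c q) := by
    have hi : ∀ q r, Integrable (fun x => c q * conj (c r) * (b q x * conj (b r x))) (nu d) :=
      fun q r => (integrable_mul_conj (hb.continuous q) (hb.continuous r)).const_mul _
    calc ∫ x, (∑ q, c q * b q x) * conj (∑ q, c q * b q x) ∂(nu d)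
        = ∫ x, ∑ q, ∑ r, c q * conj (c r) * (b q x * conj (b r x)) ∂(nu d) := by
          congr 1
          ext x
          rw [map_sum, Finset.sum_mul_sum]
          refine Finset.sum_congr rfl fun q _ => Finset.sum_congr rfl fun r _ => ?_
          rw [map_mul]
          ring
      _ = ∑ q, ∑ r, c q * conj (c r) * ∫ x, b q x * conj (b r x) ∂(nu d) := by
          rw [integral_finsetSum _ fun q _ => integrable_finsetSum _ fun r _ => hi q r]
          refine Finset.sum_congr rfl fun q _ => ?_
          rw [integral_finsetSum _ fun r _ => hi q r]
          simp_rw [integral_const_mul]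
      _ = _ := by simp [hb.orthonormal]
  simp_rw [Complex.mul_conj', ← Complex.ofReal_pow, ← Complex.ofReal_sum] at h1
  rw [integral_complex_ofReal] at h1
  exact_mod_cast h1

theorem norm_sum_mul_sq_le {ι : Type*} (s : Finset ι) (a v : ι → ℂ) :
    ‖∑ i ∈ s, a i * v i‖ ^ 2 ≤ (∑ i ∈ s, ‖a i‖ ^ 2) * ∑ i ∈ s, ‖v i‖ ^ 2 := by
  calc ‖∑ i ∈ s, a i * v i‖ ^ 2 ≤ (∑ i ∈ s, ‖a i‖ * ‖v i‖) ^ 2 := by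
        gcongr
        exact (norm_sum_le _ _).trans_eq (Finset.sum_congr rfl fun i _ => norm_mul _ _)
    _ ≤ _ := Finset.sum_mul_sq_le_sq_mul_sq _ _ _

/-- A reproducing kernel argument. The kernel `h` centred at `L x` has value `K` at `L x` and
squared norm `K`. The function `h ∘ L` is again a harmonic of squared norm `K`, so Cauchy–Schwarz at
`x` gives `K² ≤ K * ∑ q, ‖b q x‖²`. -/
theorem IsHarmONB.sum_norm_sq_isoSph_le {d l : ℕ} {b : Fin (sphDim d l) → Sph d → ℂ}
    (hb : IsHarmONB d l b) (L : Euc d ≃ₗᵢ[ℝ] Euc d) (x : Sph d) :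
    ∑ q, ‖b q (isoSph L x)‖ ^ 2 ≤ ∑ q, ‖b q x‖ ^ 2 := by
  set K := ∑ q, ‖b q (isoSph L x)‖ ^ 2 with hK
  let h : Sph d → ℂ := fun y => ∑ q, conj (b q (isoSph L x)) * b q y
  have hh : h ∈ sphHarm d l := by
    have : h = ∑ q, conj (b q (isoSph L x)) • b q := by
      ext y
      simp [h]
    rw [this]
    exact Submodule.sum_mem _ fun q _ => Submodule.smul_mem _ _ (hb.mem q)
  have hval : h (isoSph L x) = (K : ℂ) := by
    simp only [h, hK, Complex.conj_mul']
    push_cast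
    rfl
  have hnorm : ∫ y, ‖h y‖ ^ 2 ∂(nu d) = K := by
    rw [hb.integral_norm_sq]
    simp [hK]
  set c : Fin (sphDim d l) → ℂ := fun q => ∫ y, (h ∘ isoSph L) y * conj (b q y) ∂(nu d) with hc
  have hexp := hb.eq_sum (isoSph_comp_mem_sphHarm L hh)
  have hcsum : ∑ q, ‖c q‖ ^ 2 = K := by
    rw [← hb.integral_norm_sq, ← hnorm]
    simp_rw [hc, ← hexp]
    have hcont : Continuous fun y => ‖h y‖ ^ 2 := (continuous_of_mem_sphHarm hh).norm.pow 2
    conv_rhs => rw [← (measurePreserving_isoSph L).map_eq]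
    rw [integral_map (continuous_isoSph L).measurable.aemeasurable hcont.aestronglyMeasurable]
    rfl
  have h1 := norm_sum_mul_sq_le Finset.univ c fun q => b q x
  rw [← hexp x, hcsum, Function.comp_apply, hval, Complex.norm_real, Real.norm_eq_abs,
    sq_abs] at h1
  have hK0 : 0 ≤ K := Finset.sum_nonneg fun _ _ => sq_nonneg _
  rcases hK0.eq_or_lt with h0 | h0
  · rw [← h0]
    exact Finset.sum_nonneg fun _ _ => sq_nonneg _
  · rw [sq] at h1
    exact le_of_mul_le_mul_left h1 h0

theorem nu_real_univ_pos (d : ℕ) : 0 < (nu d).real Set.univ := by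
  have h : nu d ≠ 0 := Measure.toSphere_ne_zero _
  rw [measureReal_def, ENNReal.toReal_pos_iff]
  exact ⟨by simpa [pos_iff_ne_zero] using h, measure_lt_top _ _⟩

/-- Isometries act transitively, so the sum is constant; its integral counts the basis elements. -/
theorem IsHarmONB.sum_norm_sq {d l : ℕ} {b : Fin (sphDim d l) → Sph d → ℂ}
    (hb : IsHarmONB d l b) (x : Sph d) :
    ∑ q, ‖b q x‖ ^ 2 = sphDim d l / (nu d).real Set.univ := by
  have hconst : ∀ y, ∑ q, ‖b q y‖ ^ 2 = ∑ q, ‖b q x‖ ^ 2 := by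
    intro y
    obtain ⟨L, rfl⟩ := exists_isoSph_eq x y
    obtain ⟨L', hL'⟩ := exists_isoSph_eq (isoSph L x) x
    refine le_antisymm (hb.sum_norm_sq_isoSph_le L x) ?_
    have := hb.sum_norm_sq_isoSph_le L' (isoSph L x)
    rwa [hL'] at this
  have h1 : ∫ y, ∑ q, ‖b q y‖ ^ 2 ∂(nu d) = sphDim d l := by
    have hi : ∀ q, Integrable (fun y => ‖b q y‖ ^ 2) (nu d) := fun q =>
      ((hb.continuous q).norm.pow 2).integrable_of_hasCompactSupport
        (HasCompactSupport.of_compactSpace _)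
    rw [integral_finsetSum _ fun q _ => hi q]
    have h2 : ∀ q, ∫ y, ‖b q y‖ ^ 2 ∂(nu d) = 1 := by
      intro q
      have := hb.integral_norm_sq (Pi.single q 1)
      simpa [Pi.single_apply, apply_ite, ite_pow] using this
    simp [h2]
  simp_rw [hconst] at h1
  rw [integral_const, smul_eq_mul] at h1
  rw [eq_div_iff (nu_real_univ_pos d).ne', mul_comm, h1]

/-- The constant in the bound for the diagonal of the reproducing kernel. -/
def diagConst (d : ℕ) : ℝ := 2 / (nu d).real Set.univ

theorem diagConst_pos (d : ℕ) : 0 < diagConst d := div_pos two_pos (nu_real_univ_pos d)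

theorem IsHarmONB.sum_norm_sq_le {d l : ℕ} (hd : 1 ≤ d) {b : Fin (sphDim d l) → Sph d → ℂ}
    (hb : IsHarmONB d l b) (x : Sph d) :
    ∑ q, ‖b q x‖ ^ 2 ≤ diagConst d * ((l : ℝ) + 1) ^ (d - 1) := by
  rw [hb.sum_norm_sq, diagConst, div_mul_eq_mul_div]
  have := nu_real_univ_pos d
  gcongr
  exact_mod_cast sphDim_le hd l

variable {d : ℕ} {B : ∀ l, Fin (sphDim d l) → Sph d → ℂ}

/-- A basis function as a bundled continuous function. -/
def harmC (hB : ∀ l, IsHarmONB d l (B l)) (l : ℕ) (q : Fin (sphDim d l)) : C(Sph d, ℂ) :=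
  ⟨B l q, (hB l).continuous q⟩

/-- The coefficient of `g` along `B l q`. -/
def coef (B : ∀ l, Fin (sphDim d l) → Sph d → ℂ) (g : Sph d → ℂ) (l : ℕ) (q : Fin (sphDim d l)) :
    ℂ :=
  ∫ x, g x * conj (B l q x) ∂(nu d)

theorem inner_toL2_harmC (hB : ∀ l, IsHarmONB d l (B l)) (g : C(Sph d, ℂ)) (l : ℕ)
    (q : Fin (sphDim d l)) :
    inner ℂ (toL2 d (harmC hB l q)) (toL2 d g) = coef B g l q :=
  ContinuousMap.inner_toLp (nu d) (harmC hB l q) g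

/-- The family of all basis functions in `L²(ν)`. -/
def harmL2 (hB : ∀ l, IsHarmONB d l (B l)) (σ : Σ l, Fin (sphDim d l)) : Lp ℂ 2 (nu d) :=
  toL2 d (harmC hB σ.1 σ.2)

theorem orthonormal_harmL2 (hd : 1 ≤ d) (hB : ∀ l, IsHarmONB d l (B l)) :
    Orthonormal ℂ (harmL2 hB) := by
  classical
  rw [orthonormal_iff_ite]
  rintro ⟨l, q⟩ ⟨l', q'⟩
  rw [harmL2, harmL2, inner_toL2_harmC]
  change ∫ x, B l' q' x * conj (B l q x) ∂(nu d) = _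
  by_cases hl : l = l'
  · subst hl
    rw [(hB l).orthonormal]
    simp [eq_comm]
  · rw [integral_mul_conj_eq_zero hd (Ne.symm hl) ((hB l').mem q') ((hB l).mem q)]
    simp [hl]

/-- The coordinate functions on the sphere. -/
def coordC (d : ℕ) (i : Fin (d + 1)) : C(Sph d, ℂ) := ⟨fun x => ((x.1 i : ℝ) : ℂ), by fun_prop⟩

theorem aeval_coordC_apply (p : MvPolynomial (Fin (d + 1)) ℂ) (x : Sph d) :
    MvPolynomial.aeval (coordC d) p x = restrictSph d p x := by
  have := MvPolynomial.comp_aeval_apply (coordC d) (ContinuousMap.evalAlgHom ℂ ℂ x) p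
  exact this

/-- The polynomial functions on the sphere, as a star subalgebra. -/
def polySph (d : ℕ) : StarSubalgebra ℂ C(Sph d, ℂ) where
  toSubalgebra := (MvPolynomial.aeval (coordC d)).range
  star_mem' := by
    rintro _ ⟨p, rfl⟩
    induction p using MvPolynomial.induction_on with
    | C a =>
      refine ⟨MvPolynomial.C (conj a), ?_⟩
      ext x
      simp
    | add p q hp hq =>
      rw [map_add, star_add]
      exact (MvPolynomial.aeval (coordC d)).range.add_mem hp hq
    | mul_X p i hp =>
      rw [map_mul, star_mul]
      refine (MvPolynomial.aeval (coordC d)).range.mul_mem ⟨MvPolynomial.X i, ?_⟩ hp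
      ext x
      simp [coordC]

theorem polySph_topologicalClosure (d : ℕ) : (polySph d).topologicalClosure = ⊤ := by
  refine ContinuousMap.starSubalgebra_topologicalClosure_eq_top_of_separatesPoints _ ?_
  intro x y hxy
  obtain ⟨i, hi⟩ : ∃ i, x.1 i ≠ y.1 i := by
    by_contra! h
    exact hxy (Subtype.ext (PiLp.ext h))
  refine ⟨coordC d i, ⟨coordC d i, ⟨MvPolynomial.X i, ?_⟩, rfl⟩, ?_⟩
  · exact MvPolynomial.aeval_X _ _
  · simpa [coordC] using hi

theorem span_harmL2_dense (hd : 1 ≤ d) (hB : ∀ l, IsHarmONB d l (B l)) :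
    (Submodule.span ℂ (Set.range (harmL2 hB))).topologicalClosure = ⊤ := by
  set W := (Submodule.span ℂ (Set.range (harmL2 hB))).topologicalClosure with hW
  have hWc : IsClosed (W : Set (Lp ℂ 2 (nu d))) := Submodule.isClosed_topologicalClosure _
  have hharm : ∀ f : C(Sph d, ℂ), (f : Sph d → ℂ) ∈ ⨆ l, sphHarm d l → toL2 d f ∈ W := by
    intro f hf
    -- Members of the supremum are bare functions, so the induction has to carry continuity along
    -- with membership in `W`.
    have h0 : ∀ h : Sph d → ℂ, h ∈ ⨆ l, sphHarm d l →
        ∃ hc : Continuous h, toL2 d ⟨h, hc⟩ ∈ W := by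
      intro h hh
      induction hh using Submodule.iSup_induction' with
      | mem l h hh =>
        refine ⟨continuous_of_mem_sphHarm hh, ?_⟩
        have : (⟨h, continuous_of_mem_sphHarm hh⟩ : C(Sph d, ℂ))
            = ∑ q, (∫ y, h y * conj (B l q y) ∂(nu d)) • harmC hB l q := by
          ext x
          simpa [harmC] using (hB l).eq_sum hh x
        rw [this, map_sum]
        refine Submodule.sum_mem _ fun q _ => ?_
        rw [map_smul]
        exact Submodule.smul_mem _ _
          (Submodule.le_topologicalClosure _ (Submodule.subset_span ⟨⟨l, q⟩, rfl⟩))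
      | zero =>
        exact ⟨continuous_zero, by
          rw [show (⟨0, continuous_zero⟩ : C(Sph d, ℂ)) = 0 from rfl, map_zero]
          exact Submodule.zero_mem _⟩
      | add f g _ _ hf hg =>
        obtain ⟨hfc, hf⟩ := hf
        obtain ⟨hgc, hg⟩ := hg
        refine ⟨hfc.add hgc, ?_⟩
        rw [show (⟨f + g, hfc.add hgc⟩ : C(Sph d, ℂ)) = ⟨f, hfc⟩ + ⟨g, hgc⟩ from rfl, map_add]
        exact Submodule.add_mem _ hf hg
    exact (h0 f hf).2
  have hall : ∀ f : C(Sph d, ℂ), toL2 d f ∈ W := by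
    intro f
    have hf : f ∈ closure (polySph d : Set C(Sph d, ℂ)) := by
      rw [← StarSubalgebra.topologicalClosure_coe, polySph_topologicalClosure]
      trivial
    have hcl : IsClosed {f : C(Sph d, ℂ) | toL2 d f ∈ W} := hWc.preimage (toL2 d).continuous
    refine closure_minimal ?_ hcl hf
    rintro _ ⟨p, rfl⟩
    apply hharm
    have : ((MvPolynomial.aeval (coordC d) p : C(Sph d, ℂ)) : Sph d → ℂ) = restrictSph d p := by
      ext x; exact aeval_coordC_apply p x
    change ((MvPolynomial.aeval (coordC d) p : C(Sph d, ℂ)) : Sph d → ℂ) ∈ _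
    rw [this]
    exact restrictSph_mem_iSup hd p
  rw [eq_top_iff]
  intro f _
  have hdense := ContinuousMap.toLp_denseRange ℂ (nu d) ℂ (p := 2) (by simp)
  have : closure (Set.range (toL2 d)) ⊆ W :=
    closure_minimal (by rintro _ ⟨g, rfl⟩; exact hall g) hWc
  exact this (hdense f)

/-- The Hilbert basis of `L²(ν)` of spherical harmonics. -/
def harmBasis (hd : 1 ≤ d) (hB : ∀ l, IsHarmONB d l (B l)) :
    HilbertBasis (Σ l, Fin (sphDim d l)) ℂ (Lp ℂ 2 (nu d)) :=
  HilbertBasis.mk (orthonormal_harmL2 hd hB) (span_harmL2_dense hd hB).ge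

theorem hasSum_norm_coef_sq (hd : 1 ≤ d) (hB : ∀ l, IsHarmONB d l (B l)) (g : C(Sph d, ℂ)) :
    HasSum (fun σ : Σ l, Fin (sphDim d l) => ‖coef B g σ.1 σ.2‖ ^ 2) (‖toL2 d g‖ ^ 2) := by
  have h := (harmBasis hd hB).hasSum_inner_mul_inner (toL2 d g) (toL2 d g)
  rw [inner_self_eq_norm_sq_to_K] at h
  have h2 : ∀ σ : Σ l, Fin (sphDim d l),
      inner ℂ (toL2 d g) (harmBasis hd hB σ) * inner ℂ (harmBasis hd hB σ) (toL2 d g)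
        = ((‖coef B g σ.1 σ.2‖ ^ 2 : ℝ) : ℂ) := by
    intro σ
    have h3 : inner ℂ (harmBasis hd hB σ) (toL2 d g) = coef B g σ.1 σ.2 := by
      rw [harmBasis, HilbertBasis.coe_mk]
      exact inner_toL2_harmC hB g σ.1 σ.2
    rw [← inner_conj_symm, h3, Complex.conj_mul', Complex.ofReal_pow]
  simp_rw [h2] at h
  have h4 := Complex.hasSum_re h
  simpa [← Complex.ofReal_pow] using h4

instance instIsOpenPosMeasureNu (d : ℕ) : (nu d).IsOpenPosMeasure :=
  inferInstanceAs (volume : Measure (Euc d)).toSphere.IsOpenPosMeasure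

theorem coef_sub (hB : ∀ l, IsHarmONB d l (B l)) (f g : C(Sph d, ℂ)) (l : ℕ)
    (q : Fin (sphDim d l)) : coef B (f - g : C(Sph d, ℂ)) l q = coef B f l q - coef B g l q := by
  rw [← inner_toL2_harmC hB, map_sub, inner_sub_right, inner_toL2_harmC, inner_toL2_harmC]

/-- Parseval makes the difference zero in `L²`, and `nu` charges every nonempty open set, so
continuous representatives agree everywhere. -/
theorem eq_of_coef_eq (hd : 1 ≤ d) (hB : ∀ l, IsHarmONB d l (B l)) {f g : C(Sph d, ℂ)}
    (h : ∀ l q, coef B f l q = coef B g l q) : f = g := by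
  have h1 := hasSum_norm_coef_sq hd hB (f - g)
  have h2 : ∀ σ : Σ l, Fin (sphDim d l), ‖coef B (f - g : C(Sph d, ℂ)) σ.1 σ.2‖ ^ 2 = 0 := by
    intro σ
    rw [coef_sub hB, h, sub_self, norm_zero, zero_pow two_ne_zero]
  simp_rw [h2] at h1
  have h3 : toL2 d (f - g) = 0 := by
    have h4 := hasSum_zero.unique h1
    exact norm_eq_zero.1 (pow_eq_zero_iff two_ne_zero |>.1 h4.symm)
  exact sub_eq_zero.1 (ContinuousMap.toLp_injective (nu d) (h3.trans (map_zero (toL2 d)).symm))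

/-- The finite harmonic sum with coefficients `a` over the degrees `l < N`. -/
def harmSum (hB : ∀ l, IsHarmONB d l (B l)) (a : ∀ l, Fin (sphDim d l) → ℂ) (N : ℕ) :
    C(Sph d, ℂ) :=
  ∑ l ∈ Finset.range N, ∑ q, a l q • harmC hB l q

theorem harmSum_apply (hB : ∀ l, IsHarmONB d l (B l)) (a : ∀ l, Fin (sphDim d l) → ℂ) (N : ℕ)
    (x : Sph d) : harmSum hB a N x = ∑ l ∈ Finset.range N, ∑ q, a l q * B l q x := by
  simp [harmSum, harmC]

theorem harmSum_sub (hB : ∀ l, IsHarmONB d l (B l)) (a b : ∀ l, Fin (sphDim d l) → ℂ) (N : ℕ) :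
    harmSum hB (fun l q => a l q - b l q) N = harmSum hB a N - harmSum hB b N := by
  ext x
  simp only [harmSum_apply, ContinuousMap.sub_apply, sub_mul, Finset.sum_sub_distrib]

theorem toL2_harmSum (hB : ∀ l, IsHarmONB d l (B l)) (a : ∀ l, Fin (sphDim d l) → ℂ) (N : ℕ) :
    toL2 d (harmSum hB a N)
      = ∑ σ ∈ (Finset.range N).sigma fun _ => Finset.univ, a σ.1 σ.2 • harmL2 hB σ := by
  simp only [harmSum, map_sum, map_smul, Finset.sum_sigma, harmL2]

theorem norm_toL2_harmSum_sq (hd : 1 ≤ d) (hB : ∀ l, IsHarmONB d l (B l))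
    (a : ∀ l, Fin (sphDim d l) → ℂ) (N : ℕ) :
    ‖toL2 d (harmSum hB a N)‖ ^ 2 = ∑ l ∈ Finset.range N, ∑ q, ‖a l q‖ ^ 2 := by
  have h : ((‖toL2 d (harmSum hB a N)‖ : ℂ)) ^ 2
      = ((∑ l ∈ Finset.range N, ∑ q, ‖a l q‖ ^ 2 : ℝ) : ℂ) := by
    have h1 := inner_self_eq_norm_sq_to_K (𝕜 := ℂ) (toL2 d (harmSum hB a N))
    rw [toL2_harmSum, (orthonormal_harmL2 hd hB).inner_sum, Finset.sum_sigma] at h1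
    rw [toL2_harmSum]
    simp_rw [Complex.conj_mul'] at h1
    push_cast
    exact h1.symm
  exact_mod_cast h

theorem coef_harmSum (hd : 1 ≤ d) (hB : ∀ l, IsHarmONB d l (B l))
    (a : ∀ l, Fin (sphDim d l) → ℂ) (N l : ℕ) (q : Fin (sphDim d l)) :
    coef B (harmSum hB a N) l q = if l < N then a l q else 0 := by
  classical
  rw [← inner_toL2_harmC hB, toL2_harmSum, inner_sum]
  change ∑ σ ∈ _, inner ℂ (harmL2 hB ⟨l, q⟩) _ = _
  simp_rw [inner_smul_right, orthonormal_iff_ite.1 (orthonormal_harmL2 hd hB)]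
  simp

/-- Cauchy–Schwarz against the diagonal of the reproducing kernel. This passage from `L²` to
pointwise control costs `N ^ d`. -/
theorem norm_harmSum_apply_sq_le (hd : 1 ≤ d) (hB : ∀ l, IsHarmONB d l (B l))
    (a : ∀ l, Fin (sphDim d l) → ℂ) (N : ℕ) (x : Sph d) :
    ‖harmSum hB a N x‖ ^ 2
      ≤ (∑ l ∈ Finset.range N, ∑ q, ‖a l q‖ ^ 2) * (diagConst d * (N : ℝ) ^ d) := by
  have h1 := norm_sum_mul_sq_le ((Finset.range N).sigma fun l => (Finset.univ : Finset (Fin (sphDim d l))))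
    (fun σ => a σ.1 σ.2) (fun σ => B σ.1 σ.2 x)
  simp only [Finset.sum_sigma] at h1
  rw [harmSum_apply]
  refine h1.trans ?_
  gcongr
  calc ∑ l ∈ Finset.range N, ∑ q, ‖B l q x‖ ^ 2
      ≤ ∑ l ∈ Finset.range N, diagConst d * (N : ℝ) ^ (d - 1) := by
        refine Finset.sum_le_sum fun l hl => ((hB l).sum_norm_sq_le hd x).trans ?_
        have := (diagConst_pos d).le
        gcongr
        exact_mod_cast Finset.mem_range.1 hl
    _ = diagConst d * (N : ℝ) ^ d := by
        obtain ⟨e, rfl⟩ : ∃ e, d = e + 1 := ⟨d - 1, by omega⟩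
        simp only [Finset.sum_const, Finset.card_range, nsmul_eq_mul, Nat.add_sub_cancel]
        ring

/-- `g` has a `k`-th power of the spherical Laplacian among the continuous functions. -/
def HasLaplacianPow (B : ∀ l, Fin (sphDim d l) → Sph d → ℂ) (k : ℕ) (g : Sph d → ℂ)
    (G : C(Sph d, ℂ)) : Prop :=
  ∀ l q, coef B G l q = (lam d l : ℂ) ^ k * coef B g l q

theorem exists_hasLaplacianPow (hd : 1 ≤ d) (hB : ∀ l, IsHarmONB d l (B l)) {k : ℕ}
    {f : Sph d → ℝ} (hf : IsCk (2 * k) f) : ∃ G, HasLaplacianPow B k (fun x => (f x : ℂ)) G := by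
  obtain ⟨G, hG⟩ := exists_laplacian_pow hd hf
  exact ⟨G, fun l q => hG l _ ((hB l).mem q)⟩

/-- For `l ≥ N` the eigenvalue is at least `N ^ 2`; its `k`-th power, squared, gives `N ^ (4 * k)`.
-/
theorem norm_coef_sq_le (hd : 1 ≤ d) {k : ℕ} {g : Sph d → ℂ} {G : C(Sph d, ℂ)}
    (hG : HasLaplacianPow B k g G) {N l : ℕ} (hN : 1 ≤ N) (hl : N ≤ l) (q : Fin (sphDim d l)) :
    ‖coef B g l q‖ ^ 2 ≤ ((N : ℝ) ^ (4 * k))⁻¹ * ‖coef B G l q‖ ^ 2 := by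
  have hNpos : (0 : ℝ) < N := by exact_mod_cast hN
  rw [hG l q, norm_mul, norm_pow, Complex.norm_natCast, mul_pow, inv_mul_eq_div, le_div_iff₀
    (by positivity), mul_comm]
  gcongr
  have h1 : (N : ℝ) ^ 2 ≤ lam d l := by
    have h2 := sq_le_lam hd l
    have h3 : N ^ 2 ≤ l ^ 2 := Nat.pow_le_pow_left hl 2
    exact_mod_cast h3.trans h2
  calc (N : ℝ) ^ (4 * k) = (((N : ℝ) ^ 2) ^ k) ^ 2 := by rw [← pow_mul, ← pow_mul]; congr 1; ring
    _ ≤ ((lam d l : ℝ) ^ k) ^ 2 := by gcongr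

theorem norm_toL2_sub_harmSum_sq_le (hd : 1 ≤ d) (hB : ∀ l, IsHarmONB d l (B l)) {k : ℕ}
    {g G : C(Sph d, ℂ)} (hG : HasLaplacianPow B k g G) {N : ℕ} (hN : 1 ≤ N) :
    ‖toL2 d (g - harmSum hB (coef B g) N)‖ ^ 2
      ≤ ((N : ℝ) ^ (4 * k))⁻¹ * ‖toL2 d G‖ ^ 2 := by
  refine hasSum_le (fun σ => ?_) (hasSum_norm_coef_sq hd hB (g - harmSum hB (coef B g) N))
    ((hasSum_norm_coef_sq hd hB G).mul_left _)
  rw [coef_sub hB, coef_harmSum hd hB]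
  split_ifs with h
  · rw [sub_self, norm_zero, zero_pow two_ne_zero]
    positivity
  · rw [sub_zero]
    exact norm_coef_sq_le hd hG hN (not_lt.1 h) σ.2

/-- By Cauchy–Schwarz, the squared supremum norm of the degree `l` block is at most `β l` times a
multiple of `l^(d-1-4k)`, where `β` is summable by Parseval for `G`. As `d < 4k`, the second factor
is `O(l⁻²)`, and the geometric mean of two summable sequences is summable. The uniform limit is
continuous with the coefficients of `g`, hence equals `g`. -/
theorem tendsto_norm_sub_harmSum (hd : 1 ≤ d) (hB : ∀ l, IsHarmONB d l (B l)) {k : ℕ}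
    (hk : d < 4 * k) {g G : C(Sph d, ℂ)} (hG : HasLaplacianPow B k g G) :
    Tendsto (fun N => ‖g - harmSum hB (coef B g) N‖) atTop (𝓝 0) := by
  let p : ℕ → C(Sph d, ℂ) := fun l => ∑ q, coef B g l q • harmC hB l q
  let β : ℕ → ℝ := fun l => ∑ q, ‖coef B G l q‖ ^ 2
  have hβ : Summable β := ((hasSum_norm_coef_sq hd hB G).sigma fun l => hasSum_fintype _).summable
  have hbound : ∀ l, ‖p (l + 1)‖
      ≤ β (l + 1) + diagConst d * 2 ^ (d - 1) * (((l + 1 : ℕ) : ℝ) ^ 2)⁻¹ := by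
    intro l
    have hD := diagConst_pos d
    have hβ0 : 0 ≤ β (l + 1) := Finset.sum_nonneg fun _ _ => sq_nonneg _
    rw [ContinuousMap.norm_le _ (by positivity)]
    intro x
    have h1 := norm_sum_mul_sq_le Finset.univ (coef B g (l + 1)) fun q => B (l + 1) q x
    have h2 : p (l + 1) x = ∑ q, coef B g (l + 1) q * B (l + 1) q x := by simp [p, harmC]
    have hL : (0 : ℝ) < ((l + 1 : ℕ) : ℝ) := by positivity
    have hL1 : (1 : ℝ) ≤ ((l + 1 : ℕ) : ℝ) := by exact_mod_cast Nat.le_add_left 1 l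
    have h3 : ∑ q, ‖coef B g (l + 1) q‖ ^ 2
        ≤ (((l + 1 : ℕ) : ℝ) ^ (4 * k))⁻¹ * β (l + 1) := by
      rw [Finset.mul_sum]
      exact Finset.sum_le_sum fun q _ => norm_coef_sq_le hd hG (Nat.le_add_left 1 l) le_rfl q
    have h4 := (hB (l + 1)).sum_norm_sq_le hd x
    have h5 : ((((l + 1 : ℕ) : ℝ)) + 1) ^ (d - 1)
        ≤ 2 ^ (d - 1) * ((l + 1 : ℕ) : ℝ) ^ (d - 1) := by
      rw [← mul_pow]
      gcongr
      linarith
    have h6 : (((l + 1 : ℕ) : ℝ) ^ (4 * k))⁻¹ * ((l + 1 : ℕ) : ℝ) ^ (d - 1)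
        ≤ (((l + 1 : ℕ) : ℝ) ^ 2)⁻¹ := by
      rw [inv_mul_le_iff₀ (by positivity), ← div_eq_mul_inv, le_div_iff₀ (by positivity),
        ← pow_add]
      exact pow_le_pow_right₀ hL1 (by omega)
    set c := diagConst d * 2 ^ (d - 1) * (((l + 1 : ℕ) : ℝ) ^ 2)⁻¹ with hc
    have hc0 : 0 ≤ c := by positivity
    have h7 : ‖p (l + 1) x‖ ^ 2 ≤ β (l + 1) * c := by
      rw [h2]
      calc _ ≤ _ := h1
        _ ≤ ((((l + 1 : ℕ) : ℝ) ^ (4 * k))⁻¹ * β (l + 1)) *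
            (diagConst d * (2 ^ (d - 1) * ((l + 1 : ℕ) : ℝ) ^ (d - 1))) := by
          gcongr
          exact h4.trans (by gcongr)
        _ = β (l + 1) * (diagConst d * 2 ^ (d - 1) *
            ((((l + 1 : ℕ) : ℝ) ^ (4 * k))⁻¹ * ((l + 1 : ℕ) : ℝ) ^ (d - 1))) := by ring
        _ ≤ β (l + 1) * c := by rw [hc]; gcongr
    refine abs_le_of_sq_le_sq' (?_ : ‖p (l + 1) x‖ ^ 2 ≤ _) (by positivity) |>.2
    -- The crude form `β c ≤ (β + c)²` of the arithmetic–geometric mean inequality.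
    nlinarith [mul_nonneg hβ0 hc0]
  have hsum : Summable p := by
    rw [← summable_nat_add_iff 1]
    refine Summable.of_norm_bounded (((summable_nat_add_iff 1).2 hβ).add
      (((summable_nat_add_iff 1).2 (Real.summable_nat_pow_inv.2 one_lt_two)).mul_left _)) hbound
  have hS := hsum.hasSum.tendsto_sum_nat
  have hlim : ∀ l q, coef B (∑' l, p l : C(Sph d, ℂ)) l q = coef B g l q := by
    intro l q
    have h1 : Tendsto (fun N => coef B (harmSum hB (coef B g) N) l q) atTop
        (𝓝 (coef B (∑' l, p l : C(Sph d, ℂ)) l q)) := by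
      simp_rw [← inner_toL2_harmC hB]
      exact ((innerSL ℂ (toL2 d (harmC hB l q))).continuous.comp
        (toL2 d).continuous).continuousAt.tendsto.comp hS
    refine tendsto_nhds_unique h1 (tendsto_const_nhds.congr' ?_)
    filter_upwards [eventually_gt_atTop l] with N hN
    rw [coef_harmSum hd hB, if_pos hN]
  rw [eq_of_coef_eq hd hB hlim] at hS
  have h8 : Tendsto (fun N => harmSum hB (coef B g) N) atTop (𝓝 g) := hS
  simpa using ((tendsto_const_nhds (x := g)).sub h8).norm

end SphereDeconv
end

noncomputable section

namespace SphereDeconv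

/-! ### Means of independent identically distributed variables -/

section Mean

variable {Ω : Type*} [MeasurableSpace Ω] {P : Measure Ω} [IsProbabilityMeasure P]

theorem integral_mean_sub_sq_le {V : ℕ → Ω → ℝ} {V₀ : Ω → ℝ} (hind : iIndepFun V P)
    (hid : ∀ i, IdentDistrib (V i) V₀ P P) (hL2 : MemLp V₀ 2 P) {n : ℕ} (hn : 1 ≤ n) :
    Integrable (fun ω => ((n : ℝ)⁻¹ * ∑ i ∈ Finset.range n, V i ω - ∫ ω, V₀ ω ∂P) ^ 2) P ∧
    ∫ ω, ((n : ℝ)⁻¹ * ∑ i ∈ Finset.range n, V i ω - ∫ ω, V₀ ω ∂P) ^ 2 ∂P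
      ≤ (n : ℝ)⁻¹ * ∫ ω, V₀ ω ^ 2 ∂P := by
  have hVi : ∀ i, MemLp (V i) 2 P := fun i => (hid i).memLp_iff.2 hL2
  have hn0 : (n : ℝ) ≠ 0 := by positivity
  set S : Ω → ℝ := fun ω => (n : ℝ)⁻¹ * ∑ i ∈ Finset.range n, V i ω with hS
  have hSL : MemLp S 2 P := (memLp_finsetSum _ fun i _ => hVi i).const_mul _
  have hmean : ∫ ω, S ω ∂P = ∫ ω, V₀ ω ∂P := by
    rw [hS, integral_const_mul, integral_finsetSum _ fun i _ => (hVi i).integrable one_le_two]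
    simp_rw [(hid _).integral_eq]
    simp [hn0]
  refine ⟨(hSL.sub (memLp_const _)).integrable_sq, ?_⟩
  have hvar : ∫ ω, (S ω - ∫ ω, V₀ ω ∂P) ^ 2 ∂P = variance S P := by
    rw [variance_eq_integral hSL.aestronglyMeasurable.aemeasurable, hmean]
  have hvar2 : variance S P = (n : ℝ)⁻¹ * variance V₀ P := by
    have h1 : S = fun ω => (n : ℝ)⁻¹ * (∑ i ∈ Finset.range n, V i) ω := by
      ext ω; simp [hS]
    rw [h1, variance_const_mul, IndepFun.variance_sum (fun i _ => hVi i)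
      fun i _ j _ hij => hind.indepFun hij]
    simp_rw [(hid _).variance_eq]
    simp only [Finset.sum_const, Finset.card_range, nsmul_eq_mul]
    field_simp
  calc _ = (n : ℝ)⁻¹ * variance V₀ P := hvar.trans hvar2
    _ ≤ _ := by
      gcongr
      exact variance_le_expectation_sq hL2.aestronglyMeasurable

/-- Real and imaginary parts are treated separately, since their squared errors add up. -/
theorem integral_norm_mean_sub_sq_le {V : ℕ → Ω → ℂ} {V₀ : Ω → ℂ} (hind : iIndepFun V P)
    (hid : ∀ i, IdentDistrib (V i) V₀ P P) (hL2 : MemLp V₀ 2 P) {n : ℕ} (hn : 1 ≤ n) :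
    Integrable (fun ω => ‖(n : ℂ)⁻¹ * ∑ i ∈ Finset.range n, V i ω - ∫ ω, V₀ ω ∂P‖ ^ 2) P ∧
    ∫ ω, ‖(n : ℂ)⁻¹ * ∑ i ∈ Finset.range n, V i ω - ∫ ω, V₀ ω ∂P‖ ^ 2 ∂P
      ≤ (n : ℝ)⁻¹ * ∫ ω, ‖V₀ ω‖ ^ 2 ∂P := by
  have hint := hL2.integrable one_le_two
  have hre := integral_mean_sub_sq_le (hind.comp (fun _ => Complex.re) fun _ => Complex.measurable_re)
    (fun i => (hid i).comp Complex.measurable_re) hL2.re hn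
  have him := integral_mean_sub_sq_le (hind.comp (fun _ => Complex.im) fun _ => Complex.measurable_im)
    (fun i => (hid i).comp Complex.measurable_im) hL2.im hn
  have hIre : (∫ ω, V₀ ω ∂P).re = ∫ ω, (V₀ ω).re ∂P := (integral_re hint).symm
  have hIim : (∫ ω, V₀ ω ∂P).im = ∫ ω, (V₀ ω).im ∂P := (integral_im hint).symm
  have key : ∀ ω, ‖(n : ℂ)⁻¹ * ∑ i ∈ Finset.range n, V i ω - ∫ ω, V₀ ω ∂P‖ ^ 2
      = ((n : ℝ)⁻¹ * ∑ i ∈ Finset.range n, (V i ω).re - ∫ ω, (V₀ ω).re ∂P) ^ 2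
        + ((n : ℝ)⁻¹ * ∑ i ∈ Finset.range n, (V i ω).im - ∫ ω, (V₀ ω).im ∂P) ^ 2 := by
    intro ω
    have hn' : (n : ℂ)⁻¹ = (((n : ℝ)⁻¹ : ℝ) : ℂ) := by push_cast; rfl
    rw [Complex.sq_norm, Complex.normSq_apply, ← hIre, ← hIim, hn']
    simp only [Complex.sub_re, Complex.sub_im, Complex.re_ofReal_mul, Complex.im_ofReal_mul,
      Complex.re_sum, Complex.im_sum]
    ring
  have hsq : ∀ ω, ‖V₀ ω‖ ^ 2 = (V₀ ω).re ^ 2 + (V₀ ω).im ^ 2 := by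
    intro ω
    rw [Complex.sq_norm, Complex.normSq_apply]
    ring
  simp only [Function.comp_apply] at hre him
  simp_rw [key, hsq]
  refine ⟨hre.1.add him.1, ?_⟩
  have hadd : ∫ ω, ((V₀ ω).re ^ 2 + (V₀ ω).im ^ 2) ∂P
      = ∫ ω, (V₀ ω).re ^ 2 ∂P + ∫ ω, (V₀ ω).im ^ 2 ∂P :=
    integral_add hL2.re.integrable_sq hL2.im.integrable_sq
  rw [integral_add hre.1 him.1, hadd, mul_add]
  exact add_le_add hre.2 him.2

end Mean

theorem sum_norm_mulVec_sq_le {N : ℕ} (A : Matrix (Fin N) (Fin N) ℂ) (v : Fin N → ℂ) :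
    ∑ q, ‖∑ r, A q r * v r‖ ^ 2 ≤ opNorm A ^ 2 * ∑ r, ‖v r‖ ^ 2 := by
  have h := (Matrix.toEuclideanCLM (𝕜 := ℂ) A).le_opNorm (WithLp.toLp 2 v)
  have h2 := pow_le_pow_left₀ (norm_nonneg _) h 2
  rw [mul_pow, EuclideanSpace.norm_sq_eq, EuclideanSpace.norm_sq_eq] at h2
  simpa [opNorm, Matrix.mulVec, dotProduct] using h2

/-! ### The empirical coefficients -/

variable {d : ℕ} {B : ∀ l, Fin (sphDim d l) → Sph d → ℂ}

/-- The contribution of one observation `(w, z)` to the coefficient of `B l q`. -/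
def obsCoef (B : ∀ l, Fin (sphDim d l) → Sph d → ℂ) (fU : Rot d → ℝ) (l : ℕ)
    (q : Fin (sphDim d l)) (p : ℝ × Sph d) : ℂ :=
  (p.1 : ℂ) * ∑ r, (rotFourier B fU l)⁻¹ q r * conj (B l r p.2)

/-- The empirical coefficients of the weighted deconvolution estimator. -/
def empCoef (B : ∀ l, Fin (sphDim d l) → Sph d → ℂ) (fU : Rot d → ℝ) (n : ℕ) (w : ℕ → ℝ)
    (z : ℕ → Sph d) (l : ℕ) (q : Fin (sphDim d l)) : ℂ :=
  (n : ℂ)⁻¹ * ∑ i ∈ Finset.range n, obsCoef B fU l q (w i, z i)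

theorem measurable_obsCoef (hB : ∀ l, IsHarmONB d l (B l)) (fU : Rot d → ℝ) (l : ℕ)
    (q : Fin (sphDim d l)) : Measurable (obsCoef B fU l q) := by
  unfold obsCoef
  refine (Complex.measurable_ofReal.comp measurable_fst).mul
    (Finset.measurable_fun_sum _ fun r _ => measurable_const.mul ?_)
  exact ((Complex.continuous_conj.comp ((hB l).continuous r)).measurable).comp measurable_snd

/-- Exchanging the finite sums exhibits the kernel averages as truncated harmonic series, so that
everything afterwards concerns coefficients only. -/
theorem re_harmSum_empCoef (hB : ∀ l, IsHarmONB d l (B l)) (fU : Rot d → ℝ) (T : ℝ) (n : ℕ)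
    (w : ℕ → ℝ) (z : ℕ → Sph d) (x : Sph d) :
    (harmSum hB (empCoef B fU n w z) (⌊T⌋₊ + 1) x).re
      = (n : ℝ)⁻¹ * ∑ i ∈ Finset.range n, (kernelK B fU T x (z i)).re * w i := by
  have h : harmSum hB (empCoef B fU n w z) (⌊T⌋₊ + 1) x
      = (((n : ℝ)⁻¹ : ℝ) : ℂ) * ∑ i ∈ Finset.range n, (w i : ℂ) * kernelK B fU T x (z i) := by
    have hK : ∀ i, (w i : ℂ) * kernelK B fU T x (z i)
        = ∑ l ∈ Finset.range (⌊T⌋₊ + 1), ∑ q, obsCoef B fU l q (w i, z i) * B l q x := by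
      intro i
      rw [kernelK, Finset.mul_sum]
      refine Finset.sum_congr rfl fun l _ => ?_
      rw [Finset.mul_sum]
      exact Finset.sum_congr rfl fun q _ => (mul_assoc _ _ _).symm
    simp_rw [harmSum_apply, hK, empCoef]
    rw [Finset.sum_comm, Finset.mul_sum]
    refine Finset.sum_congr rfl fun l _ => ?_
    rw [Finset.sum_comm, Finset.mul_sum]
    refine Finset.sum_congr rfl fun q _ => ?_
    rw [← Finset.sum_mul]
    push_cast
    ring
  rw [h, Complex.re_ofReal_mul, Complex.re_sum]
  simp_rw [Complex.re_ofReal_mul, mul_comm]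

theorem sum_norm_obsCoef_sq_le (hd : 1 ≤ d) (hB : ∀ l, IsHarmONB d l (B l)) (fU : Rot d → ℝ)
    (l : ℕ) (p : ℝ × Sph d) :
    ∑ q, ‖obsCoef B fU l q p‖ ^ 2
      ≤ p.1 ^ 2 * (opNorm (rotFourier B fU l)⁻¹ ^ 2 * (diagConst d * ((l : ℝ) + 1) ^ (d - 1))) := by
  simp only [obsCoef, norm_mul, mul_pow, ← Finset.mul_sum, Complex.norm_real, Real.norm_eq_abs,
    sq_abs]
  gcongr
  refine (sum_norm_mulVec_sq_le _ _).trans ?_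
  gcongr
  simpa using (hB l).sum_norm_sq_le hd p.2

/-- The order of the variance of the estimators truncated at degree `N`. -/
def varOrder (B : ∀ l, Fin (sphDim d l) → Sph d → ℂ) (fU : Rot d → ℝ) (N : ℕ) : ℝ :=
  ∑ l ∈ Finset.range N, opNorm (rotFourier B fU l)⁻¹ ^ 2 * ((l : ℝ) + 1) ^ (d - 1)

/-- The squared distance between the coefficients `a` and those of `g` over the degrees `l < N`. -/
def coefErr (B : ∀ l, Fin (sphDim d l) → Sph d → ℂ) (g : Sph d → ℂ)
    (a : ∀ l, Fin (sphDim d l) → ℂ) (N : ℕ) : ℝ :=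
  ∑ l ∈ Finset.range N, ∑ q, ‖a l q - coef B g l q‖ ^ 2

section Sample

variable {Ω : Type*} [MeasurableSpace Ω] {P : Measure Ω}

/-- The general weight `W` covers both statistics: `W = 1` for the density and `W = Y` for the
numerator of the regression estimator. Only the second moment of the weight enters, because the
remaining factor is bounded uniformly in `z`. -/
theorem integral_coefErr_le [IsProbabilityMeasure P] (hd : 1 ≤ d) (hB : ∀ l, IsHarmONB d l (B l)) (fU : Rot d → ℝ)
    {W : ℕ → Ω → ℝ} {Z : ℕ → Ω → Sph d} {W₀ : Ω → ℝ} {Z₀ : Ω → Sph d}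
    (hind : iIndepFun (fun i ω => (W i ω, Z i ω)) P)
    (hid : ∀ i, IdentDistrib (fun ω => (W i ω, Z i ω)) (fun ω => (W₀ ω, Z₀ ω)) P P)
    (hW : Integrable (fun ω => W₀ ω ^ 2) P) {g : Sph d → ℂ}
    (hg : ∀ l q, ∫ ω, obsCoef B fU l q (W₀ ω, Z₀ ω) ∂P = coef B g l q)
    (N : ℕ) {n : ℕ} (hn : 1 ≤ n) :
    Integrable (fun ω => coefErr B g (empCoef B fU n (fun i => W i ω) fun i => Z i ω) N) P ∧
    ∫ ω, coefErr B g (empCoef B fU n (fun i => W i ω) fun i => Z i ω) N ∂P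
      ≤ (n : ℝ)⁻¹ * ((∫ ω, W₀ ω ^ 2 ∂P) * diagConst d * varOrder B fU N) := by
  have hmeas : ∀ l q, AEStronglyMeasurable (fun ω => obsCoef B fU l q (W₀ ω, Z₀ ω)) P :=
    fun l q => ((measurable_obsCoef hB fU l q).comp_aemeasurable
      (hid 0).aemeasurable_snd).aestronglyMeasurable
  have hsq : ∀ l q, Integrable (fun ω => ‖obsCoef B fU l q (W₀ ω, Z₀ ω)‖ ^ 2) P := by
    intro l q
    refine (hW.mul_const (opNorm (rotFourier B fU l)⁻¹ ^ 2 *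
      (diagConst d * ((l : ℝ) + 1) ^ (d - 1)))).mono' ((hmeas l q).norm.pow 2)
      (ae_of_all _ fun ω => ?_)
    rw [Real.norm_of_nonneg (sq_nonneg _)]
    exact (Finset.single_le_sum (f := fun q => ‖obsCoef B fU l q (W₀ ω, Z₀ ω)‖ ^ 2)
      (fun _ _ => sq_nonneg _) (Finset.mem_univ q)).trans
      (sum_norm_obsCoef_sq_le hd hB fU l (W₀ ω, Z₀ ω))
  have hL2 : ∀ l q, MemLp (fun ω => obsCoef B fU l q (W₀ ω, Z₀ ω)) 2 P := fun l q =>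
    (memLp_two_iff_integrable_sq_norm (hmeas l q)).2 (hsq l q)
  have hmain := fun l q => integral_norm_mean_sub_sq_le
    (hind.comp (fun _ => obsCoef B fU l q) fun _ => measurable_obsCoef hB fU l q)
    (fun i => (hid i).comp (measurable_obsCoef hB fU l q)) (hL2 l q) hn
  have hint : ∀ l q, Integrable (fun ω => ‖empCoef B fU n (fun i => W i ω) (fun i => Z i ω) l q
      - coef B g l q‖ ^ 2) P := by
    intro l q
    rw [← hg l q]
    exact (hmain l q).1
  refine ⟨integrable_finsetSum _ fun l _ => integrable_finsetSum _ fun q _ => hint l q, ?_⟩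
  unfold coefErr varOrder
  rw [integral_finsetSum _ fun l _ => integrable_finsetSum _ fun q _ => hint l q, Finset.mul_sum,
    Finset.mul_sum]
  refine Finset.sum_le_sum fun l _ => ?_
  rw [integral_finsetSum _ fun q _ => hint l q]
  calc ∑ q, ∫ ω, ‖empCoef B fU n (fun i => W i ω) (fun i => Z i ω) l q - coef B g l q‖ ^ 2 ∂P
      ≤ ∑ q, (n : ℝ)⁻¹ * ∫ ω, ‖obsCoef B fU l q (W₀ ω, Z₀ ω)‖ ^ 2 ∂P := by
        refine Finset.sum_le_sum fun q _ => ?_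
        rw [← hg l q]
        exact (hmain l q).2
    _ = (n : ℝ)⁻¹ * ∫ ω, ∑ q, ‖obsCoef B fU l q (W₀ ω, Z₀ ω)‖ ^ 2 ∂P := by
        rw [integral_finsetSum _ fun q _ => hsq l q, Finset.mul_sum]
    _ ≤ (n : ℝ)⁻¹ * ∫ ω, W₀ ω ^ 2 * (opNorm (rotFourier B fU l)⁻¹ ^ 2 *
          (diagConst d * ((l : ℝ) + 1) ^ (d - 1))) ∂P := by
        refine mul_le_mul_of_nonneg_left ?_ (by positivity)
        exact integral_mono (integrable_finsetSum _ fun q _ => hsq l q) (hW.mul_const _)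
          fun ω => sum_norm_obsCoef_sq_le hd hB fU l (W₀ ω, Z₀ ω)
    _ = _ := by
        rw [integral_mul_const]
        ring

/-! ### The expectation of the empirical coefficients -/

instance instSecondCountableTopologyRot (d : ℕ) : SecondCountableTopology (Rot d) :=
  have : SecondCountableTopology (Matrix (Fin (d + 1)) (Fin (d + 1)) ℝ) :=
    inferInstanceAs (SecondCountableTopology (Fin (d + 1) → Fin (d + 1) → ℝ))
  TopologicalSpace.Subtype.secondCountableTopology _

theorem continuous_rotCoeff (hB : ∀ l, IsHarmONB d l (B l)) (l : ℕ) (q r : Fin (sphDim d l)) :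
    Continuous (rotCoeff B l q r) := by
  have h : Continuous (Function.uncurry fun (u : Rot d) (x : Sph d) =>
      conj (B l q (rotate u x)) * B l r x) :=
    (Complex.continuous_conj.comp (((hB l).continuous q).comp continuous_rotate)).mul
      (((hB l).continuous r).comp continuous_snd)
  have := continuous_parametric_integral_of_continuous (μ := nu d) h isCompact_univ
  simp only [Measure.restrict_univ] at this
  exact this

theorem conj_rotate_eq_sum (hB : ∀ l, IsHarmONB d l (B l)) (l : ℕ) (q : Fin (sphDim d l))
    (u : Rot d) (x : Sph d) :
    conj (B l q (rotate u x)) = ∑ s, rotCoeff B l q s u * conj (B l s x) := by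
  obtain ⟨L, hL⟩ := exists_isoSph_eq_rotate u
  have h := (hB l).eq_sum (isoSph_comp_mem_sphHarm L ((hB l).mem q)) x
  rw [← hL, Function.comp_apply] at h
  rw [h, map_sum]
  refine Finset.sum_congr rfl fun s _ => ?_
  rw [map_mul, ← integral_conj]
  simp [rotCoeff]

/-- The rotated harmonic is expanded in the unrotated ones, and independence of `U` from `(X, W₀)`
factors each term. This is the convolution theorem for the rotational Fourier transform. -/
theorem integral_mul_conj_rotate (hB : ∀ l, IsHarmONB d l (B l)) {X : Ω → Sph d} {U : Ω → Rot d}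
    {fU : Rot d → ℝ} (hX : Measurable X) (hU : Measurable U) (hfU0 : ∀ u, 0 ≤ fU u)
    (hfU : AEStronglyMeasurable fU (mu d))
    (hmapU : P.map U = (mu d).withDensity fun u => ENNReal.ofReal (fU u))
    {W₀ : Ω → ℝ} (hWm : Measurable W₀) (hW : Integrable W₀ P)
    (hind : IndepFun U (fun ω => (X ω, W₀ ω)) P) {g : Sph d → ℂ}
    (hg : ∀ l q, ∫ ω, (W₀ ω : ℂ) * conj (B l q (X ω)) ∂P = coef B g l q)
    (l : ℕ) (q : Fin (sphDim d l)) :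
    ∫ ω, (W₀ ω : ℂ) * conj (B l q (rotate (U ω) (X ω))) ∂P
      = ∑ s, rotFourier B fU l q s * coef B g l s := by
  have hrot : ∀ s, ∫ ω, rotCoeff B l q s (U ω) ∂P = rotFourier B fU l q s := by
    intro s
    rw [← integral_map hU.aemeasurable (f := rotCoeff B l q s)
      (continuous_rotCoeff hB l q s).measurable.aestronglyMeasurable, hmapU,
      integral_withDensity_eq_integral_toReal_smul₀ hfU.aemeasurable.ennreal_ofReal (by simp)]
    simp [rotFourier, ENNReal.toReal_ofReal (hfU0 _)]
  have hconjm : ∀ s, Measurable fun x => conj (B l s x) := fun s =>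
    (Complex.continuous_conj.comp ((hB l).continuous s)).measurable
  have hpm : ∀ s, Measurable fun p : Sph d × ℝ => (p.2 : ℂ) * conj (B l s p.1) := fun s =>
    (Complex.measurable_ofReal.comp measurable_snd).mul ((hconjm s).comp measurable_fst)
  have hprod : ∀ s, ∫ ω, rotCoeff B l q s (U ω) * ((W₀ ω : ℂ) * conj (B l s (X ω))) ∂P
      = rotFourier B fU l q s * coef B g l s := by
    intro s
    have h1 := hind.integral_fun_comp_mul_comp (f := rotCoeff B l q s)
      (g := fun p : Sph d × ℝ => (p.2 : ℂ) * conj (B l s p.1)) hU.aemeasurable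
      (hX.prodMk hWm).aemeasurable (continuous_rotCoeff hB l q s).measurable.aestronglyMeasurable
      (hpm s).aestronglyMeasurable
    rw [h1, hrot, hg]
  have hbdd : ∀ f : Sph d → ℂ, Continuous f → ∃ C, ∀ x, ‖f x‖ ≤ C := fun f hf => by
    obtain ⟨C, hC⟩ := isCompact_univ.exists_bound_of_continuousOn hf.continuousOn
    exact ⟨C, fun x => hC x trivial⟩
  have hintW : ∀ s, Integrable (fun ω => (W₀ ω : ℂ) * conj (B l s (X ω))) P := by
    intro s
    obtain ⟨C, hC⟩ := hbdd _ (Complex.continuous_conj.comp ((hB l).continuous s))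
    exact hW.ofReal.mul_bdd (c := C) ((hconjm s).comp hX).aestronglyMeasurable
      (ae_of_all _ fun ω => hC (X ω))
  have hint : ∀ s, Integrable
      (fun ω => rotCoeff B l q s (U ω) * ((W₀ ω : ℂ) * conj (B l s (X ω)))) P := by
    intro s
    obtain ⟨C, hC⟩ := isCompact_univ.exists_bound_of_continuousOn
      (continuous_rotCoeff hB l q s).continuousOn
    exact (hintW s).bdd_mul (c := C) ((continuous_rotCoeff hB l q s).measurable.comp hU).aestronglyMeasurable
      (ae_of_all _ fun ω => hC (U ω) trivial)
  calc ∫ ω, (W₀ ω : ℂ) * conj (B l q (rotate (U ω) (X ω))) ∂P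
      = ∫ ω, ∑ s, rotCoeff B l q s (U ω) * ((W₀ ω : ℂ) * conj (B l s (X ω))) ∂P := by
        congr 1
        ext ω
        rw [conj_rotate_eq_sum hB, Finset.mul_sum]
        exact Finset.sum_congr rfl fun s _ => mul_left_comm _ _ _
    _ = _ := by
        rw [integral_finsetSum _ fun s _ => hint s]
        exact Finset.sum_congr rfl fun s _ => hprod s

theorem integral_obsCoef (hB : ∀ l, IsHarmONB d l (B l)) {X : Ω → Sph d} {U : Ω → Rot d}
    {fU : Rot d → ℝ} (hX : Measurable X) (hU : Measurable U) (hfU0 : ∀ u, 0 ≤ fU u)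
    (hfU : AEStronglyMeasurable fU (mu d))
    (hmapU : P.map U = (mu d).withDensity fun u => ENNReal.ofReal (fU u))
    (hinv : ∀ l, IsUnit (rotFourier B fU l))
    {W₀ : Ω → ℝ} (hWm : Measurable W₀) (hW : Integrable W₀ P)
    (hind : IndepFun U (fun ω => (X ω, W₀ ω)) P) {g : Sph d → ℂ}
    (hg : ∀ l q, ∫ ω, (W₀ ω : ℂ) * conj (B l q (X ω)) ∂P = coef B g l q)
    (l : ℕ) (q : Fin (sphDim d l)) :
    ∫ ω, obsCoef B fU l q (W₀ ω, rotate (U ω) (X ω)) ∂P = coef B g l q := by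
  have hZ : Measurable fun ω => rotate (U ω) (X ω) :=
    continuous_rotate.measurable.comp (hU.prodMk hX)
  have hint : ∀ r, Integrable (fun ω => (W₀ ω : ℂ) * conj (B l r (rotate (U ω) (X ω)))) P := by
    intro r
    have hc := Complex.continuous_conj.comp ((hB l).continuous r)
    obtain ⟨C, hC⟩ := isCompact_univ.exists_bound_of_continuousOn hc.continuousOn
    exact hW.ofReal.mul_bdd (c := C) (hc.measurable.comp hZ).aestronglyMeasurable
      (ae_of_all _ fun ω => hC _ trivial)
  have h1 := integral_mul_conj_rotate hB hX hU hfU0 hfU hmapU hWm hW hind hg l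
  have hunit : (rotFourier B fU l)⁻¹ * rotFourier B fU l = 1 :=
    Matrix.nonsing_inv_mul _ ((Matrix.isUnit_iff_isUnit_det _).1 (hinv l))
  calc ∫ ω, obsCoef B fU l q (W₀ ω, rotate (U ω) (X ω)) ∂P
      = ∫ ω, ∑ r, (rotFourier B fU l)⁻¹ q r *
          ((W₀ ω : ℂ) * conj (B l r (rotate (U ω) (X ω)))) ∂P := by
        congr 1
        ext ω
        rw [obsCoef, Finset.mul_sum]
        exact Finset.sum_congr rfl fun s _ => mul_left_comm _ _ _
    _ = ∑ r, (rotFourier B fU l)⁻¹ q r * ∑ s, rotFourier B fU l r s * coef B g l s := by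
        rw [integral_finsetSum _ fun r _ => (hint r).const_mul _]
        simp_rw [integral_const_mul, h1]
    _ = ((rotFourier B fU l)⁻¹.mulVec ((rotFourier B fU l).mulVec (coef B g l))) q := rfl
    _ = coef B g l q := by rw [Matrix.mulVec_mulVec, hunit, Matrix.one_mulVec]

end Sample

end SphereDeconv
end

noncomputable section

namespace SphereDeconv

variable {d : ℕ} {B : ∀ l, Fin (sphDim d l) → Sph d → ℂ}

/-! ### Error bounds in terms of the coefficients -/

theorem norm_toL2_sq (h : C(Sph d, ℂ)) : ‖toL2 d h‖ ^ 2 = ∫ x, ‖h x‖ ^ 2 ∂(nu d) := by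
  have h1 : inner ℂ (toL2 d h) (toL2 d h) = ((‖toL2 d h‖ : ℝ) : ℂ) ^ 2 :=
    inner_self_eq_norm_sq_to_K (𝕜 := ℂ) (toL2 d h)
  rw [ContinuousMap.inner_toLp] at h1
  simp_rw [Complex.mul_conj', ← Complex.ofReal_pow] at h1
  rw [integral_complex_ofReal] at h1
  exact_mod_cast h1.symm

/-- The target is real, so taking the real part can only reduce the pointwise error. -/
theorem ise_re_le (h gC : C(Sph d, ℂ)) {g : Sph d → ℝ} (hg : ∀ x, gC x = g x) :
    ise (fun x => (h x).re) g ≤ ENNReal.ofReal (‖toL2 d (h - gC)‖ ^ 2) := by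
  have hc : Continuous fun x => ‖(h - gC) x‖ ^ 2 := (h - gC).continuous.norm.pow 2
  rw [norm_toL2_sq, ofReal_integral_eq_lintegral_ofReal
    (hc.integrable_of_hasCompactSupport (HasCompactSupport.of_compactSpace _))
    (ae_of_all _ fun x => sq_nonneg _)]
  refine lintegral_mono fun x => ENNReal.ofReal_le_ofReal ?_
  gcongr
  rw [ContinuousMap.sub_apply, hg]
  simpa using Complex.abs_re_le_norm (h x - g x)

theorem ise_re_harmSum_le (hd : 1 ≤ d) (hB : ∀ l, IsHarmONB d l (B l)) {k : ℕ}
    {gC G : C(Sph d, ℂ)} (hG : HasLaplacianPow B k gC G) {g : Sph d → ℝ} (hg : ∀ x, gC x = g x)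
    (a : ∀ l, Fin (sphDim d l) → ℂ) {N : ℕ} (hN : 1 ≤ N) :
    ise (fun x => (harmSum hB a N x).re) g
      ≤ ENNReal.ofReal (2 * coefErr B gC a N + 2 * (((N : ℝ) ^ (4 * k))⁻¹ * ‖toL2 d G‖ ^ 2)) := by
  refine (ise_re_le _ _ hg).trans (ENNReal.ofReal_le_ofReal ?_)
  have h1 : harmSum hB a N - gC = harmSum hB (fun l q => a l q - coef B gC l q) N
      - (gC - harmSum hB (coef B gC) N) := by
    rw [harmSum_sub]
    abel
  have h2 := norm_toL2_harmSum_sq hd hB (fun l q => a l q - coef B gC l q) N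
  have h3 := norm_toL2_sub_harmSum_sq_le hd hB hG hN
  rw [h1, map_sub, coefErr, ← h2]
  have h4 := norm_sub_le (toL2 d (harmSum hB (fun l q => a l q - coef B gC l q) N))
    (toL2 d (gC - harmSum hB (coef B gC) N))
  have h5 := pow_le_pow_left₀ (norm_nonneg _) h4 2
  have h6 := add_sq_le (a := ‖toL2 d (harmSum hB (fun l q => a l q - coef B gC l q) N)‖)
    (b := ‖toL2 d (gC - harmSum hB (coef B gC) N)‖)
  linarith

/-- The stochastic part is bounded pointwise by Cauchy–Schwarz, the truncation error by its supremum
norm. This yields the uniform lower bound on `fHat`. -/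
theorem abs_re_harmSum_sub_le (hd : 1 ≤ d) (hB : ∀ l, IsHarmONB d l (B l))
    {gC : C(Sph d, ℂ)} {g : Sph d → ℝ} (hg : ∀ x, gC x = g x)
    (a : ∀ l, Fin (sphDim d l) → ℂ) (N : ℕ) (x : Sph d) :
    |(harmSum hB a N x).re - g x| ≤ √(coefErr B gC a N * (diagConst d * (N : ℝ) ^ d))
      + ‖gC - harmSum hB (coef B gC) N‖ := by
  have h1 : (harmSum hB a N x).re - g x = (harmSum hB (fun l q => a l q - coef B gC l q) N x
      - (gC - harmSum hB (coef B gC) N) x).re := by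
    rw [harmSum_sub, ContinuousMap.sub_apply, ContinuousMap.sub_apply, hg]
    simp
  rw [h1]
  refine (Complex.abs_re_le_norm _).trans ((norm_sub_le _ _).trans (add_le_add ?_
    (ContinuousMap.norm_coe_le_norm _ x)))
  exact Real.le_sqrt_of_sq_le (norm_harmSum_apply_sq_le hd hB _ N x)

/-- From `gh / fh - m = fh⁻¹ ((gh - m f) - m (fh - f))`. The constant 8 is `2² * 2`: the square of
`fh⁻¹ ≤ 2 / c`, times the factor from squaring a sum. -/
theorem ise_ratio_le {fh gh f m : Sph d → ℝ} (hghc : Continuous gh) (hfc : Continuous f)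
    (hmc : Continuous m) {c M : ℝ} (hc : 0 < c)
    (hm : ∀ x, |m x| ≤ M) (hfh : ∀ x, c / 2 ≤ fh x) :
    ise (fun x => (fh x)⁻¹ * gh x) m
      ≤ ENNReal.ofReal (8 / c ^ 2) * ise gh (fun x => m x * f x)
        + ENNReal.ofReal (8 / c ^ 2 * M ^ 2) * ise fh f := by
  have hpt : ∀ x, |(fh x)⁻¹ * gh x - m x| ^ 2
      ≤ 8 / c ^ 2 * |gh x - m x * f x| ^ 2 + 8 / c ^ 2 * M ^ 2 * |fh x - f x| ^ 2 := by
    intro x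
    have hpos : 0 < fh x := lt_of_lt_of_le (half_pos hc) (hfh x)
    have h1 : (fh x)⁻¹ * gh x - m x = (fh x)⁻¹ * ((gh x - m x * f x) - m x * (fh x - f x)) := by
      field_simp
      ring
    have h2 : (fh x)⁻¹ ≤ 2 / c := by
      rw [inv_le_comm₀ hpos (by positivity), inv_div]
      exact hfh x
    have h3 : |(gh x - m x * f x) - m x * (fh x - f x)|
        ≤ |gh x - m x * f x| + M * |fh x - f x| := by
      refine (abs_sub _ _).trans ?_
      rw [abs_mul]
      gcongr
      exact hm x
    have hM : 0 ≤ M := (abs_nonneg _).trans (hm x)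
    rw [h1, abs_mul, mul_pow, abs_of_pos (inv_pos.2 hpos)]
    calc (fh x)⁻¹ ^ 2 * |(gh x - m x * f x) - m x * (fh x - f x)| ^ 2
        ≤ (2 / c) ^ 2 * (|gh x - m x * f x| + M * |fh x - f x|) ^ 2 := by gcongr
      _ ≤ (2 / c) ^ 2 * (2 * (|gh x - m x * f x| ^ 2 + (M * |fh x - f x|) ^ 2)) := by
          gcongr
          exact add_sq_le
      _ = _ := by ring
  calc ise (fun x => (fh x)⁻¹ * gh x) m
      ≤ ∫⁻ x, (ENNReal.ofReal (8 / c ^ 2) * ENNReal.ofReal (|gh x - m x * f x| ^ 2)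
          + ENNReal.ofReal (8 / c ^ 2 * M ^ 2) * ENNReal.ofReal (|fh x - f x| ^ 2)) ∂(nu d) := by
        refine lintegral_mono fun x => (ENNReal.ofReal_le_ofReal (hpt x)).trans ?_
        rw [← ENNReal.ofReal_mul (by positivity), ← ENNReal.ofReal_mul (by positivity)]
        exact ENNReal.ofReal_add_le
    _ = _ := by
        rw [lintegral_add_left, lintegral_const_mul' _ _ ENNReal.ofReal_ne_top,
          lintegral_const_mul' _ _ ENNReal.ofReal_ne_top]
        · rfl
        · exact ((((hghc.sub (hmc.mul hfc)).abs.pow 2).measurable).ennreal_ofReal).const_mul _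

/-! ### Rates in probability -/

section Rates

variable {Ω : Type*} [MeasurableSpace Ω] {P : Measure Ω}

theorem exists_measure_lt_le [IsProbabilityMeasure P] {Q : ℕ → Ω → ℝ} {s : ℕ → ℝ} {C : ℝ} (hC : 0 ≤ C)
    (hQ : ∀ n ω, 0 ≤ Q n ω)
    (h : ∀ᶠ n in atTop, 0 < s n ∧ Integrable (Q n) P ∧ ∫ ω, Q n ω ∂P ≤ C * s n)
    {δ : ℝ} (hδ : 0 < δ) :
    ∃ M : ℝ, 0 < M ∧ ∀ᶠ n in atTop, P {ω | M * s n < Q n ω} ≤ ENNReal.ofReal δ := by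
  -- Markov's inequality needs `M ≥ C / δ`; the added 1 keeps `M` positive when `C = 0`.
  refine ⟨C / δ + 1, by positivity, ?_⟩
  filter_upwards [h] with n hn
  obtain ⟨hs, hint, hle⟩ := hn
  have hM : 0 < C / δ + 1 := by positivity
  have h1 := mul_meas_ge_le_integral_of_nonneg (ae_of_all P (hQ n)) hint ((C / δ + 1) * s n)
  have h2 : P.real {ω | (C / δ + 1) * s n ≤ Q n ω} ≤ δ := by
    have h3 : (C / δ + 1) * s n * P.real {ω | (C / δ + 1) * s n ≤ Q n ω}
        ≤ (C / δ + 1) * s n * δ := by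
      refine (h1.trans hle).trans ?_
      have : (C / δ + 1) * s n * δ = C * s n + s n * δ := by field_simp
      rw [this]
      have := mul_pos hs hδ
      linarith
    exact le_of_mul_le_mul_left h3 (by positivity)
  calc P {ω | (C / δ + 1) * s n < Q n ω} ≤ P {ω | (C / δ + 1) * s n ≤ Q n ω} :=
        measure_mono fun ω hω => by
          rw [Set.mem_ofPred_eq] at hω ⊢
          exact hω.le
    _ = ENNReal.ofReal (P.real {ω | (C / δ + 1) * s n ≤ Q n ω}) := by simp
    _ ≤ ENNReal.ofReal δ := ENNReal.ofReal_le_ofReal h2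

theorem IsCk.continuous {s : ℕ} {f : Sph d → ℝ} (hf : IsCk s f) : Continuous f :=
  ContMDiff.continuous hf

/-- The complexification of a continuous function. -/
def complexC (g : Sph d → ℝ) (hg : Continuous g) : C(Sph d, ℂ) :=
  ⟨fun x => (g x : ℂ), Complex.continuous_ofReal.comp hg⟩

theorem integral_comp_X {X : Ω → Sph d} {fX : Sph d → ℝ} (hX : Measurable X)
    (hfX0 : ∀ x, 0 ≤ fX x) (hfX : Continuous fX)
    (hmap : P.map X = (nu d).withDensity fun x => ENNReal.ofReal (fX x)) {h : Sph d → ℂ}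
    (hh : Continuous h) : ∫ ω, h (X ω) ∂P = ∫ x, (fX x : ℂ) * h x ∂(nu d) := by
  rw [← integral_map hX.aemeasurable (f := h) hh.measurable.aestronglyMeasurable, hmap,
    integral_withDensity_eq_integral_toReal_smul₀ hfX.measurable.ennreal_ofReal.aemeasurable
      (by simp)]
  simp [ENNReal.toReal_ofReal (hfX0 _)]

/-- A bounded function of `X` can be pulled out of the conditional expectation, which vanishes. The
complex case is split into real and imaginary parts. -/
theorem integral_mul_comp_X_eq_zero [IsProbabilityMeasure P] {X : Ω → Sph d} {ε : Ω → ℝ} (hX : Measurable X)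
    (hε : Integrable ε P) (hcond : P[ε | MeasurableSpace.comap X inferInstance] =ᵐ[P] 0)
    {h : Sph d → ℂ} (hh : Continuous h) : ∫ ω, (ε ω : ℂ) * h (X ω) ∂P = 0 := by
  have hreal : ∀ φ : Sph d → ℝ, Continuous φ →
      Integrable (fun ω => φ (X ω) * ε ω) P ∧ ∫ ω, φ (X ω) * ε ω ∂P = 0 := by
    intro φ hφ
    obtain ⟨C, hC⟩ := isCompact_univ.exists_bound_of_continuousOn hφ.continuousOn
    have hle : MeasurableSpace.comap X inferInstance ≤ (inferInstance : MeasurableSpace Ω) :=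
      hX.comap_le
    have hm : StronglyMeasurable[MeasurableSpace.comap X inferInstance] (φ ∘ X) :=
      (hφ.measurable.comp (comap_measurable X)).stronglyMeasurable
    have h1 := condExp_stronglyMeasurable_mul_of_bound hle hm hε C
      (ae_of_all _ fun ω => hC (X ω) trivial)
    refine ⟨hε.bdd_mul (c := C) (hφ.measurable.comp hX).aestronglyMeasurable
      (ae_of_all _ fun ω => hC (X ω) trivial), ?_⟩
    have h2 : ∫ ω, (φ ∘ X * ε) ω ∂P = 0 := by
      rw [← integral_condExp hle, integral_congr_ae h1]
      refine integral_eq_zero_of_ae ?_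
      filter_upwards [hcond] with ω hω
      simp [hω]
    exact h2
  have hre := hreal _ (Complex.continuous_re.comp hh)
  have him := hreal _ (Complex.continuous_im.comp hh)
  have h1 : ∀ ω, (ε ω : ℂ) * h (X ω)
      = (((h (X ω)).re * ε ω : ℝ) : ℂ) + (((h (X ω)).im * ε ω : ℝ) : ℂ) * Complex.I := by
    intro ω
    conv_lhs => rw [← Complex.re_add_im (h (X ω))]
    push_cast
    ring
  simp_rw [h1]
  rw [integral_add hre.1.ofReal (him.1.ofReal.mul_const _), integral_mul_const,
    integral_complex_ofReal, integral_complex_ofReal]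
  have e1 : ∫ ω, (h (X ω)).re * ε ω ∂P = 0 := hre.2
  have e2 : ∫ ω, (h (X ω)).im * ε ω ∂P = 0 := him.2
  rw [e1, e2]
  simp

theorem integral_coefErr_density_le [IsProbabilityMeasure P] (hd : 1 ≤ d) (hB : ∀ l, IsHarmONB d l (B l))
    {X : Ω → Sph d} {U : Ω → Rot d} {fX : Sph d → ℝ} {fU : Rot d → ℝ} {Z : ℕ → Ω → Sph d}
    (hmodel : IsErrorModel P X U fX fU Z) (hinv : ∀ l, IsUnit (rotFourier B fU l))
    (hfX : Continuous fX) (N : ℕ) {n : ℕ} (hn : 1 ≤ n) :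
    Integrable (fun ω => coefErr B (complexC fX hfX)
      (empCoef B fU n (fun _ => 1) fun i => Z i ω) N) P ∧
    ∫ ω, coefErr B (complexC fX hfX) (empCoef B fU n (fun _ => 1) fun i => Z i ω) N ∂P
      ≤ (n : ℝ)⁻¹ * (1 * diagConst d * varOrder B fU N) := by
  have hpair : Measurable fun z : Sph d => ((1 : ℝ), z) := measurable_const.prodMk measurable_id
  have hpair' : Measurable fun z : Sph d => (z, (1 : ℝ)) := measurable_id.prodMk measurable_const
  have h := integral_coefErr_le hd hB fU (W := fun _ _ => 1) (W₀ := fun _ => 1)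
    (Z₀ := fun ω => rotate (U ω) (X ω)) (P := P) (g := complexC fX hfX)
    (hmodel.iIndep_Z.comp (fun _ z => ((1 : ℝ), z)) fun _ => hpair)
    (fun i => (hmodel.identDistrib_Z i).comp hpair) (by simp)
    (integral_obsCoef hB hmodel.measurable_X hmodel.measurable_U hmodel.fU_nonneg
      hmodel.fU_memLp.aestronglyMeasurable hmodel.map_U hinv measurable_const
      (integrable_const _) (hmodel.indep_UX.comp measurable_id hpair') fun l q => ?_) N hn
  · simpa using h
  · simp only [Complex.ofReal_one, one_mul]
    exact integral_comp_X hmodel.measurable_X hmodel.fX_nonneg hfX hmodel.map_X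
      (Complex.continuous_conj.comp ((hB l).continuous q))

theorem integral_coefErr_regression_le [IsProbabilityMeasure P] (hd : 1 ≤ d) (hB : ∀ l, IsHarmONB d l (B l))
    {X : Ω → Sph d} {U : Ω → Rot d} {fX : Sph d → ℝ} {fU : Rot d → ℝ} {Z : ℕ → Ω → Sph d}
    (hmodel : IsErrorModel P X U fX fU Z) (hinv : ∀ l, IsUnit (rotFourier B fU l))
    (hfX : Continuous fX) {m : Sph d → ℝ} {ε : Ω → ℝ} {Y : ℕ → Ω → ℝ}
    (hreg : IsRegressionModel P X U m ε Z Y) (hm : Continuous m)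
    (hY : Integrable (fun ω => (m (X ω) + ε ω) ^ 2) P) (N : ℕ) {n : ℕ} (hn : 1 ≤ n) :
    Integrable (fun ω => coefErr B (complexC (fun x => m x * fX x) (hm.mul hfX))
      (empCoef B fU n (fun i => Y i ω) fun i => Z i ω) N) P ∧
    ∫ ω, coefErr B (complexC (fun x => m x * fX x) (hm.mul hfX))
        (empCoef B fU n (fun i => Y i ω) fun i => Z i ω) N ∂P
      ≤ (n : ℝ)⁻¹ * ((∫ ω, (m (X ω) + ε ω) ^ 2 ∂P) * diagConst d * varOrder B fU N) := by
  have hmX : Measurable fun ω => m (X ω) := hm.measurable.comp hmodel.measurable_X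
  have hmXi : Integrable (fun ω => m (X ω)) P := by
    obtain ⟨C, hC⟩ := isCompact_univ.exists_bound_of_continuousOn hm.continuousOn
    exact Integrable.of_bound hmX.aestronglyMeasurable C (ae_of_all _ fun ω => hC (X ω) trivial)
  refine integral_coefErr_le hd hB fU (W₀ := fun ω => m (X ω) + ε ω) hreg.iIndep_YZ hreg.identDistrib_YZ hY
    (integral_obsCoef hB hmodel.measurable_X hmodel.measurable_U hmodel.fU_nonneg
      hmodel.fU_memLp.aestronglyMeasurable hmodel.map_U hinv (hmX.add hreg.measurable_ε)
      (hmXi.add hreg.integrable_ε)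
      (hreg.indep_U.comp (ψ := fun p : Sph d × ℝ => (p.1, m p.1 + p.2)) measurable_id
        (measurable_fst.prodMk ((hm.measurable.comp measurable_fst).add measurable_snd)))
      fun l q => ?_) N hn
  have hc : Continuous fun x => conj (B l q x) :=
    Complex.continuous_conj.comp ((hB l).continuous q)
  obtain ⟨C, hC⟩ := isCompact_univ.exists_bound_of_continuousOn hc.continuousOn
  have hcX : AEStronglyMeasurable (fun ω => conj (B l q (X ω))) P :=
    (hc.measurable.comp hmodel.measurable_X).aestronglyMeasurable
  have hCX : ∀ᵐ ω ∂P, ‖conj (B l q (X ω))‖ ≤ C := ae_of_all _ fun ω => hC (X ω) trivial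
  have hi1 : Integrable (fun ω => (m (X ω) : ℂ) * conj (B l q (X ω))) P :=
    hmXi.ofReal.mul_bdd (c := C) hcX hCX
  have hi2 : Integrable (fun ω => (ε ω : ℂ) * conj (B l q (X ω))) P :=
    hreg.integrable_ε.ofReal.mul_bdd (c := C) hcX hCX
  have hadd : ∀ ω, ((m (X ω) + ε ω : ℝ) : ℂ) * conj (B l q (X ω))
      = (m (X ω) : ℂ) * conj (B l q (X ω)) + (ε ω : ℂ) * conj (B l q (X ω)) := fun ω => by
    rw [Complex.ofReal_add, add_mul]
  refine (integral_congr_ae (ae_of_all _ hadd)).trans ?_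
  rw [integral_add hi1 hi2, integral_mul_comp_X_eq_zero hmodel.measurable_X hreg.integrable_ε
    hreg.condExp_ε hc, add_zero, integral_comp_X hmodel.measurable_X hmodel.fX_nonneg hfX
    hmodel.map_X (h := fun x => (m x : ℂ) * conj (B l q x))
    ((Complex.continuous_ofReal.comp hm).mul hc)]
  simp only [coef, complexC, ContinuousMap.coe_mk, Complex.ofReal_mul]
  congr 1
  ext x
  ring

end Rates

end SphereDeconv
end

/-! ### From coefficient errors to rates for both estimators -/

noncomputable section

namespace SphereDeconv

variable {d : ℕ} {B : ∀ l, Fin (sphDim d l) → Sph d → ℂ}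

section Rates

variable {Ω : Type*} [MeasurableSpace Ω] {P : Measure Ω}

theorem coefErr_nonneg (g : Sph d → ℂ) (a : ∀ l, Fin (sphDim d l) → ℂ) (N : ℕ) :
    0 ≤ coefErr B g a N :=
  Finset.sum_nonneg fun _ _ => Finset.sum_nonneg fun _ _ => sq_nonneg _

theorem fHat_eq (hB : ∀ l, IsHarmONB d l (B l)) (fU : Rot d → ℝ) (T : ℝ) (n : ℕ)
    (z : ℕ → Sph d) :
    fHat B fU T n z = fun x => (harmSum hB (empCoef B fU n (fun _ => 1) z) (⌊T⌋₊ + 1) x).re := by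
  ext x
  rw [re_harmSum_empCoef]
  simp [fHat]

theorem mHat_eq (hB : ∀ l, IsHarmONB d l (B l)) (fU : Rot d → ℝ) (T : ℝ) (n : ℕ)
    (z : ℕ → Sph d) (y : ℕ → ℝ) :
    mHat B fU T n z y = fun x => (fHat B fU T n z x)⁻¹ *
      (harmSum hB (empCoef B fU n y z) (⌊T⌋₊ + 1) x).re := by
  ext x
  rw [re_harmSum_empCoef]
  rfl

theorem inv_floor_pow_le {T : ℝ} (hT : 0 < T) (k : ℕ) :
    (((⌊T⌋₊ + 1 : ℕ) : ℝ) ^ (4 * k))⁻¹ ≤ T ^ (-4 * (k : ℝ)) := by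
  have h : T ^ (-4 * (k : ℝ)) = (T ^ (4 * k))⁻¹ := by
    rw [← Real.rpow_natCast, ← Real.rpow_neg hT.le]
    congr 1
    push_cast
    ring
  rw [h]
  gcongr
  push_cast
  exact (Nat.lt_floor_add_one T).le

/-- Separates probability from analysis: off an event of small probability, the required bound is
deterministic. -/
theorem isBigOp_of_subset {V : ℕ → Ω → ℝ≥0∞} {r : ℕ → ℝ} {bad : ℝ → ℕ → Set Ω}
    (hbad : ∀ δ : ℝ, 0 < δ → ∃ M : ℝ, 0 < M ∧ ∀ᶠ n in atTop, P (bad M n) ≤ ENNReal.ofReal δ)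
    (h : ∀ M : ℝ, 0 < M → ∃ M' : ℝ, 0 < M' ∧ ∀ᶠ n in atTop, ∀ ω, ω ∉ bad M n →
      V n ω ≤ ENNReal.ofReal (M' * r n)) : IsBigOp P V r := by
  intro δ hδ
  obtain ⟨M, hM, hb⟩ := hbad δ hδ
  obtain ⟨M', hM', hV⟩ := h M hM
  refine ⟨M', hM', ?_⟩
  filter_upwards [hb, hV] with n h1 h2
  refine (measure_mono fun ω hω => ?_).trans h1
  by_contra hc
  rw [Set.mem_ofPred_eq] at hω
  exact absurd (h2 ω hc) (not_le.2 hω)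

theorem exists_measure_union_le {Q Q' : ℕ → Ω → ℝ} {s : ℕ → ℝ} (hs : ∀ᶠ n in atTop, 0 < s n)
    (hQ : ∀ δ : ℝ, 0 < δ → ∃ M : ℝ, 0 < M ∧
      ∀ᶠ n in atTop, P {ω | M * s n < Q n ω} ≤ ENNReal.ofReal δ)
    (hQ' : ∀ δ : ℝ, 0 < δ → ∃ M : ℝ, 0 < M ∧
      ∀ᶠ n in atTop, P {ω | M * s n < Q' n ω} ≤ ENNReal.ofReal δ) {δ : ℝ} (hδ : 0 < δ) :
    ∃ M : ℝ, 0 < M ∧ ∀ᶠ n in atTop,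
      P ({ω | M * s n < Q n ω} ∪ {ω | M * s n < Q' n ω}) ≤ ENNReal.ofReal δ := by
  obtain ⟨M, hM, h⟩ := hQ _ (half_pos hδ)
  obtain ⟨M', hM', h'⟩ := hQ' _ (half_pos hδ)
  refine ⟨max M M', lt_max_of_lt_left hM, ?_⟩
  filter_upwards [h, h', hs] with n h1 h2 hs
  calc P ({ω | max M M' * s n < Q n ω} ∪ {ω | max M M' * s n < Q' n ω})
      ≤ P {ω | M * s n < Q n ω} + P {ω | M' * s n < Q' n ω} := by
        refine (measure_union_le _ _).trans (add_le_add (measure_mono fun ω hω => ?_)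
          (measure_mono fun ω hω => ?_))
        · rw [Set.mem_ofPred_eq] at hω ⊢
          exact (mul_le_mul_of_nonneg_right (le_max_left _ _) hs.le).trans_lt hω
        · rw [Set.mem_ofPred_eq] at hω ⊢
          exact (mul_le_mul_of_nonneg_right (le_max_right _ _) hs.le).trans_lt hω
    _ ≤ ENNReal.ofReal (δ / 2) + ENNReal.ofReal (δ / 2) := add_le_add h1 h2
    _ = ENNReal.ofReal δ := by
        rw [← ENNReal.ofReal_add (by positivity) (by positivity), add_halves]

theorem isCk_mul {s : ℕ} {f g : Sph d → ℝ} (hf : IsCk s f) (hg : IsCk s g) :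
    IsCk s fun x => f x * g x :=
  ContMDiff.mul (I := 𝓘(ℝ, ℝ)) (I' := 𝓡 d) hf hg

/-- The growth condition on the inverse matrices enters only through the bound `K * v n` for
`varOrder`. The stochastic error has order `s n = n⁻¹ * v n` and the truncation error order `T n ^
(-4k)`. The limit hypothesis says that `s n` remains negligible after the pointwise loss `T n ^ d`;
it serves only to keep `fHat` away from zero. -/
theorem l2Rates_of_varOrder_le [IsProbabilityMeasure P] (hd : 1 ≤ d) {k : ℕ} (hk : d < 4 * k)
    (hB : ∀ l, IsHarmONB d l (B l))
    {X : Ω → Sph d} {U : Ω → Rot d} {fX : Sph d → ℝ} {fU : Rot d → ℝ} {Z : ℕ → Ω → Sph d}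
    (hmodel : IsErrorModel P X U fX fU Z) (hinv : ∀ l, IsUnit (rotFourier B fU l))
    (hfX : IsCk (2 * k) fX) {T : ℕ → ℝ} (hTpos : ∀ n, 0 < T n) (hT : Tendsto T atTop atTop)
    {v : ℕ → ℝ} (hv : ∀ n, 0 < v n) {K : ℝ} (hK : 0 < K)
    (hvar : ∀ᶠ n in atTop, varOrder B fU (⌊T n⌋₊ + 1) ≤ K * v n)
    (hlim : Tendsto (fun n : ℕ => (n : ℝ)⁻¹ * v n * T n ^ d) atTop (𝓝 0)) :
    L2Rates P k B X U fX fU Z T (fun n => T n ^ (-4 * (k : ℝ)) + (n : ℝ)⁻¹ * v n) := by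
  have hfc := hfX.continuous
  set s : ℕ → ℝ := fun n => (n : ℝ)⁻¹ * v n with hs_def
  have hs : ∀ᶠ n in atTop, 0 < s n := by
    filter_upwards [eventually_ge_atTop 1] with n hn
    exact mul_pos (inv_pos.2 (by exact_mod_cast hn)) (hv n)
  set Qf : ℕ → Ω → ℝ := fun n ω => coefErr B (complexC fX hfc)
    (empCoef B fU n (fun _ => 1) fun i => Z i ω) (⌊T n⌋₊ + 1) with hQf
  have hmarkov : ∀ (Q : ℕ → Ω → ℝ) (C : ℝ), 0 ≤ C → (∀ n ω, 0 ≤ Q n ω) →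
      (∀ n, 1 ≤ n → Integrable (Q n) P ∧ ∫ ω, Q n ω ∂P
        ≤ (n : ℝ)⁻¹ * (C * diagConst d * varOrder B fU (⌊T n⌋₊ + 1))) →
      ∀ δ : ℝ, 0 < δ → ∃ M : ℝ, 0 < M ∧
        ∀ᶠ n in atTop, P {ω | M * s n < Q n ω} ≤ ENNReal.ofReal δ := by
    intro Q C hC hQ0 hQ δ hδ
    have hD := diagConst_pos d
    refine exists_measure_lt_le (C := C * diagConst d * K) (by positivity) hQ0 ?_ hδ
    filter_upwards [hs, hvar, eventually_ge_atTop 1] with n h1 h2 h3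
    refine ⟨h1, (hQ n h3).1, (hQ n h3).2.trans ?_⟩
    calc (n : ℝ)⁻¹ * (C * diagConst d * varOrder B fU (⌊T n⌋₊ + 1))
        ≤ (n : ℝ)⁻¹ * (C * diagConst d * (K * v n)) := by gcongr
      _ = C * diagConst d * K * s n := by rw [hs_def]; ring
  have hf_prob := hmarkov Qf 1 zero_le_one (fun n ω => coefErr_nonneg _ _ _) fun n hn =>
    integral_coefErr_density_le hd hB hmodel hinv hfc _ hn
  have hbias : ∀ (g : Sph d → ℝ) (hg : IsCk (2 * k) g), ∃ C : ℝ, 0 ≤ C ∧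
      ∀ (a : ∀ l, Fin (sphDim d l) → ℂ) (n : ℕ) (M : ℝ), 0 < M → 0 < s n →
        coefErr B (complexC g hg.continuous) a (⌊T n⌋₊ + 1) ≤ M * s n →
        ise (fun x => (harmSum hB a (⌊T n⌋₊ + 1) x).re) g
          ≤ ENNReal.ofReal ((2 * M + 2 * C) * (T n ^ (-4 * (k : ℝ)) + s n)) := by
    intro g hg
    obtain ⟨G, hG⟩ := exists_hasLaplacianPow hd hB hg
    refine ⟨‖toL2 d G‖ ^ 2, sq_nonneg _, fun a n M hM hsn ha => ?_⟩
    refine (ise_re_harmSum_le hd hB (gC := complexC g hg.continuous) hG (fun x => rfl) a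
      (Nat.le_add_left 1 _)).trans (ENNReal.ofReal_le_ofReal ?_)
    have h1 := mul_le_mul_of_nonneg_right (inv_floor_pow_le (hTpos n) k) (sq_nonneg ‖toL2 d G‖)
    have h2 : 0 ≤ T n ^ (-4 * (k : ℝ)) := (Real.rpow_pos_of_pos (hTpos n) _).le
    have h3 := mul_nonneg hM.le h2
    have h4 := mul_nonneg (sq_nonneg ‖toL2 d G‖) hsn.le
    nlinarith
  obtain ⟨Cf, hCf0, hCf⟩ := hbias fX hfX
  refine ⟨?_, ?_⟩
  · simp_rw [fHat_eq hB]
    refine isBigOp_of_subset (bad := fun M n => {ω | M * s n < Qf n ω}) hf_prob fun M hM =>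
      ⟨2 * M + 2 * Cf, by positivity, ?_⟩
    filter_upwards [hs] with n hsn ω hω
    exact hCf _ n M hM hsn (not_lt.1 hω)
  · rintro m ε Y hreg hm ⟨c, hc, hcf⟩ ⟨hY, -⟩
    have hmc := hm.continuous
    have hmf : IsCk (2 * k) fun x => m x * fX x := isCk_mul hm hfX
    obtain ⟨Cm, hCm0, hCm⟩ := hbias _ hmf
    obtain ⟨A, hA⟩ := isCompact_univ.exists_bound_of_continuousOn hmc.continuousOn
    have hA' : ∀ x, |m x| ≤ A := fun x => hA x trivial
    set Qm : ℕ → Ω → ℝ := fun n ω => coefErr B (complexC (fun x => m x * fX x) (hmc.mul hfc))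
      (empCoef B fU n (fun i => Y i ω) fun i => Z i ω) (⌊T n⌋₊ + 1) with hQm
    have hm_prob := hmarkov Qm (∫ ω, (m (X ω) + ε ω) ^ 2 ∂P) (integral_nonneg fun _ => sq_nonneg _)
      (fun n ω => coefErr_nonneg _ _ _) fun n hn =>
      integral_coefErr_regression_le hd hB hmodel hinv hfc hreg hmc hY _ hn
    obtain ⟨G, hG⟩ := exists_hasLaplacianPow hd hB hfX
    have hN : Tendsto (fun n => ⌊T n⌋₊ + 1) atTop atTop :=
      (tendsto_add_atTop_nat 1).comp (tendsto_nat_floor_atTop.comp hT)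
    have hsup : Tendsto (fun n => ‖complexC fX hfc
        - harmSum hB (coef B (complexC fX hfc)) (⌊T n⌋₊ + 1)‖) atTop (𝓝 0) :=
      (tendsto_norm_sub_harmSum hd hB hk (g := complexC fX hfc) hG).comp hN
    simp_rw [mHat_eq hB]
    refine isBigOp_of_subset
      (bad := fun M n => {ω | M * s n < Qf n ω} ∪ {ω | M * s n < Qm n ω})
      (fun δ hδ => exists_measure_union_le hs hf_prob hm_prob hδ) fun M hM => ?_
    -- On the good event this is the uniform error of `fHat`, and `c / 2` leaves `fHat ≥ c / 2`. The
    -- factor `2 ^ d` below comes from `⌊T n⌋₊ + 1 ≤ 2 * T n`.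
    have hsmall : ∀ᶠ n in atTop,
        √(M * s n * (diagConst d * ((⌊T n⌋₊ + 1 : ℕ) : ℝ) ^ d))
          + ‖complexC fX hfc - harmSum hB (coef B (complexC fX hfc)) (⌊T n⌋₊ + 1)‖ ≤ c / 2 := by
      have h1 : Tendsto (fun n : ℕ => √(M * diagConst d * 2 ^ d * ((n : ℝ)⁻¹ * v n * T n ^ d))
          + ‖complexC fX hfc - harmSum hB (coef B (complexC fX hfc)) (⌊T n⌋₊ + 1)‖)
          atTop (𝓝 0) := by
        have := ((hlim.const_mul (M * diagConst d * 2 ^ d)).sqrt).add hsup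
        simpa using this
      filter_upwards [h1.eventually_le_const (half_pos hc), hs, hT.eventually_ge_atTop 1]
        with n h2 hsn hT1
      refine le_trans ?_ h2
      gcongr ?_ + _
      apply Real.sqrt_le_sqrt
      have hD := diagConst_pos d
      have h3 : ((⌊T n⌋₊ + 1 : ℕ) : ℝ) ^ d ≤ (2 * T n) ^ d := by
        gcongr
        push_cast
        linarith [Nat.floor_le (hTpos n).le]
      calc M * s n * (diagConst d * ((⌊T n⌋₊ + 1 : ℕ) : ℝ) ^ d)
          ≤ M * s n * (diagConst d * (2 * T n) ^ d) := by gcongr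
        _ = M * diagConst d * 2 ^ d * ((n : ℝ)⁻¹ * v n * T n ^ d) := by
            rw [mul_pow, hs_def]
            ring
    refine ⟨8 / c ^ 2 * (2 * M + 2 * Cm) + 8 / c ^ 2 * A ^ 2 * (2 * M + 2 * Cf), by positivity, ?_⟩
    filter_upwards [hs, hsmall] with n hsn hn ω hω
    rw [Set.mem_union, not_or] at hω
    have hω1 : Qf n ω ≤ M * s n := not_lt.1 hω.1
    have hω2 : Qm n ω ≤ M * s n := not_lt.1 hω.2
    have hlow : ∀ x, c / 2 ≤ fHat B fU (T n) n (fun i => Z i ω) x := by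
      intro x
      have h1 := abs_re_harmSum_sub_le hd hB (gC := complexC fX hfc) (g := fX) (fun x => rfl)
        (empCoef B fU n (fun _ => 1) fun i => Z i ω) (⌊T n⌋₊ + 1) x
      have h2 : √(Qf n ω * (diagConst d * ((⌊T n⌋₊ + 1 : ℕ) : ℝ) ^ d))
          ≤ √(M * s n * (diagConst d * ((⌊T n⌋₊ + 1 : ℕ) : ℝ) ^ d)) := by
        have hD := diagConst_pos d
        gcongr
      have h3 := h1.trans ((add_le_add_left h2 _).trans hn)
      rw [fHat_eq hB]
      have h4 := (abs_le.1 h3).1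
      have h5 := hcf x
      linarith
    have hr : 0 ≤ T n ^ (-4 * (k : ℝ)) + s n :=
      add_nonneg (Real.rpow_pos_of_pos (hTpos n) _).le hsn.le
    refine (ise_ratio_le (Complex.continuous_re.comp (ContinuousMap.continuous _)) hfc hmc hc hA'
      hlow).trans ?_
    have h1 := hCm (empCoef B fU n (fun i => Y i ω) fun i => Z i ω) n M hM hsn hω2
    have h2 := hCf (empCoef B fU n (fun _ => 1) fun i => Z i ω) n M hM hsn hω1
    rw [← fHat_eq hB] at h2
    calc _ ≤ ENNReal.ofReal (8 / c ^ 2) *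
            ENNReal.ofReal ((2 * M + 2 * Cm) * (T n ^ (-4 * (k : ℝ)) + s n))
          + ENNReal.ofReal (8 / c ^ 2 * A ^ 2) *
            ENNReal.ofReal ((2 * M + 2 * Cf) * (T n ^ (-4 * (k : ℝ)) + s n)) :=
          add_le_add (mul_le_mul_right h1 _) (mul_le_mul_right h2 _)
      _ = _ := by
          rw [← ENNReal.ofReal_mul (by positivity), ← ENNReal.ofReal_mul (by positivity),
            ← ENNReal.ofReal_add (by positivity) (by positivity)]
          congr 1
          ring

end Rates

/-! ### The order of the variance -/

/-- The degrees from `t₀` to `T` number at most `2 T`, and each contributes at most a multiple of `ψ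
T` by monotonicity. Those below `t₀`, among them degree 0 where `hop` says nothing, add up to a
constant, absorbed using `T * ψ T ≥ ψ t₀`. -/
theorem varOrder_le (fU : Rot d → ℝ) {ψ : ℝ → ℝ} {C t₀ : ℝ} (ht₀ : 1 ≤ t₀)
    (hC : 0 < C)
    (hop : ∀ l : ℕ, 1 ≤ l → opNorm (rotFourier B fU l)⁻¹ ^ 2 * (l : ℝ) ^ (d - 1) ≤ C * ψ l)
    (hpos : 0 < ψ t₀) (hmono : ∀ s t, t₀ ≤ s → s ≤ t → ψ s ≤ ψ t) :
    ∃ K : ℝ, 0 < K ∧ ∀ T, t₀ ≤ T → varOrder B fU (⌊T⌋₊ + 1) ≤ K * (T * ψ T) := by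
  set A : ℕ → ℝ := fun l => opNorm (rotFourier B fU l)⁻¹ ^ 2 * ((l : ℝ) + 1) ^ (d - 1) with hA
  have hA0 : ∀ l, 0 ≤ A l := fun l => by positivity
  set L := ⌈t₀⌉₊
  set S := ∑ l ∈ Finset.range L, A l with hS
  have hS0 : 0 ≤ S := Finset.sum_nonneg fun l _ => hA0 l
  refine ⟨S / ψ t₀ + 2 * (2 ^ (d - 1) * C), by positivity, fun T hT => ?_⟩
  have hT1 : 1 ≤ T := ht₀.trans hT
  have hψT : ψ t₀ ≤ ψ T := hmono _ _ le_rfl hT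
  have hψ0 : 0 < ψ T := hpos.trans_le hψT
  have hterm : ∀ l ∈ Finset.range (⌊T⌋₊ + 1),
      A l ≤ (if l < L then A l else 0) + 2 ^ (d - 1) * C * ψ T := by
    intro l hl
    split_ifs with hlL
    · have : 0 ≤ 2 ^ (d - 1) * C * ψ T := by positivity
      linarith
    · have hlt : t₀ ≤ l := Nat.ceil_le.1 (not_lt.1 hlL)
      have hl1 : 1 ≤ l := by exact_mod_cast ht₀.trans hlt
      have hlT : (l : ℝ) ≤ T := by
        have : l ≤ ⌊T⌋₊ := Nat.lt_succ_iff.1 (Finset.mem_range.1 hl)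
        exact (Nat.cast_le.2 this).trans (Nat.floor_le (by linarith))
      have hl1' : (1 : ℝ) ≤ l := by exact_mod_cast hl1
      rw [zero_add]
      calc A l ≤ opNorm (rotFourier B fU l)⁻¹ ^ 2 * (2 * (l : ℝ)) ^ (d - 1) := by
            change opNorm (rotFourier B fU l)⁻¹ ^ 2 * ((l : ℝ) + 1) ^ (d - 1) ≤ _
            gcongr
            linarith
        _ = 2 ^ (d - 1) * (opNorm (rotFourier B fU l)⁻¹ ^ 2 * (l : ℝ) ^ (d - 1)) := by
            rw [mul_pow]; ring
        _ ≤ 2 ^ (d - 1) * (C * ψ l) := mul_le_mul_of_nonneg_left (hop l hl1) (by positivity)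
        _ ≤ 2 ^ (d - 1) * (C * ψ T) := 
            mul_le_mul_of_nonneg_left
              (mul_le_mul_of_nonneg_left (hmono _ _ hlt hlT) hC.le) (by positivity)
        _ = _ := by ring
  have hfirst : ∑ l ∈ Finset.range (⌊T⌋₊ + 1), (if l < L then A l else 0) ≤ S := by
    rw [← Finset.sum_filter]
    refine Finset.sum_le_sum_of_subset_of_nonneg (fun l hl => ?_) fun l _ _ => hA0 l
    exact Finset.mem_range.2 (Finset.mem_filter.1 hl).2
  have hSψ : S ≤ S / ψ t₀ * (T * ψ T) := by
    rw [div_mul_eq_mul_div, le_div_iff₀ hpos]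
    gcongr
    nlinarith
  calc varOrder B fU (⌊T⌋₊ + 1)
      ≤ ∑ l ∈ Finset.range (⌊T⌋₊ + 1), ((if l < L then A l else 0) + 2 ^ (d - 1) * C * ψ T) :=
        Finset.sum_le_sum hterm
    _ ≤ S + (⌊T⌋₊ + 1 : ℕ) * (2 ^ (d - 1) * C * ψ T) := by
        rw [Finset.sum_add_distrib, Finset.sum_const, Finset.card_range, nsmul_eq_mul]
        gcongr
    _ ≤ S / ψ t₀ * (T * ψ T) + (2 * T) * (2 ^ (d - 1) * C * ψ T) := by
        gcongr
        push_cast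
        linarith [Nat.floor_le (show 0 ≤ T by linarith)]
    _ = _ := by ring

/-- Only a negative power `a` is a danger. On the logarithmic scale it loses at most `|a| (log t -
log s)`, while the exponent gains at least `γ β s^β (log t - log s)`; this wins once `s^β ≥ |a| / (γ
β)`. -/
theorem exists_monotone_rpow_mul_exp (a : ℝ) {β γ t₁ : ℝ} (hβ : 0 < β) (hγ : 0 < γ) {w : ℝ → ℝ}
    (hw1 : ∀ t, t₁ ≤ t → 1 ≤ w t) (hw : ∀ s t, t₁ ≤ s → s ≤ t → w s ≤ w t) :
    ∃ t₀ : ℝ, 1 ≤ t₀ ∧ ∀ s t, t₀ ≤ s → s ≤ t →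
      s ^ a * Real.exp (γ * s ^ β * w s) ≤ t ^ a * Real.exp (γ * t ^ β * w t) := by
  obtain ⟨t₂, ht₂⟩ := ((tendsto_rpow_atTop hβ).eventually_ge_atTop (|a| / (γ * β))).exists_forall_of_atTop
  refine ⟨max 1 (max t₁ t₂), le_max_left _ _, fun s t hs hst => ?_⟩
  have hs1 : 1 ≤ s := (le_max_left _ _).trans hs
  have hst₁ : t₁ ≤ s := (le_max_left _ _).trans ((le_max_right _ _).trans hs)
  have hst₂ : t₂ ≤ s := (le_max_right _ _).trans ((le_max_right _ _).trans hs)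
  have hs0 : 0 < s := by linarith
  have ht0 : 0 < t := by linarith
  have hlog : Real.log s ≤ Real.log t := Real.log_le_log hs0 hst
  have hsβ := ht₂ s hst₂
  rw [div_le_iff₀ (by positivity)] at hsβ
  -- The inequality `1 + x ≤ exp x` at `x = β (log t - log s)`, multiplied by `s ^ β`.
  have hinc : s ^ β * (β * (Real.log t - Real.log s)) ≤ t ^ β - s ^ β := by
    have h1 : t ^ β = s ^ β * Real.exp (β * (Real.log t - Real.log s)) := by
      rw [Real.rpow_def_of_pos hs0, Real.rpow_def_of_pos ht0, ← Real.exp_add]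
      congr 1
      ring
    have h2 := Real.add_one_le_exp (β * (Real.log t - Real.log s))
    have h3 : 0 ≤ s ^ β := (Real.rpow_pos_of_pos hs0 _).le
    rw [h1]
    nlinarith
  have hpowle : s ^ β ≤ t ^ β := Real.rpow_le_rpow hs0.le hst hβ.le
  have hmain : a * Real.log s + γ * s ^ β * w s ≤ a * Real.log t + γ * t ^ β * w t := by
    have h1 : γ * (t ^ β - s ^ β) ≤ γ * t ^ β * w t - γ * s ^ β * w s := by
      have h2 := hw s t hst₁ hst
      have h3 := hw1 t (hst₁.trans hst)
      have h4 : 0 ≤ s ^ β := (Real.rpow_pos_of_pos hs0 _).le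
      have h5 : s ^ β * w s ≤ s ^ β * w t := mul_le_mul_of_nonneg_left h2 h4
      have h6 : (t ^ β - s ^ β) * 1 ≤ (t ^ β - s ^ β) * w t :=
        mul_le_mul_of_nonneg_left h3 (by linarith)
      nlinarith
    have h7 : γ * (s ^ β * (β * (Real.log t - Real.log s))) ≤ γ * (t ^ β - s ^ β) :=
      mul_le_mul_of_nonneg_left hinc hγ.le
    have h8 : |a| * (Real.log t - Real.log s)
        ≤ s ^ β * (γ * β) * (Real.log t - Real.log s) :=
      mul_le_mul_of_nonneg_right hsβ (by linarith)
    have h9 : -(|a|) * (Real.log t - Real.log s) ≤ a * (Real.log t - Real.log s) :=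
      mul_le_mul_of_nonneg_right (neg_abs_le a) (by linarith)
    nlinarith
  rw [Real.rpow_def_of_pos hs0, Real.rpow_def_of_pos ht0, ← Real.exp_add, ← Real.exp_add]
  apply Real.exp_le_exp.2
  linarith

/-- The assumed limit is squared, and `T n ^ (2α + 2d)` is split into the variance order and the
pointwise loss `T n ^ d`. -/
theorem tendsto_inv_mul_sq {T E : ℕ → ℝ} (hT : ∀ n, 0 < T n) {α : ℝ}
    (h : Tendsto (fun n : ℕ => (n : ℝ) ^ (-(1 / 2) : ℝ) * T n ^ (α + d) * E n) atTop (𝓝 0)) :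
    Tendsto (fun n : ℕ => (n : ℝ)⁻¹ * (T n ^ (2 * α + d) * E n ^ 2) * T n ^ d) atTop (𝓝 0) := by
  have h2 := h.pow 2
  rw [zero_pow two_ne_zero] at h2
  refine h2.congr fun n => ?_
  have e1 : ((n : ℝ) ^ (-(1 / 2) : ℝ)) ^ 2 = (n : ℝ)⁻¹ := by
    rw [← Real.rpow_natCast, ← Real.rpow_mul (Nat.cast_nonneg n), ← Real.rpow_neg_one]
    norm_num
  have e2 : (T n ^ (α + d)) ^ 2 = T n ^ (2 * α + d) * T n ^ d := by
    rw [← Real.rpow_natCast, ← Real.rpow_natCast (T n) d, ← Real.rpow_mul (hT n).le,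
      ← Real.rpow_add (hT n)]
    congr 1
    push_cast
    ring
  rw [mul_pow, mul_pow, e1, e2]
  ring

end SphereDeconv
end

/-! ### The polynomial and exponential growth regimes -/

noncomputable section

namespace SphereDeconv

variable {d : ℕ} {B : ∀ l, Fin (sphDim d l) → Sph d → ℂ}

theorem opNorm_sq_mul_pow_le (hd : 1 ≤ d) {N l : ℕ} (hl : 1 ≤ l) {A : Matrix (Fin N) (Fin N) ℂ}
    {c α e : ℝ} (h : opNorm A ≤ c * (l : ℝ) ^ α * e) :
    opNorm A ^ 2 * (l : ℝ) ^ (d - 1) ≤ c ^ 2 * ((l : ℝ) ^ (2 * α + d - 1) * e ^ 2) := by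
  have hl0 : (0 : ℝ) < l := by exact_mod_cast hl
  have h1 : opNorm A ^ 2 ≤ (c * (l : ℝ) ^ α * e) ^ 2 := pow_le_pow_left₀ (norm_nonneg _) h 2
  have h2 : (l : ℝ) ^ (2 * α + d - 1) = ((l : ℝ) ^ α) ^ 2 * (l : ℝ) ^ (d - 1) := by
    rw [← Real.rpow_natCast, ← Real.rpow_natCast (l : ℝ) (d - 1), ← Real.rpow_mul hl0.le,
      ← Real.rpow_add hl0]
    congr 1
    push_cast [Nat.cast_sub hd]
    ring
  calc opNorm A ^ 2 * (l : ℝ) ^ (d - 1)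
      ≤ (c * (l : ℝ) ^ α * e) ^ 2 * (l : ℝ) ^ (d - 1) := by gcongr
    _ = _ := by rw [h2]; ring

section Rates

variable {Ω : Type*} [MeasurableSpace Ω] {P : Measure Ω}

theorem l2Rates_of_opNorm_le [IsProbabilityMeasure P] (hd : 1 ≤ d) {k : ℕ} (hk : d < 4 * k)
    (hB : ∀ l, IsHarmONB d l (B l))
    {X : Ω → Sph d} {U : Ω → Rot d} {fX : Sph d → ℝ} {fU : Rot d → ℝ} {Z : ℕ → Ω → Sph d}
    (hmodel : IsErrorModel P X U fX fU Z) (hinv : ∀ l, IsUnit (rotFourier B fU l))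
    (hfX : IsCk (2 * k) fX) {T : ℕ → ℝ} (hTpos : ∀ n, 0 < T n) (hT : Tendsto T atTop atTop)
    {α c₁ : ℝ} (hc₁ : 0 < c₁) {E : ℝ → ℝ} (hE : ∀ t, 0 < E t)
    (hop : ∀ l : ℕ, 1 ≤ l → opNorm (rotFourier B fU l)⁻¹ ≤ c₁ * (l : ℝ) ^ α * E l)
    {t₀ : ℝ} (ht₀ : 1 ≤ t₀) (hmono : ∀ s t, t₀ ≤ s → s ≤ t →
      s ^ (2 * α + d - 1) * E s ^ 2 ≤ t ^ (2 * α + d - 1) * E t ^ 2)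
    (hlim : Tendsto (fun n : ℕ => (n : ℝ) ^ (-(1 / 2) : ℝ) * T n ^ (α + d) * E (T n))
      atTop (𝓝 0)) :
    L2Rates P k B X U fX fU Z T
      (fun n => T n ^ (-4 * (k : ℝ)) + (n : ℝ)⁻¹ * (T n ^ (2 * α + d) * E (T n) ^ 2)) := by
  obtain ⟨K, hK, hvar⟩ := varOrder_le (B := B) fU
    (ψ := fun t => t ^ (2 * α + d - 1) * E t ^ 2) ht₀ (pow_pos hc₁ 2)
    (fun l hl => opNorm_sq_mul_pow_le hd hl (hop l hl))
    (mul_pos (Real.rpow_pos_of_pos (by linarith) _) (pow_pos (hE _) 2)) hmono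
  refine l2Rates_of_varOrder_le hd hk hB hmodel hinv hfX hTpos hT
    (fun n => mul_pos (Real.rpow_pos_of_pos (hTpos n) _) (pow_pos (hE _) 2)) hK ?_
    (tendsto_inv_mul_sq hTpos hlim)
  filter_upwards [hT.eventually_ge_atTop t₀] with n hn
  refine (hvar _ hn).trans_eq ?_
  have h : T n * T n ^ (2 * α + d - 1) = T n ^ (2 * α + d) := by
    rw [Real.rpow_sub_one (hTpos n).ne', mul_div_cancel₀ _ (hTpos n).ne']
  rw [← mul_assoc (T n), h]

/-- The factor `w` treats both exponential regimes together: `w = 1` in (b) and `w t = log t - ξ₁`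
in (c). In the latter `w` may be negative for small `t`, so its bounds are required only beyond
`t₁`. -/
theorem l2Rates_of_opNorm_le_exp [IsProbabilityMeasure P] (hd : 1 ≤ d) {k : ℕ} (hk : d < 4 * k)
    (hB : ∀ l, IsHarmONB d l (B l))
    {X : Ω → Sph d} {U : Ω → Rot d} {fX : Sph d → ℝ} {fU : Rot d → ℝ} {Z : ℕ → Ω → Sph d}
    (hmodel : IsErrorModel P X U fX fU Z) (hinv : ∀ l, IsUnit (rotFourier B fU l))
    (hfX : IsCk (2 * k) fX) {T : ℕ → ℝ} (hTpos : ∀ n, 0 < T n) (hT : Tendsto T atTop atTop)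
    {α β γ c₁ : ℝ} (hβ : 0 < β) (hγ : 0 < γ) (hc₁ : 0 < c₁) {w : ℝ → ℝ} {t₁ : ℝ}
    (hw1 : ∀ t, t₁ ≤ t → 1 ≤ w t) (hw : ∀ s t, t₁ ≤ s → s ≤ t → w s ≤ w t)
    (hop : ∀ l : ℕ, 1 ≤ l → opNorm (rotFourier B fU l)⁻¹ ≤
      c₁ * (l : ℝ) ^ α * Real.exp (γ * (l : ℝ) ^ β * w l))
    (hlim : Tendsto (fun n : ℕ => (n : ℝ) ^ (-(1 / 2) : ℝ) * T n ^ (α + d) *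
      Real.exp (γ * T n ^ β * w (T n))) atTop (𝓝 0)) :
    L2Rates P k B X U fX fU Z T
      (fun n => T n ^ (-4 * (k : ℝ)) +
        (n : ℝ)⁻¹ * T n ^ (2 * α + d) * Real.exp (2 * γ * T n ^ β * w (T n))) := by
  have hsq : ∀ t : ℝ, Real.exp (γ * t ^ β * w t) ^ 2 = Real.exp (2 * γ * t ^ β * w t) := by
    intro t
    rw [← Real.exp_nat_mul]
    congr 1
    push_cast
    ring
  obtain ⟨t₀, ht₀, hmono⟩ := exists_monotone_rpow_mul_exp (2 * α + d - 1) hβ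
    (mul_pos two_pos hγ) hw1 hw
  have h := l2Rates_of_opNorm_le hd hk hB hmodel hinv hfX hTpos hT hc₁
    (E := fun t => Real.exp (γ * t ^ β * w t)) (fun t => Real.exp_pos _) hop ht₀
    (by simpa only [hsq] using hmono) hlim
  simp only [hsq] at h
  simpa only [mul_assoc] using h

end Rates

end SphereDeconv
end

theorem mainTheorem1 {d : ℕ} (hd : 1 ≤ d) {k : ℕ} (hk : (d : ℝ) / 4 < k)
    (B : ∀ l, Fin (sphDim d l) → Sph d → ℂ) (hB : ∀ l, IsHarmONB d l (B l))
    {Ω : Type*} [MeasurableSpace Ω] (P : Measure Ω) [IsProbabilityMeasure P]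
    (X : Ω → Sph d) (U : Ω → Rot d) (fX : Sph d → ℝ) (fU : Rot d → ℝ) (Z : ℕ → Ω → Sph d)
    (hmodel : IsErrorModel P X U fX fU Z)
    (hinv : ∀ l, IsUnit (rotFourier B fU l))
    (hfX : IsCk (2 * k) fX)
    (T : ℕ → ℝ) (hTpos : ∀ n, 0 < T n) (hT : Tendsto T atTop atTop) :
    (∀ β c₁ : ℝ, 0 ≤ β → 0 < c₁ →
      (∀ l : ℕ, 1 ≤ l → opNorm (rotFourier B fU l)⁻¹ ≤ c₁ * (l : ℝ) ^ β) →
      Tendsto (fun n : ℕ => (n : ℝ) ^ (-(1 / 2) : ℝ) * T n ^ (β + d)) atTop (𝓝 0) →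
      L2Rates P k B X U fX fU Z T
        (fun n => T n ^ (-4 * (k : ℝ)) + (n : ℝ)⁻¹ * T n ^ (2 * β + d))) ∧
    (∀ β c₁ γ α : ℝ, 0 < β → 0 < c₁ → 0 < γ →
      (∀ l : ℕ, 1 ≤ l → opNorm (rotFourier B fU l)⁻¹ ≤
        c₁ * (l : ℝ) ^ α * Real.exp (γ * (l : ℝ) ^ β)) →
      Tendsto (fun n : ℕ => (n : ℝ) ^ (-(1 / 2) : ℝ) * T n ^ (α + d) *
        Real.exp (γ * T n ^ β)) atTop (𝓝 0) →
      L2Rates P k B X U fX fU Z T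
        (fun n => T n ^ (-4 * (k : ℝ)) +
          (n : ℝ)⁻¹ * T n ^ (2 * α + d) * Real.exp (2 * γ * T n ^ β))) ∧
    (∀ β c₁ γ α ξ₁ : ℝ, 0 < β → 0 < c₁ → 0 < γ →
      (∀ l : ℕ, 1 ≤ l → opNorm (rotFourier B fU l)⁻¹ ≤
        c₁ * (l : ℝ) ^ α * Real.exp (γ * (l : ℝ) ^ β * (Real.log l - ξ₁))) →
      Tendsto (fun n : ℕ => (n : ℝ) ^ (-(1 / 2) : ℝ) * T n ^ (α + d) *
        Real.exp (γ * T n ^ β * (Real.log (T n) - ξ₁))) atTop (𝓝 0) →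
      L2Rates P k B X U fX fU Z T
        (fun n => T n ^ (-4 * (k : ℝ)) +
          (n : ℝ)⁻¹ * T n ^ (2 * α + d) *
            Real.exp (2 * γ * T n ^ β * (Real.log (T n) - ξ₁)))) := by
  have hk4 : d < 4 * k := by
    have h : (d : ℝ) < 4 * k := by linarith
    exact_mod_cast h
  refine ⟨fun β c₁ hβ hc₁ hop hlim => ?_, fun β c₁ γ α hβ hc₁ hγ hop hlim => ?_,
    fun β c₁ γ α ξ₁ hβ hc₁ hγ hop hlim => ?_⟩
  · have h := l2Rates_of_opNorm_le hd hk4 hB hmodel hinv hfX hTpos hT hc₁ (E := fun _ => 1)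
      (fun _ => one_pos) (by simpa using hop) le_rfl (fun s t hs hst => by
        have hd' : (1 : ℝ) ≤ d := by exact_mod_cast hd
        have := Real.rpow_le_rpow (by linarith) hst (show 0 ≤ 2 * β + d - 1 by linarith)
        simpa using this) (by simpa using hlim)
    simpa using h
  · have h := l2Rates_of_opNorm_le_exp hd hk4 hB hmodel hinv hfX hTpos hT hβ hγ hc₁
      (w := fun _ => 1) (t₁ := 0) (fun _ _ => le_rfl) (fun _ _ _ _ => le_rfl)
      (by simpa only [mul_one] using hop) (by simpa only [mul_one] using hlim)
    simpa only [mul_one] using h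
  · refine l2Rates_of_opNorm_le_exp hd hk4 hB hmodel hinv hfX hTpos hT hβ hγ hc₁
      -- Beyond `exp (1 + ξ₁)` one has `log t - ξ₁ ≥ 1`.
      (w := fun t => Real.log t - ξ₁) (t₁ := Real.exp (1 + ξ₁)) (fun t ht => ?_)
      (fun s t hs hst => ?_) hop hlim
    · have := (Real.le_log_iff_exp_le ((Real.exp_pos _).trans_le ht)).2 ht
      linarith
    · have := Real.log_le_log ((Real.exp_pos _).trans_le hs) hst
      linarith
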